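/- For $f\in\{0,1\}^n$ let $f(a)=\sum_i f_i a_i \bmod 2$ be its parity function on $\{0,1\}^n$, and let $\mathrm{PAR}(k)$ (the $k$-parities on $n$ variables) be the class of all $f\in\{0,1\}^n$ of Hamming weight $k$. A (randomized) algorithm learns $\mathrm{PAR}(k)$ over a distribution $\mathcal D$ on $\{0,1\}^n$ with approximation parameter $\varepsilon$, confidence parameter $\delta$, sample complexity $S$ and running time $T$ if, for every target $f\in \mathrm{PAR}(k)$, given access to independent examples $(a,f(a))$ with $a\sim\mathcal D$ and to fair coins, it always halts within time $T$ after drawing at most $S$ examples, and with probability at least $1-\delta$ it outputs an $f^*\in\{0,1\}^n$ with $\Pr_{a\sim\mathcal D}[f(a)\ne f^*(a)]<\varepsilon$. (If $\mathcal D$ is uniform and $\varepsilon=\frac12$, this last condition says $f^*=f$.) Algorithms are programs of a random access machine with logarithmic cost, in which the overhead of a counted loop is one unit per iteration and receiving an example takes time $n+1$. **Theorem.** There are absolute constants $C,c\in\mathbb N$ such that the following holds. Let $k,t:\mathbb N\to\mathbb N$ be constructible in quadratic time (computable from $n$ in time $O(n^2)$, without examples or coins) and satisfy $\log\log n\ll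 k(n)\ll t(n)\ll n$, where $g\ll h$ means $g(n)/h(n)\to 0$. Let $\gamma>4$ be a constant (for instance $\gamma=4.01$). Write $k=k(n)$, $t=t(n)$ and $$S_n(\delta)=\frac{kn}{t}+\log_2\binom tk+\log_2\frac1\delta,\qquad T_n(\delta)=e^{-k/\gamma}\binom tk\, n^{c}\,\max\Bigl(1,\log_2\frac1\delta\Bigr).$$ 1. (Uniform examples.) There are a single algorithm, with input $n$ and $\lceil\log_2(1/\delta)\rceil$, and an $n_0$ such that for all $n\ge n_0$ and all $\delta\in(0,1)$ the algorithm learns $\mathrm{PAR}(k)$ over the uniform distribution on $\{0,1\}^n$ with approximation parameter $\frac12$, confidence parameter $\delta$, sample complexity $C\cdot S_n(\delta)$ and running time $T_n(\delta)$. 2. (Arbitrary distributions.) There are a single algorithm, with input $n$, $\lceil\log_2(1/\delta)\rceil$ and $\lceil1/\varepsilon\rceil$, and an $n_0$ such that for all $n\ge n_0$, all $\delta,\varepsilon\in(0,1)$ and every distribution $\mathcal D$ on $\{0,1\}^n$ the algorithm learns $\mathrm{PAR}(k)$ over $\mathcal D$ with approximation parameter $\varepsilon$, confidence parameter $\delta$,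 sample complexity $C\cdot S_n(\delta)/\varepsilon$ and running time $T_n(\delta)/\varepsilon$. -/

import Mathlib

open Filter Asymptotics MeasureTheory

/-! ## The machine model: a probabilistic random access machine with logarithmic cost

A program is a fixed (finite) piece of code, written in a structured imperative language. It works
on natural-number registers and on indirectly addressed memory banks ("arrays"). Every operation is
charged by the bit lengths of all the numbers it handles, addresses included. Randomness enters
through fair coins and through the example source. -/

namespace RAM

/-- Binary arithmetical operations (comparisons return `0` or `1`, subtraction is truncated). -/
inductive Op where
  | add | sub | mul | div | mod | lt | eq

/-- The value of a binary operation. -/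
def Op.eval : Op → ℕ → ℕ → ℕ
  | .add, a, b => a + b
  | .sub, a, b => a - b
  | .mul, a, b => a * b
  | .div, a, b => a / b
  | .mod, a, b => a % b
  | .lt, a, b => if a < b then 1 else 0
  | .eq, a, b => if a = b then 1 else 0

/-- Expressions: constants, registers, array entries, and operations. The names of registers and
arrays are part of the program text; only the index into an array is computed. -/
inductive Expr where
  | const (c : ℕ)
  | reg (x : ℕ)
  | get (a : ℕ) (i : Expr)
  | op (o : Op) (e₁ e₂ : Expr)

/-- Commands. -/
inductive Cmd where
  /-- do nothing -/
  | skip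
  /-- register `x := e` -/
  | set (x : ℕ) (e : Expr)
  /-- array entry `a[i] := e` -/
  | store (a : ℕ) (i e : Expr)
  /-- sequential composition -/
  | seq (p q : Cmd)
  /-- if `e ≠ 0` then `p` else `q` -/
  | ite (e : Expr) (p q : Cmd)
  /-- while `e ≠ 0` do `p` -/
  | while (e : Expr) (p : Cmd)
  /-- evaluate `e` once, then run `p` that many times -/
  | rep (e : Expr) (p : Cmd)
  /-- register `x :=` a fresh fair random bit -/
  | coin (x : ℕ)
  /-- draw the next labelled example: the point goes to array `a`, the label to register `x` -/
  | draw (a x : ℕ)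

/-- A configuration: registers, arrays, and the numbers of examples drawn and of coins flipped. -/
structure State where
  reg : ℕ → ℕ
  arr : ℕ → ℕ → ℕ
  drawn : ℕ
  flipped : ℕ

/-- The initial configuration: the input in registers `0, 1, …`, everything else zero. -/
def init (input : List ℕ) : State where
  reg := fun x => input.getD x 0
  arr := fun _ _ => 0
  drawn := 0
  flipped := 0

/-- The value of an expression. -/
def Expr.eval (s : State) : Expr → ℕ
  | .const c => c
  | .reg x => s.reg x
  | .get a i => s.arr a (i.eval s)
  | .op o e₁ e₂ => o.eval (e₁.eval s) (e₂.eval s)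

/-- The cost of evaluating an expression: one per node of the expression plus the bit lengths of all
the values, operands and addresses involved. -/
def Expr.cost (s : State) : Expr → ℕ
  | .const c => 1 + c.size
  | .reg x => 1 + (s.reg x).size
  | .get a i => i.cost s + 1 + (i.eval s).size + (s.arr a (i.eval s)).size
  | .op _ e₁ e₂ => e₁.cost s + e₂.cost s + 1 + (e₁.eval s).size + (e₂.eval s).size

/-- What a run depends on besides its input: the successive points of the example source, and the
outcomes of the coin flips. -/
abbrev Randomness (n : ℕ) := (ℕ → Fin n → ZMod 2) × (ℕ → Bool)

/-- `Exec f w p s s' τ`: with target vector `f` (examples are labelled by the parity function of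
`f`) and randomness `w`, the program `p` started in configuration `s` halts in configuration `s'`
after time `τ`.

Control flow costs one unit per test. The overhead of a counted loop is one unit per iteration, which
is the amortized cost of decrementing a binary counter. Receiving an example of length `n` takes
time `n + 1`. -/
inductive Exec {n : ℕ} (f : Fin n → ZMod 2) (w : Randomness n) :
    Cmd → State → State → ℕ → Prop where
  | skip (s : State) : Exec f w .skip s s 1
  | set (s : State) (x : ℕ) (e : Expr) :
      Exec f w (.set x e) s { s with reg := Function.update s.reg x (e.eval s) } (e.cost s + 1)
  | store (s : State) (a : ℕ) (i e : Expr) :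
      Exec f w (.store a i e) s
        { s with arr := Function.update s.arr a
                          (Function.update (s.arr a) (i.eval s) (e.eval s)) }
        (i.cost s + e.cost s + 1)
  | seq {p q : Cmd} {s s' s'' : State} {τ τ' : ℕ} :
      Exec f w p s s' τ → Exec f w q s' s'' τ' → Exec f w (.seq p q) s s'' (τ + τ')
  | ite_true {e : Expr} {p q : Cmd} {s s' : State} {τ : ℕ} :
      e.eval s ≠ 0 → Exec f w p s s' τ → Exec f w (.ite e p q) s s' (e.cost s + 1 + τ)
  | ite_false {e : Expr} {p q : Cmd} {s s' : State} {τ : ℕ} :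
      e.eval s = 0 → Exec f w q s s' τ → Exec f w (.ite e p q) s s' (e.cost s + 1 + τ)
  | while_true {e : Expr} {p : Cmd} {s s' s'' : State} {τ τ' : ℕ} :
      e.eval s ≠ 0 → Exec f w p s s' τ → Exec f w (.while e p) s' s'' τ' →
        Exec f w (.while e p) s s'' (e.cost s + 1 + τ + τ')
  | while_false {e : Expr} {p : Cmd} {s : State} :
      e.eval s = 0 → Exec f w (.while e p) s s (e.cost s + 1)
  | rep {e : Expr} {p : Cmd} {s : State} (σ : ℕ → State) (τ : ℕ → ℕ) :
      σ 0 = s → (∀ i < e.eval s, Exec f w p (σ i) (σ (i + 1)) (τ i)) →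
        Exec f w (.rep e p) s (σ (e.eval s))
          (e.cost s + 1 + ∑ i ∈ Finset.range (e.eval s), (τ i + 1))
  | coin (s : State) (x : ℕ) :
      Exec f w (.coin x) s
        { s with reg := Function.update s.reg x (w.2 s.flipped).toNat, flipped := s.flipped + 1 } 1
  | draw (s : State) (a x : ℕ) :
      Exec f w (.draw a x) s
        { reg := Function.update s.reg x (f ⬝ᵥ w.1 s.drawn).val
          arr := Function.update s.arr a
            (fun i => if h : i < n then (w.1 s.drawn ⟨i, h⟩).val else s.arr a i)
          drawn := s.drawn + 1
          flipped := s.flipped } (n + 1)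

/-- `g` is constructible in quadratic time: some program computes `g n` from `n` in time `O(n²)`,
without using examples or coins. (The result is returned in register `0`.) -/
def ConstructibleInQuadraticTime (g : ℕ → ℕ) : Prop :=
  ∃ (p : Cmd) (C : ℕ), ∀ (n m : ℕ) (f : Fin m → ZMod 2) (w : Randomness m),
    ∃ (s : State) (τ : ℕ), Exec f w p (init [n]) s τ ∧ s.reg 0 = g n ∧
      s.drawn = 0 ∧ s.flipped = 0 ∧ τ ≤ C * (n + 1) ^ 2

/-- The hypothesis returned by a learner: the vector of `{0,1}ⁿ` whose `i`-th bit is the `i`-th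
entry, taken modulo `2`, of array `0`. It stands for the parity function `a ↦ ⟨·, a⟩`. -/
def output (n : ℕ) (s : State) : Fin n → ZMod 2 := fun i => (s.arr 0 i : ZMod 2)

end RAM

/-! ## Parities and PAC learning -/

/-- `PAR(k)`: the vectors of Hamming weight `k` in `{0,1}ⁿ`; the vector `f` stands for the parity
function `a ↦ f ⬝ᵥ a`. -/
def PAR (n k : ℕ) : Set (Fin n → ZMod 2) := {f | hammingNorm f = k}

/-- The probability, for `a` drawn from `D`, that the parity functions of `f` and `g` differ. -/
noncomputable def disagreement {n : ℕ} (D : PMF (Fin n → ZMod 2)) (f g : Fin n → ZMod 2) : ℝ :=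
  D.toMeasure.real {a | f ⬝ᵥ a ≠ g ⬝ᵥ a}

/-- The law of the randomness of a run: independent points drawn from `D`, and independent fair
coins, independent of each other. -/
noncomputable def randomnessLaw {n : ℕ} (D : PMF (Fin n → ZMod 2)) :
    Measure (RAM.Randomness n) :=
  (Measure.infinitePi fun _ : ℕ => D.toMeasure).prod
    (Measure.infinitePi fun _ : ℕ => (PMF.uniformOfFintype Bool).toMeasure)

/-- The program `p`, on the given input, PAC-learns the class `𝒞` of parities under the
distribution `D`, with approximation parameter `ε`, confidence parameter `δ`, sample complexity `S`
and running time `T`: for every target in `𝒞` each run halts within time `T` after drawing at most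
`S` examples, and with probability at least `1 - δ` the output differs from the target with
`D`-probability less than `ε`. -/
def PACLearns {n : ℕ} (p : RAM.Cmd) (input : List ℕ) (𝒞 : Set (Fin n → ZMod 2))
    (D : PMF (Fin n → ZMod 2)) (ε δ S T : ℝ) : Prop :=
  ∀ f ∈ 𝒞,
    (∀ w : RAM.Randomness n, ∃ (s : RAM.State) (τ : ℕ),
      RAM.Exec f w p (RAM.init input) s τ ∧ (s.drawn : ℝ) ≤ S ∧ (τ : ℝ) ≤ T) ∧
    1 - δ ≤ (randomnessLaw D).real
      {w | ∃ (s : RAM.State) (τ : ℕ),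
        RAM.Exec f w p (RAM.init input) s τ ∧ disagreement D f (RAM.output n s) < ε}

/-- The sample size `kn/t + log₂ (t choose k) + log₂ (1/δ)`. -/
noncomputable def sampleSize (n k t : ℕ) (δ : ℝ) : ℝ :=
  (k : ℝ) * n / t + Real.logb 2 (t.choose k) + Real.logb 2 (1 / δ)

/-- The running time `e^{-k/γ} · (t choose k) · n^c · max(1, log₂ (1/δ))`. -/
noncomputable def runningTime (γ : ℝ) (c n k t : ℕ) (δ : ℝ) : ℝ :=
  Real.exp (-(k : ℝ) / γ) * (t.choose k : ℝ) * (n : ℝ) ^ c * max 1 (Real.logb 2 (1 / δ))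

/-! The learner guesses a random set of coordinates and does linear algebra inside it. Fix `j` by `2
^ j * (2 * k) ≤ t < 2 ^ j * (4 * k)`. In a trial each coordinate is kept with probability `2 ^
(-j)`, and elimination over `ZMod 2` looks for a parity that is supported in the kept coordinates
and agrees with all examples. A trial keeps the whole support of the target with probability `2 ^
(-j * k)`, and then it cannot fail to find something, the target itself being a candidate. With `L =
⌈log₂ (1/δ)⌉`, all of `(L + 1) * 2 ^ (j * k)` trials miss the support with probability at most `exp
(-(L + 1)) ≤ δ / 2`.

The parity found may be wrong. The expected number of vectors supported in the kept coordinates is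
`(1 + 2 ^ (-j)) ^ n ≤ exp (n / 2 ^ j)`, and a vector with disagreement at least `ε` survives `m`
examples with probability at most `(1 - ε) ^ m ≤ exp (-ε m)`. Coins and examples are independent, so
all trials can share one sample, and a union bound over trials and vectors
(`randomnessLaw_real_failure_le`, `failure_le`) asks for `ε m ≥ 2 (L + 1) + j k + n / 2 ^ j`. Since
`j k ≤ log₂ (t choose k)` and `n / 2 ^ j ≤ 4 k n / t`, this is the claimed sample size
(`samples_le`).

The time is the number of trials times a polynomial and `1 / ε`. From `2 ^ (j + 1) * k ≤ t` follows
`2 ^ (j * k) * 2 ^ k ≤ t choose k`, and the spare `2 ^ k` exceeds `exp (k / γ)`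
(`two_pow_le_exp_mul_choose`). The growth conditions enter as `1 ≤ k` and `2 * k ≤ t ≤ n` for large
`n`.

The rest is program verification. The inner programs are `while`-free and keep all they assign below
a modulus quadratic in `n`, so a crude syntactic bound makes them polynomial (`exec_of_guarded`),
and their correctness is proved for the function `run` without mention of time. The counters `L +
1`, `⌈1/ε⌉` and `2 ^ (j * k)`, which may exceed the modulus, stay in registers from `50` on. The
given programs for `k` and `t` are opaque and run in separate banks of registers and arrays
(`Exec.rename`). `exec_learner` says what holds on every run, and `pacLearns_learner` joins it to
the probabilities. Uniform examples are the case `ε = 1 / 2`. -/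

namespace RAM

/-! ## Denotational semantics of loop programs -/

/-- The final configuration of a program without `while` loops. -/
def run {n : ℕ} (f : Fin n → ZMod 2) (w : Randomness n) : Cmd → State → State
  | .skip, s => s
  | .set x e, s => { s with reg := Function.update s.reg x (e.eval s) }
  | .store a i e, s =>
      { s with arr := Function.update s.arr a
                        (Function.update (s.arr a) (i.eval s) (e.eval s)) }
  | .seq p q, s => run f w q (run f w p s)
  | .ite e p q, s => if e.eval s ≠ 0 then run f w p s else run f w q s
  -- A default value: guarded programs contain no `while`.
  | .while _ _, s => s
  | .rep e p, s => (run f w p)^[e.eval s] s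
  | .coin x, s =>
      { s with reg := Function.update s.reg x (w.2 s.flipped).toNat, flipped := s.flipped + 1 }
  | .draw a x, s =>
      { reg := Function.update s.reg x (f ⬝ᵥ w.1 s.drawn).val
        arr := Function.update s.arr a
          (fun i => if h : i < n then (w.1 s.drawn ⟨i, h⟩).val else s.arr a i)
        drawn := s.drawn + 1
        flipped := s.flipped }

/-- The registers written by a program. -/
def Cmd.regs : Cmd → List ℕ
  | .skip => []
  | .set x _ => [x]
  | .store _ _ _ => []
  | .seq p q => p.regs ++ q.regs
  | .ite _ p q => p.regs ++ q.regs
  | .while _ p => p.regs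
  | .rep _ p => p.regs
  | .coin x => [x]
  | .draw _ x => [x]

/-- The arrays written by a program. -/
def Cmd.arrs : Cmd → List ℕ
  | .skip => []
  | .set _ _ => []
  | .store a _ _ => [a]
  | .seq p q => p.arrs ++ q.arrs
  | .ite _ p q => p.arrs ++ q.arrs
  | .while _ p => p.arrs
  | .rep _ p => p.arrs
  | .coin _ => []
  | .draw a _ => [a]

/-- Programs which draw no examples. -/
def Cmd.noDraw : Cmd → Bool
  | .seq p q => p.noDraw && q.noDraw
  | .ite _ p q => p.noDraw && q.noDraw
  | .while _ p => p.noDraw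
  | .rep _ p => p.noDraw
  | .draw _ _ => false
  | _ => true

/-- Programs which flip no coins. -/
def Cmd.noCoin : Cmd → Bool
  | .seq p q => p.noCoin && q.noCoin
  | .ite _ p q => p.noCoin && q.noCoin
  | .while _ p => p.noCoin
  | .rep _ p => p.noCoin
  | .coin _ => false
  | _ => true

/-! ### Frame rules: what a program does not write stays unchanged. -/

section frame

variable {n : ℕ} (f : Fin n → ZMod 2) (w : Randomness n)

theorem run_reg_of_notMem (p : Cmd) (s : State) {x : ℕ} (hx : x ∉ p.regs) :
    (run f w p s).reg x = s.reg x := by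
  induction p generalizing s with
  | skip => rfl
  | set y e => simp [Cmd.regs] at hx; simp [run, hx]
  | store a i e => rfl
  | seq p q hp hq =>
    simp only [Cmd.regs, List.mem_append, not_or] at hx
    simp only [run]; rw [hq _ hx.2, hp _ hx.1]
  | ite e p q hp hq =>
    simp only [Cmd.regs, List.mem_append, not_or] at hx
    simp only [run]; split_ifs
    · exact hp _ hx.1
    · exact hq _ hx.2
  | rep e p hp =>
    simp only [run]
    generalize e.eval s = N
    induction N with
    | zero => rfl
    | succ N ih => rw [Function.iterate_succ_apply', hp _ hx, ih]
  | coin y => simp [Cmd.regs] at hx; simp [run, hx]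
  | draw a y => simp [Cmd.regs] at hx; simp [run, hx]
  | _ => rfl

theorem run_arr_of_notMem (p : Cmd) (s : State) {x : ℕ} (hx : x ∉ p.arrs) :
    (run f w p s).arr x = s.arr x := by
  induction p generalizing s with
  | skip => rfl
  | set y e => rfl
  | store a i e => simp [Cmd.arrs] at hx; simp [run, hx]
  | seq p q hp hq =>
    simp only [Cmd.arrs, List.mem_append, not_or] at hx
    simp only [run]; rw [hq _ hx.2, hp _ hx.1]
  | ite e p q hp hq =>
    simp only [Cmd.arrs, List.mem_append, not_or] at hx
    simp only [run]; split_ifs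
    · exact hp _ hx.1
    · exact hq _ hx.2
  | rep e p hp =>
    simp only [run]
    generalize e.eval s = N
    induction N with
    | zero => rfl
    | succ N ih => rw [Function.iterate_succ_apply', hp _ hx, ih]
  | coin y => rfl
  | draw a y => simp [Cmd.arrs] at hx; simp [run, hx]
  | _ => rfl

theorem run_drawn_of_noDraw (p : Cmd) (s : State) (hp : p.noDraw = true) :
    (run f w p s).drawn = s.drawn := by
  induction p generalizing s with
  | seq p q ihp ihq =>
    simp only [Cmd.noDraw, Bool.and_eq_true] at hp
    simp only [run]; rw [ihq _ hp.2, ihp _ hp.1]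
  | ite e p q ihp ihq =>
    simp only [Cmd.noDraw, Bool.and_eq_true] at hp
    simp only [run]; split_ifs
    · exact ihp _ hp.1
    · exact ihq _ hp.2
  | rep e p ih =>
    simp only [run]
    generalize e.eval s = N
    induction N with
    | zero => rfl
    | succ N ihN => rw [Function.iterate_succ_apply', ih _ hp, ihN]
  | draw a y => simp [Cmd.noDraw] at hp
  | _ => rfl

theorem run_flipped_of_noCoin (p : Cmd) (s : State) (hp : p.noCoin = true) :
    (run f w p s).flipped = s.flipped := by
  induction p generalizing s with
  | seq p q ihp ihq =>
    simp only [Cmd.noCoin, Bool.and_eq_true] at hp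
    simp only [run]; rw [ihq _ hp.2, ihp _ hp.1]
  | ite e p q ihp ihq =>
    simp only [Cmd.noCoin, Bool.and_eq_true] at hp
    simp only [run]; split_ifs
    · exact ihp _ hp.1
    · exact ihq _ hp.2
  | rep e p ih =>
    simp only [run]
    generalize e.eval s = N
    induction N with
    | zero => rfl
    | succ N ihN => rw [Function.iterate_succ_apply', ih _ hp, ihN]
  | coin y => simp [Cmd.noCoin] at hp
  | _ => rfl

end frame

/-! ## Guarded programs and their running time -/

/-- The register holding the modulus by which guarded programs reduce what they assign. -/
abbrev modReg : ℕ := 4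

/-- Expressions using only registers and arrays with numbers below `50`. -/
def Expr.low : Expr → Bool
  | .const _ => true
  | .reg x => decide (x < 50)
  | .get a i => decide (a < 50) && i.low
  | .op _ e₁ e₂ => e₁.low && e₂.low

/-- Low expressions whose value is bounded by the modulus. -/
def Expr.guard : Expr → Bool
  | .const c => decide (c ≤ 1)
  | .op .mod e (.const c) => decide (c = 2) && e.low
  | .op .mod e (.reg x) => decide (x = modReg) && e.low
  | _ => false

/-- Loop programs which only assign guarded expressions. -/
def Cmd.guarded : Cmd → Bool
  | .skip => true
  | .set x e => decide (x < 50) && decide (x ≠ modReg) && e.guard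
  | .store a i e => decide (a < 50) && i.low && e.guard
  | .seq p q => p.guarded && q.guarded
  | .ite e p q => e.low && p.guarded && q.guarded
  | .while _ _ => false
  | .rep e p => e.low && p.guarded
  | .coin x => decide (x < 50) && decide (x ≠ modReg)
  | .draw a x => decide (a < 50) && decide (x < 50) && decide (x ≠ modReg)

/-- The modulus is `B ≥ 2`, and all low registers and array entries are at most `B`. -/
structure Small (B : ℕ) (s : State) : Prop where
  two_le : 2 ≤ B
  mod_eq : s.reg modReg = B
  reg_le : ∀ x < 50, s.reg x ≤ B
  arr_le : ∀ a < 50, ∀ i, s.arr a i ≤ B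

/-- A bound for the value of a low expression in a small configuration. -/
def Expr.valBound (B : ℕ) : Expr → ℕ
  | .const c => c
  | .reg _ => B
  | .get _ _ => B
  | .op .add e₁ e₂ => e₁.valBound B + e₂.valBound B
  | .op .mul e₁ e₂ => e₁.valBound B * e₂.valBound B
  | .op .lt _ _ => 1
  | .op .eq _ _ => 1
  | .op _ e₁ _ => e₁.valBound B

/-- A bound for the cost of a low expression in a small configuration. -/
def Expr.costBound (B : ℕ) : Expr → ℕ
  | .const c => 1 + c
  | .reg _ => 1 + B
  | .get _ i => i.costBound B + 1 + i.valBound B + B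
  | .op _ e₁ e₂ => e₁.costBound B + e₂.costBound B + 1 + e₁.valBound B + e₂.valBound B

/-- A bound for the running time of a guarded program in a small configuration. -/
def Cmd.timeBound (B : ℕ) : Cmd → ℕ
  | .skip => 1
  | .set _ e => e.costBound B + 1
  | .store _ i e => i.costBound B + e.costBound B + 1
  | .seq p q => p.timeBound B + q.timeBound B
  | .ite e p q => e.costBound B + 1 + (p.timeBound B + q.timeBound B)
  | .while _ _ => 0
  | .rep e p => e.costBound B + 1 + e.valBound B * (p.timeBound B + 1)
  | .coin _ => 1
  | .draw _ _ => B + 1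

/-- Replacing bit lengths by values is affordable because the modulus is polynomial in `n`. -/
theorem size_le_self (a : ℕ) : a.size ≤ a := Nat.size_le.2 Nat.lt_two_pow_self

theorem Expr.low_of_guard {e : Expr} (h : e.guard = true) : e.low = true := by
  unfold Expr.guard at h
  split at h <;> simp_all [Expr.low, modReg]

theorem Expr.eval_le_valBound {B : ℕ} {s : State} (hs : Small B s) {e : Expr}
    (he : e.low = true) : e.eval s ≤ e.valBound B := by
  induction e with
  | const c => exact le_rfl
  | reg x => exact hs.reg_le x (by simpa [Expr.low] using he)
  | get a i _ =>
    simp only [Expr.low, Bool.and_eq_true, decide_eq_true_eq] at he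
    exact hs.arr_le a he.1 _
  | op o e₁ e₂ h₁ h₂ =>
    simp only [Expr.low, Bool.and_eq_true] at he
    specialize h₁ he.1
    specialize h₂ he.2
    cases o <;> simp only [Expr.eval, Op.eval, Expr.valBound]
    · exact add_le_add h₁ h₂
    · exact (Nat.sub_le _ _).trans h₁
    · exact Nat.mul_le_mul h₁ h₂
    · exact (Nat.div_le_self _ _).trans h₁
    · exact (Nat.mod_le _ _).trans h₁
    · split_ifs <;> simp
    · split_ifs <;> simp

theorem Expr.cost_le_costBound {B : ℕ} {s : State} (hs : Small B s) {e : Expr}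
    (he : e.low = true) : e.cost s ≤ e.costBound B := by
  induction e with
  | const c => exact Nat.add_le_add_left (size_le_self _) _
  | reg x =>
    exact Nat.add_le_add_left ((size_le_self _).trans (hs.reg_le x (by simpa [Expr.low] using he))) _
  | get a i ih =>
    have he' := he
    simp only [Expr.low, Bool.and_eq_true, decide_eq_true_eq] at he
    have h1 := ih he.2
    have h2 := (size_le_self _).trans (Expr.eval_le_valBound hs he.2)
    have h3 := (size_le_self _).trans (hs.arr_le a he.1 (i.eval s))
    simp only [Expr.cost, Expr.costBound]
    omega
  | op o e₁ e₂ h₁ h₂ =>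
    simp only [Expr.low, Bool.and_eq_true] at he
    have h3 := (size_le_self _).trans (Expr.eval_le_valBound hs he.1)
    have h4 := (size_le_self _).trans (Expr.eval_le_valBound hs he.2)
    specialize h₁ he.1
    specialize h₂ he.2
    simp only [Expr.cost, Expr.costBound]
    omega

/-- This is what keeps `Small` invariant under assignments. The constants and the residues modulo
`2` need `2 ≤ B`; the other residues are below `B` itself. -/
theorem Expr.eval_le_of_guard {B : ℕ} {s : State} (hs : Small B s) {e : Expr}
    (he : e.guard = true) : e.eval s ≤ B := by
  have hB := hs.two_le
  unfold Expr.guard at he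
  split at he
  · simp only [decide_eq_true_eq] at he
    simp only [Expr.eval]; omega
  · simp only [Bool.and_eq_true, decide_eq_true_eq] at he
    obtain ⟨rfl, -⟩ := he
    simp only [Expr.eval, Op.eval]; omega
  · simp only [Bool.and_eq_true, decide_eq_true_eq] at he
    obtain ⟨rfl, -⟩ := he
    simp only [Expr.eval, Op.eval, hs.mod_eq]
    exact (Nat.mod_lt _ (by omega)).le
  · cases he

theorem Small.update_reg {B : ℕ} {s : State} (hs : Small B s) {x v : ℕ} (hx : x ≠ modReg)
    (hv : v ≤ B) : Small B { s with reg := Function.update s.reg x v } where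
  two_le := hs.two_le
  mod_eq := by simpa [Function.update_of_ne hx.symm] using hs.mod_eq
  reg_le y hy := by
    by_cases h : y = x
    · subst h; simpa using hv
    · simpa [h] using hs.reg_le y hy
  arr_le := hs.arr_le

theorem Small.update_arr {B : ℕ} {s : State} (hs : Small B s) {a : ℕ} {g : ℕ → ℕ}
    (hg : ∀ i, g i ≤ B) : Small B { s with arr := Function.update s.arr a g } where
  two_le := hs.two_le
  mod_eq := hs.mod_eq
  reg_le := hs.reg_le
  arr_le b hb i := by
    by_cases h : b = a
    · subst h; simpa using hg i
    · simpa [h] using hs.arr_le b hb i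

/-- The invariant rule for repetition, with a uniform bound on the time of an iteration. -/
theorem exec_rep_of_invariant {n : ℕ} {f : Fin n → ZMod 2} {w : Randomness n} {p : Cmd} {T : ℕ}
    {e : Expr} {s : State} {N : ℕ} (hN : e.eval s = N) (I : ℕ → State → Prop)
    (hI : ∀ i < N, ∀ s, I i s →
      I (i + 1) (run f w p s) ∧ ∃ τ ≤ T, Exec f w p s (run f w p s) τ) (hs : I 0 s) :
    I N (run f w (.rep e p) s) ∧ ∃ τ ≤ e.cost s + 1 + N * (T + 1),
      Exec f w (.rep e p) s (run f w (.rep e p) s) τ := by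
  subst hN
  have hi : ∀ i ≤ e.eval s, I i ((run f w p)^[i] s) := fun i => by
    induction i with
    | zero => exact fun _ => hs
    | succ i ih =>
      intro h
      rw [Function.iterate_succ_apply']; exact (hI _ h _ (ih (by omega))).1
  choose! τ hτ hE using fun i hlt => (hI i hlt _ (hi i (le_of_lt hlt))).2
  refine ⟨hi _ le_rfl, _, ?_, Exec.rep (fun i => (run f w p)^[i] s) τ rfl fun i hlt => ?_⟩
  · gcongr
    calc ∑ i ∈ Finset.range (e.eval s), (τ i + 1)
        ≤ ∑ i ∈ Finset.range (e.eval s), (T + 1) :=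
          Finset.sum_le_sum fun i h => Nat.add_le_add_right (hτ i (Finset.mem_range.1 h)) 1
      _ = e.eval s * (T + 1) := by simp
  · simp only [Function.iterate_succ_apply']
    exact hE i hlt

/-- A guarded program halts within its time bound, in a small configuration. -/
theorem exec_of_guarded {n : ℕ} (f : Fin n → ZMod 2) (w : Randomness n) {B : ℕ} (hn : n ≤ B)
    {p : Cmd} (hp : p.guarded = true) {s : State} (hs : Small B s) :
    Small B (run f w p s) ∧ ∃ τ ≤ p.timeBound B, Exec f w p s (run f w p s) τ := by
  induction p generalizing s with
  | skip => exact ⟨hs, _, le_rfl, Exec.skip s⟩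
  | set x e =>
    simp only [Cmd.guarded, Bool.and_eq_true, decide_eq_true_eq] at hp
    exact ⟨hs.update_reg hp.1.2 (Expr.eval_le_of_guard hs hp.2), _,
      Nat.add_le_add_right (Expr.cost_le_costBound hs (Expr.low_of_guard hp.2)) 1, Exec.set s x e⟩
  | store a i e =>
    simp only [Cmd.guarded, Bool.and_eq_true, decide_eq_true_eq] at hp
    refine ⟨hs.update_arr fun l => ?_, _, ?_, Exec.store s a i e⟩
    · by_cases h : l = i.eval s
      · subst h; simpa using Expr.eval_le_of_guard hs hp.2
      · simpa [h] using hs.arr_le a hp.1.1 l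
    · have h1 := Expr.cost_le_costBound hs hp.1.2
      have h2 := Expr.cost_le_costBound hs (Expr.low_of_guard hp.2)
      simp only [Cmd.timeBound]; omega
  | seq p q ihp ihq =>
    simp only [Cmd.guarded, Bool.and_eq_true] at hp
    obtain ⟨h1, τ₁, ht1, hE1⟩ := ihp hp.1 hs
    obtain ⟨h2, τ₂, ht2, hE2⟩ := ihq hp.2 h1
    exact ⟨h2, _, add_le_add ht1 ht2, Exec.seq hE1 hE2⟩
  | ite e p q ihp ihq =>
    simp only [Cmd.guarded, Bool.and_eq_true] at hp
    have hc := Expr.cost_le_costBound hs hp.1.1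
    simp only [run, Cmd.timeBound]
    split_ifs with h
    · obtain ⟨h1, τ₁, ht1, hE1⟩ := ihp hp.1.2 hs
      exact ⟨h1, _, by omega, Exec.ite_true h hE1⟩
    · obtain ⟨h1, τ₁, ht1, hE1⟩ := ihq hp.2 hs
      exact ⟨h1, _, by omega, Exec.ite_false (not_not.1 h) hE1⟩
  | rep e p ih =>
    simp only [Cmd.guarded, Bool.and_eq_true] at hp
    obtain ⟨h1, τ, ht, hE⟩ := exec_rep_of_invariant (f := f) (w := w) (p := p)
      (T := p.timeBound B) (e := e) rfl (fun _ => Small B) (fun _ _ s hs => ih hp.2 hs) hs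
    refine ⟨h1, τ, ht.trans ?_, hE⟩
    have hc := Expr.cost_le_costBound hs hp.1
    have hv := Expr.eval_le_valBound hs hp.1
    simp only [Cmd.timeBound]
    gcongr
  | coin x =>
    simp only [Cmd.guarded, Bool.and_eq_true, decide_eq_true_eq] at hp
    have h := hs.update_reg hp.2 (v := (w.2 s.flipped).toNat)
      ((Bool.toNat_le _).trans (by have := hs.two_le; omega))
    exact ⟨⟨h.two_le, h.mod_eq, h.reg_le, h.arr_le⟩, _, le_rfl, Exec.coin s x⟩
  | draw a x =>
    simp only [Cmd.guarded, Bool.and_eq_true, decide_eq_true_eq] at hp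
    have hbit : ∀ b : ZMod 2, b.val ≤ B := fun b =>
      (ZMod.val_lt b).le.trans hs.two_le
    have h := (hs.update_reg hp.2 (hbit (f ⬝ᵥ w.1 s.drawn))).update_arr (a := a)
      (g := fun i => if h : i < n then (w.1 s.drawn ⟨i, h⟩).val else s.arr a i) (fun i => by
        split_ifs
        · exact hbit _
        · exact hs.arr_le a hp.1.1 i)
    exact ⟨⟨h.two_le, h.mod_eq, h.reg_le, h.arr_le⟩, _, Nat.add_le_add_right hn 1, Exec.draw s a x⟩
  | _ => simp [Cmd.guarded] at hp

/-! ## Polynomial bounds -/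

/-- Functions bounded by a polynomial. -/
def PolyBounded (g : ℕ → ℕ) : Prop := ∃ K d : ℕ, ∀ B, g B ≤ K * (B + 1) ^ d

theorem PolyBounded.const (c : ℕ) : PolyBounded fun _ => c := ⟨c, 0, fun B => by simp⟩

theorem PolyBounded.id : PolyBounded fun B => B := ⟨1, 1, fun B => by simp⟩

theorem PolyBounded.add {g h : ℕ → ℕ} (hg : PolyBounded g) (hh : PolyBounded h) :
    PolyBounded fun B => g B + h B := by
  obtain ⟨K, d, hg⟩ := hg
  obtain ⟨K', d', hh⟩ := hh
  refine ⟨K + K', d + d', fun B => (add_le_add (hg B) (hh B)).trans ?_⟩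
  rw [add_mul]
  gcongr <;> omega

theorem PolyBounded.mul {g h : ℕ → ℕ} (hg : PolyBounded g) (hh : PolyBounded h) :
    PolyBounded fun B => g B * h B := by
  obtain ⟨K, d, hg⟩ := hg
  obtain ⟨K', d', hh⟩ := hh
  refine ⟨K * K', d + d', fun B => (Nat.mul_le_mul (hg B) (hh B)).trans (le_of_eq ?_)⟩
  ring

theorem Expr.polyBounded_valBound (e : Expr) : PolyBounded fun B => e.valBound B := by
  induction e with
  | const c => exact .const c
  | reg x => exact .id
  | get a i _ => exact .id
  | op o e₁ e₂ h₁ h₂ =>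
    cases o <;> simp only [Expr.valBound]
    exacts [h₁.add h₂, h₁, h₁.mul h₂, h₁, h₁, .const 1, .const 1]

theorem Expr.polyBounded_costBound (e : Expr) : PolyBounded fun B => e.costBound B := by
  induction e with
  | const c => exact .const _
  | reg x => exact .add (.const 1) .id
  | get a i h => exact ((h.add (.const 1)).add i.polyBounded_valBound).add .id
  | op o e₁ e₂ h₁ h₂ =>
    exact (((h₁.add h₂).add (.const 1)).add e₁.polyBounded_valBound).add e₂.polyBounded_valBound

theorem Cmd.polyBounded_timeBound (p : Cmd) : PolyBounded fun B => p.timeBound B := by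
  induction p with
  | skip => exact .const 1
  | set x e => exact e.polyBounded_costBound.add (.const 1)
  | store a i e => exact (i.polyBounded_costBound.add e.polyBounded_costBound).add (.const 1)
  | seq p q hp hq => exact hp.add hq
  | ite e p q hp hq => exact (e.polyBounded_costBound.add (.const 1)).add (hp.add hq)
  | rep e p hp =>
    exact (e.polyBounded_costBound.add (.const 1)).add
      (e.polyBounded_valBound.mul (hp.add (.const 1)))
  | coin x => exact .const 1
  | draw a x => exact .add .id (.const 1)
  | _ => exact .const 0

/-! ## Renaming registers and arrays -/

/-- Rename the registers and arrays of an expression. -/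
def Expr.rename (ρ : ℕ → ℕ) : Expr → Expr
  | .const c => .const c
  | .reg x => .reg (ρ x)
  | .get a i => .get (ρ a) (i.rename ρ)
  | .op o e₁ e₂ => .op o (e₁.rename ρ) (e₂.rename ρ)

/-- Rename the registers and arrays of a program. -/
def Cmd.rename (ρ : ℕ → ℕ) : Cmd → Cmd
  | .skip => .skip
  | .set x e => .set (ρ x) (e.rename ρ)
  | .store a i e => .store (ρ a) (i.rename ρ) (e.rename ρ)
  | .seq p q => .seq (p.rename ρ) (q.rename ρ)
  | .ite e p q => .ite (e.rename ρ) (p.rename ρ) (q.rename ρ)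
  | .while e p => .while (e.rename ρ) (p.rename ρ)
  | .rep e p => .rep (e.rename ρ) (p.rename ρ)
  | .coin x => .coin (ρ x)
  | .draw a x => .draw (ρ a) (ρ x)

open Classical in
/-- Place the configuration `s` in the renamed registers and arrays, on top of `r`. -/
noncomputable def State.embed (ρ : ℕ → ℕ) (r s : State) : State where
  reg y := if h : ∃ x, ρ x = y then s.reg h.choose else r.reg y
  arr b := if h : ∃ a, ρ a = b then s.arr h.choose else r.arr b
  drawn := s.drawn
  flipped := s.flipped

theorem State.embed_reg {ρ : ℕ → ℕ} (hρ : Function.Injective ρ) (r s : State) (x : ℕ) :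
    (State.embed ρ r s).reg (ρ x) = s.reg x := by
  have h : ∃ x', ρ x' = ρ x := ⟨x, rfl⟩
  simp only [State.embed, dif_pos h, hρ h.choose_spec]

theorem State.embed_arr {ρ : ℕ → ℕ} (hρ : Function.Injective ρ) (r s : State) (a : ℕ) :
    (State.embed ρ r s).arr (ρ a) = s.arr a := by
  have h : ∃ a', ρ a' = ρ a := ⟨a, rfl⟩
  simp only [State.embed, dif_pos h, hρ h.choose_spec]

theorem State.embed_reg_of_notMem {ρ : ℕ → ℕ} (r s : State) {y : ℕ} (hy : ∀ x, ρ x ≠ y) :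
    (State.embed ρ r s).reg y = r.reg y := by
  have h : ¬ ∃ x, ρ x = y := fun ⟨x, hx⟩ => hy x hx
  simp only [State.embed, dif_neg h]

theorem State.embed_arr_of_notMem {ρ : ℕ → ℕ} (r s : State) {b : ℕ} (hb : ∀ a, ρ a ≠ b) :
    (State.embed ρ r s).arr b = r.arr b := by
  have h : ¬ ∃ a, ρ a = b := fun ⟨a, ha⟩ => hb a ha
  simp only [State.embed, dif_neg h]

theorem State.ext_of {s s' : State} (h₁ : ∀ x, s.reg x = s'.reg x) (h₂ : ∀ a, s.arr a = s'.arr a)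
    (h₃ : s.drawn = s'.drawn) (h₄ : s.flipped = s'.flipped) : s = s' := by
  cases s; cases s'
  simp only [State.mk.injEq]
  exact ⟨funext h₁, funext h₂, h₃, h₄⟩

/-- A configuration whose renamed part looks like `s` is an embedding of `s`. -/
theorem State.embed_eq_self {ρ : ℕ → ℕ} {r s : State} (h₁ : ∀ x, r.reg (ρ x) = s.reg x)
    (h₂ : ∀ a, r.arr (ρ a) = s.arr a) (h₃ : r.drawn = s.drawn) (h₄ : r.flipped = s.flipped) :
    State.embed ρ r s = r := by
  refine State.ext_of (fun y => ?_) (fun b => ?_) h₃.symm h₄.symm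
  · simp only [State.embed]
    split_ifs with h
    · rw [← h₁, h.choose_spec]
    · rfl
  · simp only [State.embed]
    split_ifs with h
    · rw [← h₂, h.choose_spec]
    · rfl

theorem State.embed_update_reg {ρ : ℕ → ℕ} (hρ : Function.Injective ρ) (r s : State) (x v : ℕ) :
    (State.embed ρ r { s with reg := Function.update s.reg x v }).reg =
      Function.update (State.embed ρ r s).reg (ρ x) v := by
  funext y
  by_cases hy : ∃ x', ρ x' = y
  · obtain ⟨x', rfl⟩ := hy
    rw [State.embed_reg hρ]
    by_cases h : x' = x
    · subst h; simp
    · simp [h, hρ.ne h, State.embed_reg hρ]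
  · have hy' : ∀ x', ρ x' ≠ y := fun x' h => hy ⟨x', h⟩
    rw [State.embed_reg_of_notMem _ _ hy', Function.update_of_ne (hy' x).symm,
      State.embed_reg_of_notMem _ _ hy']

theorem State.embed_update_arr {ρ : ℕ → ℕ} (hρ : Function.Injective ρ) (r s : State) (a : ℕ)
    (g : ℕ → ℕ) :
    (State.embed ρ r { s with arr := Function.update s.arr a g }).arr =
      Function.update (State.embed ρ r s).arr (ρ a) g := by
  funext y
  by_cases hy : ∃ x', ρ x' = y
  · obtain ⟨x', rfl⟩ := hy
    rw [State.embed_arr hρ]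
    by_cases h : x' = a
    · subst h; simp
    · simp [h, hρ.ne h, State.embed_arr hρ]
  · have hy' : ∀ x', ρ x' ≠ y := fun x' h => hy ⟨x', h⟩
    rw [State.embed_arr_of_notMem _ _ hy', Function.update_of_ne (hy' a).symm,
      State.embed_arr_of_notMem _ _ hy']

theorem Expr.eval_rename {ρ : ℕ → ℕ} (hρ : Function.Injective ρ) (r s : State) (e : Expr) :
    (e.rename ρ).eval (State.embed ρ r s) = e.eval s := by
  induction e with
  | const c => rfl
  | reg x => exact State.embed_reg hρ r s x
  | get a i ih => simp only [Expr.rename, Expr.eval, ih, State.embed_arr hρ]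
  | op o e₁ e₂ h₁ h₂ => simp only [Expr.rename, Expr.eval, h₁, h₂]

theorem Expr.cost_rename {ρ : ℕ → ℕ} (hρ : Function.Injective ρ) (r s : State) (e : Expr) :
    (e.rename ρ).cost (State.embed ρ r s) = e.cost s := by
  induction e with
  | const c => rfl
  | reg x => simp only [Expr.rename, Expr.cost, State.embed_reg hρ]
  | get a i ih =>
    simp only [Expr.rename, Expr.cost, ih, State.embed_arr hρ, Expr.eval_rename hρ]
  | op o e₁ e₂ h₁ h₂ => simp only [Expr.rename, Expr.cost, h₁, h₂, Expr.eval_rename hρ]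

/-- A renamed program runs like the original one, and leaves the rest of the configuration alone. -/
theorem Exec.rename {n : ℕ} {f : Fin n → ZMod 2} {w : Randomness n} {p : Cmd} {s s' : State}
    {τ : ℕ} {ρ : ℕ → ℕ} (hρ : Function.Injective ρ) (r : State) (h : Exec f w p s s' τ) :
    Exec f w (p.rename ρ) (State.embed ρ r s) (State.embed ρ r s') τ := by
  have hv := Expr.eval_rename hρ r
  have hc := Expr.cost_rename hρ r
  induction h with
  | skip s => exact Exec.skip _
  | set s x e =>
    have := Exec.set (f := f) (w := w) (State.embed ρ r s) (ρ x) (e.rename ρ)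
    rw [hv, hc, ← State.embed_update_reg hρ] at this
    exact this
  | store s a i e =>
    have := Exec.store (f := f) (w := w) (State.embed ρ r s) (ρ a) (i.rename ρ) (e.rename ρ)
    rw [hv, hv, hc, hc, State.embed_arr hρ, ← State.embed_update_arr hρ] at this
    exact this
  | seq _ _ h₁ h₂ => exact Exec.seq h₁ h₂
  | @ite_true e p q s s' τ he _ h =>
    rw [← hc]
    exact Exec.ite_true (by rwa [hv]) h
  | @ite_false e p q s s' τ he _ h =>
    rw [← hc]
    exact Exec.ite_false (by rwa [hv]) h
  | @while_true e p s s' s'' τ τ' he _ _ h₁ h₂ =>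
    rw [← hc]
    exact Exec.while_true (by rwa [hv]) h₁ h₂
  | @while_false e p s he =>
    rw [← hc]
    exact Exec.while_false (by rwa [hv])
  | @rep e p s σ τ h0 _ ih =>
    subst h0
    have := Exec.rep (f := f) (w := w) (e := e.rename ρ) (p := p.rename ρ)
      (fun i => State.embed ρ r (σ i)) τ rfl (fun i hi => ih i (by rwa [hv] at hi))
    rw [hv, hc] at this
    exact this
  | coin s x =>
    have := Exec.coin (f := f) (w := w) (State.embed ρ r s) (ρ x)
    have h2 := State.embed_update_reg hρ r s x (w.2 s.flipped).toNat
    change Exec f w _ _ { State.embed ρ r s with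
      reg := Function.update (State.embed ρ r s).reg (ρ x) (w.2 s.flipped).toNat,
      flipped := s.flipped + 1 } 1 at this
    rw [← h2] at this
    exact this
  | draw s a x =>
    have := Exec.draw (f := f) (w := w) (State.embed ρ r s) (ρ a) (ρ x)
    rw [State.embed_arr hρ] at this
    have h2 := State.embed_update_reg hρ r s x (f ⬝ᵥ w.1 s.drawn).val
    have h3 := State.embed_update_arr hρ r s a
      (fun i => if h : i < n then (w.1 s.drawn ⟨i, h⟩).val else s.arr a i)
    change Exec f w _ _ { State.embed ρ r s with
      reg := Function.update (State.embed ρ r s).reg (ρ x) (f ⬝ᵥ w.1 s.drawn).val,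
      arr := Function.update (State.embed ρ r s).arr (ρ a)
        (fun i => if h : i < n then (w.1 s.drawn ⟨i, h⟩).val else s.arr a i),
      drawn := s.drawn + 1 } (n + 1) at this
    rw [← h2, ← h3] at this
    exact this

/-! ## Counted loops with a loop variable -/

/-- The configuration with register `x` set to `v`. -/
def State.setReg (s : State) (x v : ℕ) : State := { s with reg := Function.update s.reg x v }

@[simp] theorem State.setReg_reg (s : State) (x v y : ℕ) :
    (s.setReg x v).reg y = if y = x then v else s.reg y := by
  simp [State.setReg, Function.update_apply]

@[simp] theorem State.setReg_arr (s : State) (x v : ℕ) : (s.setReg x v).arr = s.arr := rfl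
@[simp] theorem State.setReg_drawn (s : State) (x v : ℕ) : (s.setReg x v).drawn = s.drawn := rfl
@[simp] theorem State.setReg_flipped (s : State) (x v : ℕ) :
    (s.setReg x v).flipped = s.flipped := rfl

/-- The configuration with array entry `a[i]` set to `v`. -/
def State.setArr (s : State) (a i v : ℕ) : State :=
  { s with arr := Function.update s.arr a (Function.update (s.arr a) i v) }

@[simp] theorem State.setArr_arr (s : State) (a i v b j : ℕ) :
    (s.setArr a i v).arr b j = if b = a ∧ j = i then v else s.arr b j := by
  by_cases h : b = a
  · subst h; simp [State.setArr, Function.update_apply]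
  · simp [State.setArr, h]

@[simp] theorem State.setArr_flipped (s : State) (a i v : ℕ) :
    (s.setArr a i v).flipped = s.flipped := rfl

instance : Add Expr := ⟨Expr.op .add⟩
instance : Mul Expr := ⟨Expr.op .mul⟩
instance : Sub Expr := ⟨Expr.op .sub⟩
instance : Div Expr := ⟨Expr.op .div⟩
instance : Mod Expr := ⟨Expr.op .mod⟩

@[simp] theorem Expr.eval_add (s : State) (a b : Expr) :
    (a + b).eval s = a.eval s + b.eval s := rfl
@[simp] theorem Expr.eval_mul (s : State) (a b : Expr) :
    (a * b).eval s = a.eval s * b.eval s := rfl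
@[simp] theorem Expr.eval_sub (s : State) (a b : Expr) :
    (a - b).eval s = a.eval s - b.eval s := rfl
@[simp] theorem Expr.eval_div (s : State) (a b : Expr) :
    (a / b).eval s = a.eval s / b.eval s := rfl
@[simp] theorem Expr.eval_mod (s : State) (a b : Expr) :
    (a % b).eval s = a.eval s % b.eval s := rfl
@[simp] theorem Expr.eval_const (s : State) (c : ℕ) : (Expr.const c).eval s = c := rfl
@[simp] theorem Expr.eval_reg (s : State) (x : ℕ) : (Expr.reg x).eval s = s.reg x := rfl
@[simp] theorem Expr.eval_get (s : State) (a : ℕ) (i : Expr) :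
    (Expr.get a i).eval s = s.arr a (i.eval s) := rfl
@[simp] theorem Expr.eval_lt (s : State) (a b : Expr) :
    (Expr.op .lt a b).eval s = if a.eval s < b.eval s then 1 else 0 := rfl

/-- Run `p` for `x = 0, 1, …`, as many times as the value of `e`. -/
def Cmd.loop (x : ℕ) (e : Expr) (p : Cmd) : Cmd :=
  .seq (.set x (.const 0))
    (.rep e (.seq p (.set x ((.reg x + .const 1) % .reg modReg))))

section run

variable {n : ℕ} (f : Fin n → ZMod 2) (w : Randomness n)

@[simp] theorem run_skip (s : State) : run f w .skip s = s := rfl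

@[simp] theorem run_set (x : ℕ) (e : Expr) (s : State) :
    run f w (.set x e) s = s.setReg x (e.eval s) := rfl

@[simp] theorem run_store (a : ℕ) (i e : Expr) (s : State) :
    run f w (.store a i e) s = s.setArr a (i.eval s) (e.eval s) := rfl

@[simp] theorem run_seq (p q : Cmd) (s : State) :
    run f w (.seq p q) s = run f w q (run f w p s) := rfl

@[simp] theorem run_ite (e : Expr) (p q : Cmd) (s : State) :
    run f w (.ite e p q) s = if e.eval s ≠ 0 then run f w p s else run f w q s := rfl

theorem run_rep (e : Expr) (p : Cmd) (s : State) :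
    run f w (.rep e p) s = (run f w p)^[e.eval s] s := rfl

/-- The invariant rule for counted loops. -/
theorem run_loop {x : ℕ} {e : Expr} {p : Cmd} {s : State} {N : ℕ} (I : ℕ → State → Prop)
    (hx : x ∉ p.regs) (hm : modReg ∉ p.regs) (hxm : x ≠ modReg)
    (hI : ∀ i s v, I i s → I i (s.setReg x v))
    (step : ∀ i < N, ∀ s', s'.reg x = i → (∀ y, y ≠ x → y ∉ p.regs → s'.reg y = s.reg y) →
      (∀ a, a ∉ p.arrs → s'.arr a = s.arr a) → I i s' → I (i + 1) (run f w p s'))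
    (hN : e.eval (s.setReg x 0) = N) (hM : N < s.reg modReg) (h0 : I 0 s) :
    I N (run f w (.loop x e p) s) := by
  have key : ∀ i ≤ N, ∃ s',
      (run f w (.seq p (.set x ((.reg x + .const 1) % .reg modReg))))^[i] (s.setReg x 0) = s' ∧
        s'.reg x = i ∧ (∀ y, y ≠ x → y ∉ p.regs → s'.reg y = s.reg y) ∧
      (∀ a, a ∉ p.arrs → s'.arr a = s.arr a) ∧ I i s' := by
    intro i
    induction i with
    | zero =>
      intro _
      exact ⟨_, rfl, by simp, fun y hy _ => by simp [hy], fun a _ => rfl, hI _ _ _ h0⟩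
    | succ i ih =>
      intro hi
      obtain ⟨s', h1, h2, h3, h4, h5⟩ := ih (by omega)
      refine ⟨_, rfl, ?_⟩
      have hxr : (run f w p s').reg x = i := by rw [run_reg_of_notMem f w p s' hx, h2]
      have hmr : (run f w p s').reg modReg = s.reg modReg := by
        rw [run_reg_of_notMem f w p s' hm, h3 _ hxm.symm hm]
      rw [Function.iterate_succ_apply', h1]
      -- The loop variable is also incremented after the last iteration, so `N` itself must be below
      -- the modulus for the reduction to be void.
      simp only [run_seq, run_set, Expr.eval_mod, Expr.eval_add, Expr.eval_reg, Expr.eval_const,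
        hxr, hmr, Nat.mod_eq_of_lt (show i + 1 < s.reg modReg by omega)]
      refine ⟨by simp, fun y hy hyp => ?_, fun a ha => ?_, hI _ _ _ (step i (by omega) s' h2 h3 h4 h5)⟩
      · simp only [State.setReg_reg, if_neg hy]
        rw [run_reg_of_notMem f w p s' hyp, h3 y hy hyp]
      · rw [State.setReg_arr, run_arr_of_notMem f w p s' ha, h4 a ha]
  obtain ⟨s', h1, -, -, -, h5⟩ := key N le_rfl
  simp only [Cmd.loop, run_seq, run_set, Expr.eval_const, run_rep, hN, h1]
  exact h5

end run

/-! ## Linear algebra over `ZMod 2` -/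

/-- Adding a pivot row to all rows not orthogonal to `c` cuts the row space down to the vectors
orthogonal to `c`. -/
theorem mem_span_range_eliminate {ι : Type*} [Fintype ι] [DecidableEq ι] {m : ℕ} {V V' : ι → Fin m → ZMod 2}
    {c : Fin m → ZMod 2} {p : ι} (hV : ∀ i, V' i = V i + (V i ⬝ᵥ c) • V p)
    (hp : (∀ i, V i ⬝ᵥ c = 0) ∨ V p ⬝ᵥ c ≠ 0) (z : Fin m → ZMod 2) :
    z ∈ Submodule.span (ZMod 2) (Set.range V') ↔
      z ∈ Submodule.span (ZMod 2) (Set.range V) ∧ z ⬝ᵥ c = 0 := by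
  have h2 : ∀ a : ZMod 2, a ≠ 0 → a = 1 := by decide
  have h3 : ∀ a : ZMod 2, a + a = 0 := by decide
  simp only [Submodule.mem_span_range_iff_exists_fun]
  -- The same coefficients applied to the new rows change a combination `z` by `(z ⬝ᵥ c) • V p`. So
  -- combinations orthogonal to `c` are kept, and any other new combination is an old one with its
  -- coefficient at `p` corrected.
  have hsum : ∀ g : ι → ZMod 2, ∑ i, g i • V' i =
      ∑ i, g i • V i + ((∑ i, g i • V i) ⬝ᵥ c) • V p := by
    intro g
    simp only [hV, smul_add, Finset.sum_add_distrib, sum_dotProduct, smul_dotProduct, smul_eq_mul,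
      Finset.sum_smul, mul_smul]
  constructor
  · rintro ⟨g, rfl⟩
    refine ⟨⟨g + Pi.single p ((∑ i, g i • V i) ⬝ᵥ c), ?_⟩, ?_⟩
    · rw [hsum]
      simp only [Pi.add_apply, add_smul, Finset.sum_add_distrib]
      congr 1
      simp [Pi.single_apply]
    · rw [hsum, add_dotProduct, smul_dotProduct, smul_eq_mul]
      rcases hp with hp | hp
      · simp [sum_dotProduct, smul_dotProduct, hp]
      -- The pivot has inner product `1` with `c`, so the correction doubles `z ⬝ᵥ c`, which
      -- vanishes in characteristic two.
      · rw [h2 _ hp, mul_one, h3]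
  · rintro ⟨⟨g, rfl⟩, hz⟩
    exact ⟨g, by rw [hsum, hz, zero_smul, add_zero]⟩

/-! ## Elimination -/

/-- The registers holding the parameters: the dimension `n`, the number `n + 1` of rows and columns,
the number of matrix entries, and a modulus exceeding them. -/
structure Env (n : ℕ) (s : State) : Prop where
  dim : s.reg 0 = n
  width : s.reg 3 = n + 1
  entries : s.reg 8 = (n + 1) * (n + 1)
  lt_mod : (n + 1) * (n + 1) < s.reg modReg

theorem Env.run {n m : ℕ} {s : State} (h : Env n s) (f : Fin m → ZMod 2) (w : Randomness m)
    {p : Cmd} (h0 : 0 ∉ p.regs) (h3 : 3 ∉ p.regs) (h8 : 8 ∉ p.regs) (h4 : modReg ∉ p.regs) :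
    Env n (run f w p s) where
  dim := by rw [run_reg_of_notMem f w p s h0, h.dim]
  width := by rw [run_reg_of_notMem f w p s h3, h.width]
  entries := by rw [run_reg_of_notMem f w p s h8, h.entries]
  lt_mod := by rw [run_reg_of_notMem f w p s h4]; exact h.lt_mod

theorem Env.setReg {n : ℕ} {s : State} (h : Env n s) {x v : ℕ}
    (hx : x ∉ [0, 3, 4, 8]) : Env n (s.setReg x v) := by
  simp only [List.mem_cons, List.not_mem_nil, or_false, not_or] at hx
  obtain ⟨h0, h3, h4, h8⟩ := hx
  exact ⟨by simp [Ne.symm h0, h.dim], by simp [Ne.symm h3, h.width],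
    by simp [Ne.symm h8, h.entries], by simpa [modReg, Ne.symm h4] using h.lt_mod⟩

/-- Compute into array `5` the inner products of the rows of the matrix `A` with array `1`. -/
def dots (A : ℕ) : Cmd :=
  .loop 10 (.reg 3) (.seq (.set 11 (.const 0)) (.seq
    (.loop 12 (.reg 3)
      (.set 11 ((.reg 11 + .get A (.reg 10 * .reg 3 + .reg 12) * .get 1 (.reg 12)) % .const 2)))
    (.store 5 (.reg 10) (.reg 11 % .const 2))))

/-- Set register `13` to the index of a nonzero entry of array `5`, if there is one. -/
def pivot : Cmd :=
  .seq (.set 13 (.const 0))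
    (.loop 10 (.reg 3) (.ite (.get 5 (.reg 10) % .const 2) (.set 13 (.reg 10 % .reg modReg)) .skip))

/-- Copy row number `13` of the matrix `A` to array `6`. -/
def copyRow (A : ℕ) : Cmd :=
  .loop 10 (.reg 3) (.store 6 (.reg 10) (.get A (.reg 13 * .reg 3 + .reg 10) % .const 2))

/-- Add to the rows of the matrix `A` the multiples of array `6` given by array `5`. -/
def addRows (A : ℕ) : Cmd :=
  .loop 10 (.reg 8) (.store A (.reg 10)
    ((.get A (.reg 10) + .get 5 (.reg 10 / .reg 3) * .get 6 (.reg 10 % .reg 3)) % .const 2))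

/-- Select a row of the matrix `A` which is not orthogonal to array `1`. -/
def select (A : ℕ) : Cmd := .seq (dots A) (.seq pivot (copyRow A))

/-- Restrict the row space of the matrix `A` to the vectors orthogonal to array `1`. -/
def impose (A : ℕ) : Cmd := .seq (select A) (addRows A)

/-- An entry of a matrix with `n + 1` columns stored in array `A`. -/
def State.entry (n : ℕ) (s : State) (A i l : ℕ) : ZMod 2 := (s.arr A (i * (n + 1) + l) : ℕ)

/-- The row space of the matrix stored in array `A`. -/
def State.rowSpace (n : ℕ) (s : State) (A : ℕ) : Submodule (ZMod 2) (Fin (n + 1) → ZMod 2) :=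
  Submodule.span (ZMod 2) (Set.range fun i : Fin (n + 1) => fun l : Fin (n + 1) => s.entry n A i l)

/-- The vector stored in array `a`. -/
def State.vec (n : ℕ) (s : State) (a : ℕ) : Fin (n + 1) → ZMod 2 := fun l => (s.arr a l : ℕ)

section elimination

variable {n m : ℕ} (f : Fin m → ZMod 2) (w : Randomness m) {s : State}

theorem natCast_mod_two (a : ℕ) : ((a % 2 : ℕ) : ZMod 2) = a := ZMod.natCast_mod a 2

theorem dots_spec (hs : Env n s) {A : ℕ} (hA : A ≠ 5) :
    ∀ i ≤ n, ((run f w (dots A) s).arr 5 i : ZMod 2) =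
      ∑ l ∈ Finset.range (n + 1), s.entry n A i l * (s.arr 1 l : ℕ) := by
  have hM := hs.lt_mod
  have hW : n + 1 < s.reg modReg := lt_of_le_of_lt (Nat.le_mul_of_pos_left _ (by omega)) hM
  have h := run_loop f w (x := 10) (e := .reg 3) (s := s) (N := n + 1)
    (p := .seq (.set 11 (.const 0)) (.seq
    (.loop 12 (.reg 3)
      (.set 11 ((.reg 11 + .get A (.reg 10 * .reg 3 + .reg 12) * .get 1 (.reg 12)) % .const 2)))
    (.store 5 (.reg 10) (.reg 11 % .const 2))))
    (fun j s' => ∀ i < j, (s'.arr 5 i : ZMod 2) =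
      ∑ l ∈ Finset.range (n + 1), s.entry n A i l * (s.arr 1 l : ℕ))
    (by simp [Cmd.regs, Cmd.loop]) (by simp [Cmd.regs, Cmd.loop, modReg]) (by simp [modReg])
    (fun i s' v h => h) ?_ (by simp [hs.width]) hW (by simp)
  · intro i hi; exact h i (by omega)
  · intro j hj s' hj' hreg harr ih
    simp only [Cmd.regs, Cmd.loop, Cmd.arrs] at hreg harr
    have h3 : s'.reg 3 = n + 1 := by rw [hreg 3 (by simp) (by simp), hs.width]
    have h4 : s'.reg modReg = s.reg modReg := hreg _ (by simp [modReg]) (by simp [modReg])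
    have hin := run_loop f w (x := 12) (e := .reg 3) (s := s'.setReg 11 0) (N := n + 1)
      (p := .set 11
        ((.reg 11 + .get A (.reg 10 * .reg 3 + .reg 12) * .get 1 (.reg 12)) % .const 2))
      (fun j' s'' => (s''.reg 11 : ZMod 2) =
        ∑ l ∈ Finset.range j', s.entry n A j l * (s.arr 1 l : ℕ))
      (by simp [Cmd.regs]) (by simp [Cmd.regs, modReg]) (by simp [modReg])
      (fun i s' v h => by simpa using h) ?_ (by simp [h3]) (by simpa [h4, modReg] using hW)
      (by simp)
    · have hreg10 : (run f w (Cmd.loop 12 (Expr.reg 3) (Cmd.set 11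
          ((Expr.reg 11 + Expr.get A (Expr.reg 10 * Expr.reg 3 + Expr.reg 12) *
            Expr.get 1 (Expr.reg 12)) % Expr.const 2))) (s'.setReg 11 0)).reg 10 = j := by
        rw [run_reg_of_notMem _ _ _ _ (by simp [Cmd.loop, Cmd.regs])]
        simpa using hj'
      intro i hi
      simp only [run_seq, run_set, run_store, Expr.eval_const, State.setArr_arr, Expr.eval_reg,
        hreg10, true_and, Expr.eval_mod]
      split_ifs with hij
      · subst hij
        rw [natCast_mod_two, hin]
      · rw [run_arr_of_notMem _ _ _ _ (by simp [Cmd.loop, Cmd.arrs])]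
        exact ih i (by omega)
    · intro l hl s'' hl' hreg' harr' ih'
      simp only [Cmd.regs, Cmd.arrs, State.setReg_arr] at hreg' harr'
      have e10 : s''.reg 10 = j := by rw [hreg' 10 (by simp) (by simp)]; simpa using hj'
      have e3 : s''.reg 3 = n + 1 := by rw [hreg' 3 (by simp) (by simp)]; simpa using h3
      have eA : s''.arr A = s.arr A := by rw [harr' A (by simp), harr A (by simpa using hA)]
      have e1 : s''.arr 1 = s.arr 1 := by rw [harr' 1 (by simp), harr 1 (by simp)]
      simp only [run_set, State.setReg_reg, if_true, Expr.eval_mod, Expr.eval_add, Expr.eval_mul,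
        Expr.eval_get, Expr.eval_reg, Expr.eval_const, e10, e3, hl', eA, e1, natCast_mod_two]
      rw [Finset.sum_range_succ, ← ih']
      push_cast [State.entry]
      rfl

theorem natCast_zmod_two_eq_zero {a : ℕ} : (a : ZMod 2) = 0 ↔ a % 2 = 0 := by
  rw [ZMod.natCast_eq_zero_iff, Nat.dvd_iff_mod_eq_zero]

/-- The last nonzero entry wins. If there is none the index stays `0`, which is harmless: the
multiples of the pivot row that get added are then all zero. -/
theorem pivot_spec (hs : Env n s) :
    (run f w pivot s).reg 13 ≤ n ∧ ((∀ i ≤ n, (s.arr 5 i : ZMod 2) = 0) ∨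
      (s.arr 5 ((run f w pivot s).reg 13) : ZMod 2) ≠ 0) := by
  have hM := hs.lt_mod
  have hW : n + 1 < s.reg modReg := lt_of_le_of_lt (Nat.le_mul_of_pos_left _ (by omega)) hM
  have h := run_loop f w (x := 10) (e := .reg 3) (s := s.setReg 13 0) (N := n + 1)
    (p := .ite (.get 5 (.reg 10) % .const 2) (.set 13 (.reg 10 % .reg modReg)) .skip)
    (fun j s' => s'.reg 13 ≤ n ∧ ((∀ i < j, (s.arr 5 i : ZMod 2) = 0) ∨
      (s.arr 5 (s'.reg 13) : ZMod 2) ≠ 0))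
    (by simp [Cmd.regs]) (by simp [Cmd.regs, modReg]) (by simp [modReg])
    (fun i s' v h => by simpa using h) ?_ (by simp [hs.width]) (by simpa [modReg] using hW)
    (by simp)
  · refine ⟨h.1, h.2.imp_left fun h i hi => h i (by omega)⟩
  · intro j hj s' hj' hreg harr ih
    simp only [Cmd.regs, Cmd.arrs] at hreg harr
    have h4 : s'.reg modReg = s.reg modReg := by
      rw [hreg _ (by simp [modReg]) (by simp [modReg])]; simp [modReg]
    have h5 : s'.arr 5 = s.arr 5 := harr 5 (by simp)
    simp only [run_ite, Expr.eval_mod, Expr.eval_get, Expr.eval_reg, Expr.eval_const, hj', h5]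
    split_ifs with h
    · simp only [run_set, State.setReg_reg, if_true, Expr.eval_mod, Expr.eval_reg, hj', h4,
        Nat.mod_eq_of_lt (show j < s.reg modReg by omega)]
      exact ⟨by omega, Or.inr (by rwa [Ne, natCast_zmod_two_eq_zero])⟩
    · simp only [run_skip]
      refine ⟨ih.1, ih.2.imp_left fun h' i hi => ?_⟩
      rcases Nat.lt_succ_iff_lt_or_eq.1 hi with hi | rfl
      · exact h' i hi
      · exact natCast_zmod_two_eq_zero.2 (not_not.1 h)

theorem copyRow_spec (hs : Env n s) {A : ℕ} (hA : A ≠ 6) :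
    ∀ l ≤ n, ((run f w (copyRow A) s).arr 6 l : ZMod 2) = s.entry n A (s.reg 13) l := by
  have hM := hs.lt_mod
  have hW : n + 1 < s.reg modReg := lt_of_le_of_lt (Nat.le_mul_of_pos_left _ (by omega)) hM
  have h := run_loop f w (x := 10) (e := .reg 3) (s := s) (N := n + 1)
    (p := .store 6 (.reg 10) (.get A (.reg 13 * .reg 3 + .reg 10) % .const 2))
    (fun j s' => ∀ l < j, (s'.arr 6 l : ZMod 2) = s.entry n A (s.reg 13) l)
    (by simp [Cmd.regs]) (by simp [Cmd.regs]) (by simp [modReg])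
    (fun i s' v h => h) ?_ (by simp [hs.width]) hW (by simp)
  · intro i hi; exact h i (by omega)
  · intro j hj s' hj' hreg harr ih l hl
    simp only [Cmd.regs, Cmd.arrs] at hreg harr
    have h3 : s'.reg 3 = n + 1 := by rw [hreg 3 (by simp) (by simp), hs.width]
    have h13 : s'.reg 13 = s.reg 13 := hreg 13 (by simp) (by simp)
    have eA : s'.arr A = s.arr A := harr A (by simpa using hA)
    simp only [run_store, State.setArr_arr, Expr.eval_reg, Expr.eval_mod, Expr.eval_get,
      Expr.eval_add, Expr.eval_mul, Expr.eval_const, hj', h3, h13, eA, true_and]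
    split_ifs with h
    · subst h
      rw [natCast_mod_two]; rfl
    · exact ih l (by omega)

/-- The loop runs over the flattened matrix, position `q` being in row `q / (n + 1)` and column `q %
(n + 1)`. The pivot row may be altered on the way, so it is read from its copy in array `6`. -/
theorem addRows_spec (hs : Env n s) {A : ℕ} (hA : A ≠ 5) (hA' : A ≠ 6) :
    ∀ i ≤ n, ∀ l ≤ n, (run f w (addRows A) s).entry n A i l =
      s.entry n A i l + (s.arr 5 i : ℕ) * (s.arr 6 l : ℕ) := by
  have hM := hs.lt_mod
  have h := run_loop f w (x := 10) (e := .reg 8) (s := s) (N := (n + 1) * (n + 1))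
    (p := .store A (.reg 10)
    ((.get A (.reg 10) + .get 5 (.reg 10 / .reg 3) * .get 6 (.reg 10 % .reg 3)) % .const 2))
    (fun j s' => ∀ q, (s'.arr A q : ZMod 2) = s.arr A q +
      if q < j then (s.arr 5 (q / (n + 1)) : ZMod 2) * (s.arr 6 (q % (n + 1)) : ℕ) else 0)
    (by simp [Cmd.regs]) (by simp [Cmd.regs]) (by simp [modReg])
    (fun i s' v h => h) ?_ (by simp [hs.entries]) hM (by simp)
  · intro i hi l hl
    have hlt : i * (n + 1) + l < (n + 1) * (n + 1) := by nlinarith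
    have hdiv : (i * (n + 1) + l) / (n + 1) = i := by
      rw [mul_comm, Nat.mul_add_div (by omega), Nat.div_eq_of_lt (by omega), add_zero]
    have hmod : (i * (n + 1) + l) % (n + 1) = l := by
      rw [mul_comm, Nat.mul_add_mod, Nat.mod_eq_of_lt (by omega)]
    have := h (i * (n + 1) + l)
    rw [if_pos hlt, hdiv, hmod] at this
    exact this
  · intro j hj s' hj' hreg harr ih q
    simp only [Cmd.regs, Cmd.arrs] at hreg harr
    have h3 : s'.reg 3 = n + 1 := by rw [hreg 3 (by simp) (by simp), hs.width]
    have e5 : s'.arr 5 = s.arr 5 := harr 5 (by simpa using hA.symm)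
    have e6 : s'.arr 6 = s.arr 6 := harr 6 (by simpa using hA'.symm)
    simp only [run_store, State.setArr_arr, Expr.eval_reg, Expr.eval_mod, Expr.eval_get,
      Expr.eval_add, Expr.eval_mul, Expr.eval_div, Expr.eval_const, hj', h3, e5, e6, true_and]
    split_ifs with h h' h'
    · subst h
      rw [natCast_mod_two, Nat.cast_add, ih]
      simp
    · omega
    · rw [ih, if_pos (by omega)]
    · rw [ih, if_neg (by omega)]

/-- What `select` leaves in array `5` (the inner products) and in array `6` (the pivot row). -/
theorem select_spec (hs : Env n s) {A : ℕ} (hA : A ≠ 5) (hA' : A ≠ 6) :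
    ∃ p : Fin (n + 1), (run f w (select A) s).reg 13 = p ∧
      (∀ i : Fin (n + 1), ((run f w (select A) s).arr 5 i : ZMod 2) =
        (fun l : Fin (n + 1) => s.entry n A i l) ⬝ᵥ s.vec n 1) ∧
      (∀ l : Fin (n + 1), ((run f w (select A) s).arr 6 l : ZMod 2) = s.entry n A p l) ∧
      ((∀ i : Fin (n + 1), (fun l : Fin (n + 1) => s.entry n A i l) ⬝ᵥ s.vec n 1 = 0) ∨
        (fun l : Fin (n + 1) => s.entry n A p l) ⬝ᵥ s.vec n 1 ≠ 0) := by
  have hs1 : Env n (run f w (dots A) s) := hs.run f w (by simp [dots, Cmd.regs, Cmd.loop])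
    (by simp [dots, Cmd.regs, Cmd.loop]) (by simp [dots, Cmd.regs, Cmd.loop])
    (by simp [dots, Cmd.regs, Cmd.loop, modReg])
  have hs2 : Env n (run f w pivot (run f w (dots A) s)) :=
    hs1.run f w (by decide) (by decide) (by decide) (by decide)
  have h1 := dots_spec f w hs hA
  have h2 := pivot_spec f w hs1
  have h3 := copyRow_spec f w hs2 hA'
  have hd : ∀ i : Fin (n + 1), ((run f w (dots A) s).arr 5 i : ZMod 2) =
      (fun l : Fin (n + 1) => s.entry n A i l) ⬝ᵥ s.vec n 1 := fun i => by
    rw [h1 i (by omega), Finset.sum_range]; rfl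
  have he : ∀ i l, (run f w pivot (run f w (dots A) s)).entry n A i l = s.entry n A i l := by
    intro i l
    simp only [State.entry]
    rw [run_arr_of_notMem f w pivot _ (by simp [pivot, Cmd.arrs, Cmd.loop]),
      run_arr_of_notMem f w (dots A) _ (by simp [dots, Cmd.arrs, Cmd.loop, hA])]
  refine ⟨⟨_, Nat.lt_succ_of_le h2.1⟩, ?_, fun i => ?_, fun l => ?_, ?_⟩
  · simp only [select, run_seq]
    rw [run_reg_of_notMem f w (copyRow A) _ (by simp [copyRow, Cmd.regs, Cmd.loop])]
  · rw [← hd]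
    simp only [select, run_seq]
    rw [run_arr_of_notMem f w (copyRow A) _ (by simp [copyRow, Cmd.arrs, Cmd.loop]),
      run_arr_of_notMem f w pivot _ (by simp [pivot, Cmd.arrs, Cmd.loop])]
  · simp only [select, run_seq]
    rw [h3 l (by omega), he]
  · refine h2.2.imp (fun h i => ?_) fun h => ?_
    · rw [← hd, h i (by omega)]
    · rw [← hd]; exact h

/-- `impose` restricts the row space to the vectors orthogonal to array `1`. -/
theorem mem_rowSpace_impose (hs : Env n s) {A : ℕ} (hA : A ≠ 5) (hA' : A ≠ 6)
    (z : Fin (n + 1) → ZMod 2) :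
    z ∈ (run f w (impose A) s).rowSpace n A ↔ z ∈ s.rowSpace n A ∧ z ⬝ᵥ s.vec n 1 = 0 := by
  obtain ⟨p, -, h5, h6, hp⟩ := select_spec f w hs hA hA'
  have hs1 : Env n (run f w (select A) s) := hs.run f w
    (by simp [select, dots, pivot, copyRow, Cmd.regs, Cmd.loop])
    (by simp [select, dots, pivot, copyRow, Cmd.regs, Cmd.loop])
    (by simp [select, dots, pivot, copyRow, Cmd.regs, Cmd.loop])
    (by simp [select, dots, pivot, copyRow, Cmd.regs, Cmd.loop, modReg])
  have h := addRows_spec f w hs1 hA hA'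
  refine mem_span_range_eliminate (p := p) (fun i => funext fun l => ?_) hp z
  simp only [impose, run_seq, Pi.add_apply, Pi.smul_apply, smul_eq_mul]
  rw [h i (by omega) l (by omega), h5, h6]
  congr 1
  simp only [State.entry]
  rw [run_arr_of_notMem f w (select A) _
    (by simp [select, dots, pivot, copyRow, Cmd.arrs, Cmd.loop, hA, hA'])]

end elimination
/-! ## Processing an example -/

/-- Draw an example, and restrict the row space of array `2` to the vectors consistent with it. -/
def sample : Cmd :=
  .seq (.draw 1 14) (.seq (.store 1 (.reg 0) (.reg 14 % .const 2)) (impose 2))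

/-- The row space of array `2` consists of the vectors `(x, c)` with `⟨x, a⟩ + c y = 0` for all examples `(a, y)` drawn so far. -/
structure Consistent {n : ℕ} (f : Fin n → ZMod 2) (w : Randomness n) (s : State) : Prop where
  mem_iff : ∀ z : Fin (n + 1) → ZMod 2, z ∈ s.rowSpace n 2 ↔ ∀ l < s.drawn,
    (fun i : Fin n => z i.castSucc) ⬝ᵥ w.1 l + z (Fin.last n) * (f ⬝ᵥ w.1 l) = 0

section sample

variable {n : ℕ} (f : Fin n → ZMod 2) (w : Randomness n) {s : State}

theorem run_sample_drawn : (run f w sample s).drawn = s.drawn + 1 := by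
  simp only [sample, run_seq]
  rw [run_drawn_of_noDraw f w (impose 2) _ (by decide)]
  rfl

/-- Homogenization: an example `(a, y)` becomes one vector of length `n + 1`, and imposing
orthogonality to it adds one equation. The parities consistent with the examples are the members of
the row space with last coordinate `1`. -/
theorem Consistent.run_sample (hs : Env n s) (h : Consistent f w s) :
    Consistent f w (run f w sample s) where
  mem_iff z := by
    rw [run_sample_drawn]
    simp only [sample, run_seq]
    set s₁ := run f w (.draw 1 14) s with hs₁
    have hE₁ : Env n s₁ := hs.run f w (by decide) (by decide) (by decide) (by decide)
    set s₂ := run f w (.store 1 (.reg 0) (.reg 14 % .const 2)) s₁ with hs₂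
    have hE₂ : Env n s₂ := hE₁.run f w (by decide) (by decide) (by decide) (by decide)
    rw [mem_rowSpace_impose f w hE₂ (by decide) (by decide)]
    have hrow : s₂.rowSpace n 2 = s.rowSpace n 2 := by
      simp only [State.rowSpace, State.entry, hs₂, hs₁]
      rw [run_arr_of_notMem f w _ _ (by decide), run_arr_of_notMem f w _ _ (by decide)]
    -- The label was stored in entry `n` of array `1`, just behind the point.
    have hvec : z ⬝ᵥ s₂.vec n 1 = (fun i : Fin n => z i.castSucc) ⬝ᵥ w.1 s.drawn +
        z (Fin.last n) * (f ⬝ᵥ w.1 s.drawn) := by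
      simp only [dotProduct, Fin.sum_univ_castSucc]
      congr 1
      · refine Finset.sum_congr rfl fun i _ => ?_
        congr 1
        simp only [State.vec, hs₂, run_store, State.setArr_arr, Expr.eval_reg, hE₁.dim, true_and]
        rw [if_neg (by simpa using i.2.ne)]
        simp [hs₁, run]
      · congr 1
        simp only [State.vec, hs₂, run_store, State.setArr_arr, Expr.eval_reg, hE₁.dim, true_and]
        rw [if_pos (by simp), Expr.eval_mod, Expr.eval_const, natCast_mod_two]
        simp [hs₁, run, dotProduct]
    rw [hrow, hvec, h.mem_iff]
    constructor
    · rintro ⟨h1, h2⟩ l hl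
      rcases Nat.lt_succ_iff_lt_or_eq.1 hl with hl | rfl
      · exact h1 l hl
      · exact h2
    · exact fun h => ⟨fun l hl => h l (by omega), h _ (by omega)⟩

end sample

/-! ## A trial -/

/-- Set register `16` to the conjunction of as many coins as register `7` tells. -/
def coins : Cmd :=
  .seq (.set 16 (.const 1))
    (.rep (.reg 7) (.seq (.coin 17) (.set 16 (.reg 16 * .reg 17 % .const 2))))

/-- Copy the matrix in array `2` to array `3`. -/
def copyMatrix : Cmd := .loop 10 (.reg 8) (.store 3 (.reg 10) (.get 2 (.reg 10) % .const 2))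

/-- Clear array `1`. -/
def clear : Cmd := .loop 10 (.reg 3) (.store 1 (.reg 10) (.const 0))

/-- Decide whether to use the coordinate in register `15`, and if not, require it to vanish. -/
def chooseCoord : Cmd :=
  .seq coins (.seq (.store 1 (.reg 15) ((.const 1 - .reg 16) % .const 2))
    (.seq (impose 3) (.store 1 (.reg 15) (.const 0))))

/-- Copy array `6` to the output. -/
def copyOut : Cmd := .loop 10 (.reg 0) (.store 0 (.reg 10) (.get 6 (.reg 10) % .const 2))

/-- Look for a consistent hypothesis supported in a random set of coordinates. -/
def trial : Cmd :=
  .seq copyMatrix (.seq clear (.seq (.loop 15 (.reg 0) chooseCoord)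
    (.seq (.store 1 (.reg 0) (.const 1)) (.seq (select 3)
      (.ite (.get 5 (.reg 13) % .const 2) copyOut .skip)))))

/-- In a block of coins starting at `b`, with `j` coins for each coordinate, the coordinate `i` is
chosen if all its coins show heads. -/
def chosen (c : ℕ → Bool) (b j i : ℕ) : Prop := ∀ l < j, c (b + i * j + l) = true

section trial

variable {n m : ℕ} (f : Fin m → ZMod 2) (w : Randomness m) {s : State}

open Classical in
theorem coins_spec : (run f w coins s).flipped = s.flipped + s.reg 7 ∧
    (run f w coins s).reg 16 = if ∀ l < s.reg 7, w.2 (s.flipped + l) = true then 1 else 0 := by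
  simp only [coins, run_seq, run_set, run_rep, Expr.eval_reg, Expr.eval_const, State.setReg_reg]
  rw [if_neg (by decide)]
  generalize s.reg 7 = j
  induction j with
  | zero => simp
  | succ j ih =>
    rw [Function.iterate_succ_apply']
    set s' := (run f w (Cmd.seq (Cmd.coin 17) (Cmd.set 16 (Expr.reg 16 * Expr.reg 17 % Expr.const 2))))^[j]
      (s.setReg 16 1)
    simp only [run_seq, run_set, State.setReg_flipped, State.setReg_reg, if_true, Expr.eval_mod,
      Expr.eval_mul, Expr.eval_reg, Expr.eval_const]
    simp only [run, Function.update_self, ih.1, Function.update_of_ne (show 16 ≠ 17 by decide), ih.2]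
    refine ⟨by ring, ?_⟩
    rcases hb : w.2 (s.flipped + j)
    · rw [if_neg (c := ∀ l < j + 1, w.2 (s.flipped + l) = true)
        (fun h => by simpa [hb] using h j (by omega))]
      simp
    · by_cases h : ∀ l < j, w.2 (s.flipped + l) = true
      · rw [if_pos h, if_pos]
        · simp
        · intro l hl
          rcases Nat.lt_succ_iff_lt_or_eq.1 hl with hl | rfl
          · exact h l hl
          · exact hb
      · rw [if_neg h, if_neg fun h' => h fun l hl => h' l (by omega)]
        simp

theorem copyMatrix_spec (hs : Env n s) : ∀ q < (n + 1) * (n + 1),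
    ((run f w copyMatrix s).arr 3 q : ZMod 2) = s.arr 2 q := by
  refine run_loop f w (x := 10) (e := .reg 8) (s := s) (N := (n + 1) * (n + 1))
    (p := .store 3 (.reg 10) (.get 2 (.reg 10) % .const 2))
    (fun j s' => ∀ q < j, (s'.arr 3 q : ZMod 2) = s.arr 2 q)
    (by decide) (by decide) (by decide) (fun i s' v h => h) ?_ (by simp [hs.entries]) hs.lt_mod
    (by simp)
  intro j hj s' hj' hreg harr ih q hq
  have e2 : s'.arr 2 = s.arr 2 := harr 2 (by decide)
  simp only [run_store, State.setArr_arr, Expr.eval_reg, Expr.eval_mod, Expr.eval_get,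
    Expr.eval_const, hj', e2, true_and]
  split_ifs with h
  · subst h
    rw [natCast_mod_two]
  · exact ih q (by omega)

theorem clear_spec (hs : Env n s) : ∀ l < n + 1, (run f w clear s).arr 1 l = 0 := by
  have hW : n + 1 < s.reg modReg := lt_of_le_of_lt (Nat.le_mul_of_pos_left _ (by omega)) hs.lt_mod
  refine run_loop f w (x := 10) (e := .reg 3) (s := s) (N := n + 1)
    (p := .store 1 (.reg 10) (.const 0))
    (fun j s' => ∀ l < j, s'.arr 1 l = 0)
    (by decide) (by decide) (by decide) (fun i s' v h => h) ?_ (by simp [hs.width]) hW (by simp)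
  intro j hj s' hj' hreg harr ih l hl
  simp only [run_store, State.setArr_arr, Expr.eval_reg, Expr.eval_const, hj', true_and]
  split_ifs with h
  · rfl
  · exact ih l (by omega)

theorem copyOut_spec (hs : Env n s) : ∀ l < n,
    ((run f w copyOut s).arr 0 l : ZMod 2) = s.arr 6 l := by
  have hW : n + 1 < s.reg modReg := lt_of_le_of_lt (Nat.le_mul_of_pos_left _ (by omega)) hs.lt_mod
  have h := run_loop f w (x := 10) (e := .reg 0) (s := s) (N := n)
    (p := .store 0 (.reg 10) (.get 6 (.reg 10) % .const 2))
    (fun j s' => ∀ l < j, (s'.arr 0 l : ZMod 2) = s.arr 6 l)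
    (by decide) (by decide) (by decide) (fun i s' v h => h) ?_ (by simp [hs.dim]) (by omega)
    (by simp)
  · exact h
  intro j hj s' hj' hreg harr ih q hq
  have e2 : s'.arr 6 = s.arr 6 := harr 6 (by decide)
  simp only [run_store, State.setArr_arr, Expr.eval_reg, Expr.eval_mod, Expr.eval_get,
    Expr.eval_const, hj', e2, true_and]
  split_ifs with h
  · subst h
    rw [natCast_mod_two]
  · exact ih q (by omega)

theorem rowSpace_copyMatrix (hs : Env n s) :
    (run f w copyMatrix s).rowSpace n 3 = s.rowSpace n 2 := by
  have h := copyMatrix_spec f w hs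
  simp only [State.rowSpace, State.entry]
  congr 2
  funext i l
  exact h _ (by nlinarith [i.2, l.2])

theorem Env.congr {s' : State} (hs : Env n s) (h0 : s'.reg 0 = s.reg 0) (h3 : s'.reg 3 = s.reg 3)
    (h8 : s'.reg 8 = s.reg 8) (h4 : s'.reg modReg = s.reg modReg) : Env n s' :=
  ⟨h0.trans hs.dim, h3.trans hs.width, h8.trans hs.entries, h4 ▸ hs.lt_mod⟩

open Classical in
/-- The vectors which survive the random restriction of coordinates. -/
theorem chooseCoords_spec (hs : Env n s) (h1 : ∀ l < n + 1, s.arr 1 l = 0) :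
    (run f w (.loop 15 (.reg 0) chooseCoord) s).flipped = s.flipped + n * s.reg 7 ∧
    (∀ l < n + 1, (run f w (.loop 15 (.reg 0) chooseCoord) s).arr 1 l = 0) ∧
    ∀ z : Fin (n + 1) → ZMod 2,
      z ∈ (run f w (.loop 15 (.reg 0) chooseCoord) s).rowSpace n 3 ↔ z ∈ s.rowSpace n 3 ∧
        ∀ i : Fin n, ¬ chosen w.2 s.flipped (s.reg 7) i → z i.castSucc = 0 := by
  have hW : n + 1 < s.reg modReg := lt_of_le_of_lt (Nat.le_mul_of_pos_left _ (by omega)) hs.lt_mod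
  have h := run_loop f w (x := 15) (e := .reg 0) (s := s) (N := n) (p := chooseCoord)
    (fun j s' => s'.flipped = s.flipped + j * s.reg 7 ∧ (∀ l < n + 1, s'.arr 1 l = 0) ∧
      ∀ z : Fin (n + 1) → ZMod 2, z ∈ s'.rowSpace n 3 ↔ z ∈ s.rowSpace n 3 ∧
        ∀ i : Fin n, (i : ℕ) < j → ¬ chosen w.2 s.flipped (s.reg 7) i → z i.castSucc = 0)
    (by decide) (by decide) (by decide) (fun i s' v h => h) ?_ (by simp [hs.dim]) (by omega)
    ⟨by simp, h1, by simp⟩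
  · exact ⟨h.1, h.2.1, fun z => (h.2.2 z).trans (by simp)⟩
  intro j hj s' hj' hreg harr ⟨ih1, ih2, ih3⟩
  have hs' : Env n s' := hs.congr (hreg _ (by decide) (by decide)) (hreg _ (by decide) (by decide))
    (hreg _ (by decide) (by decide)) (hreg _ (by decide) (by decide))
  have h7 : s'.reg 7 = s.reg 7 := hreg _ (by decide) (by decide)
  obtain ⟨hc1, hc2⟩ := coins_spec f w (s := s')
  simp only [chooseCoord, run_seq]
  set s₁ := run f w coins s' with hs₁
  have hE₁ : Env n s₁ := hs'.run f w (by decide) (by decide) (by decide) (by decide)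
  have h15 : s₁.reg 15 = j := by rw [hs₁, run_reg_of_notMem _ _ _ _ (by decide), hj']
  have hA₁ : s₁.arr = s'.arr := funext fun a => run_arr_of_notMem _ _ _ _ (by simp [coins, Cmd.arrs])
  set s₂ := run f w (.store 1 (.reg 15) ((.const 1 - .reg 16) % .const 2)) s₁ with hs₂
  have hE₂ : Env n s₂ := hE₁.run f w (by decide) (by decide) (by decide) (by decide)
  set s₃ := run f w (impose 3) s₂ with hs₃
  have hA3 : s₂.rowSpace n 3 = s'.rowSpace n 3 := by
    simp only [State.rowSpace, State.entry]
    rw [hs₂, run_arr_of_notMem _ _ _ _ (by decide), hA₁]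
  have hz : ∀ z, z ∈ s₃.rowSpace n 3 ↔ _ := mem_rowSpace_impose f w hE₂ (by decide) (by decide)
  have h1₃ : s₃.arr 1 = s₂.arr 1 := run_arr_of_notMem _ _ _ _ (by decide)
  have h15₃ : s₃.reg 15 = j := by
    rw [hs₃, run_reg_of_notMem _ _ _ _ (by decide), hs₂, run_reg_of_notMem _ _ _ _ (by decide), h15]
  have h1₂ : ∀ l, s₂.arr 1 l = if l = j then (1 - s₁.reg 16) % 2 else s'.arr 1 l := by
    intro l
    simp [hs₂, h15, hA₁]
  refine ⟨?_, fun l hl => ?_, fun z => ?_⟩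
  · simp only [run_store, State.setArr_flipped]
    rw [hs₃, run_flipped_of_noCoin _ _ _ _ (by decide), hs₂,
      run_flipped_of_noCoin _ _ _ _ (by decide), hc1, ih1, h7]
    ring
  · simp only [run_store, State.setArr_arr, true_and, Expr.eval_reg, Expr.eval_const, h15₃]
    split_ifs with h
    · rfl
    · rw [h1₃, h1₂, if_neg h, ih2 l hl]
  · have hr : (run f w (.store 1 (.reg 15) (.const 0)) s₃).rowSpace n 3 = s₃.rowSpace n 3 := by
      simp only [State.rowSpace, State.entry]
      rw [run_arr_of_notMem _ _ _ _ (by decide)]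
    -- Array `1` vanishes except perhaps at `j`. There it is `1` for a rejected coordinate, and `0`
    -- for a chosen one, in which case the imposed condition is empty.
    have hdot : z ⬝ᵥ s₂.vec n 1 = z (Fin.castSucc ⟨j, hj⟩) * ((1 - s₁.reg 16 : ℕ) : ZMod 2) := by
      rw [dotProduct, Finset.sum_eq_single (Fin.castSucc ⟨j, hj⟩)]
      · simp [State.vec, h1₂]
      · intro l _ hl
        have : (l : ℕ) ≠ j := fun h => hl (Fin.ext h)
        simp [State.vec, h1₂, this, ih2 l l.2]
      · simp
    have hc2' : s₁.reg 16 = if chosen w.2 s.flipped (s.reg 7) j then 1 else 0 := by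
      rw [hc2, h7, ih1]; exact if_congr Iff.rfl rfl rfl
    rw [hr, hz, hA3, ih3, hdot, hc2', and_assoc]
    refine and_congr_right fun _ => ?_
    constructor
    · rintro ⟨h2, h3⟩ i hi hni
      rcases Nat.lt_succ_iff_lt_or_eq.1 hi with hi | hi
      · exact h2 i hi hni
      · have : i = ⟨j, hj⟩ := Fin.ext hi
        subst this
        rw [if_neg hni] at h3
        simpa using h3
    · intro h
      refine ⟨fun i hi => h i (by omega), ?_⟩
      by_cases hcj : chosen w.2 s.flipped (s.reg 7) j
      · simp [if_pos hcj]
      · rw [h ⟨j, hj⟩ (by simp) hcj, zero_mul]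

/-- A trial either outputs a vector of the row space of array `2` which has last coordinate `1` and
is supported in the chosen coordinates, or there is none. -/
theorem trial_spec (hs : Env n s) :
    (run f w trial s).flipped = s.flipped + n * s.reg 7 ∧
    ((∃ z ∈ s.rowSpace n 2, z (Fin.last n) = 1 ∧
        (∀ i : Fin n, ¬ chosen w.2 s.flipped (s.reg 7) i → z i.castSucc = 0) ∧
        output n (run f w trial s) = fun i => z i.castSucc) ∨
      (output n (run f w trial s) = output n s ∧ ∀ z ∈ s.rowSpace n 2,
        (∀ i : Fin n, ¬ chosen w.2 s.flipped (s.reg 7) i → z i.castSucc = 0) →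
          z (Fin.last n) = 0)) := by
  simp only [trial, run_seq]
  set s₁ := run f w copyMatrix s with hs₁
  have hE₁ : Env n s₁ := hs.run f w (by decide) (by decide) (by decide) (by decide)
  set s₂ := run f w clear s₁ with hs₂
  have hE₂ : Env n s₂ := hE₁.run f w (by decide) (by decide) (by decide) (by decide)
  set s₃ := run f w (.loop 15 (.reg 0) chooseCoord) s₂ with hs₃
  have hE₃ : Env n s₃ := hE₂.run f w (by decide) (by decide) (by decide) (by decide)
  set s₄ := run f w (.store 1 (.reg 0) (.const 1)) s₃ with hs₄
  have hE₄ : Env n s₄ := hE₃.run f w (by decide) (by decide) (by decide) (by decide)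
  set s₅ := run f w (select 3) s₄ with hs₅
  have hE₅ : Env n s₅ := hE₄.run f w (by decide) (by decide) (by decide) (by decide)
  have hr₂ : s₂.rowSpace n 3 = s.rowSpace n 2 := by
    rw [← rowSpace_copyMatrix f w hs]
    simp only [State.rowSpace, State.entry]
    rw [hs₂, run_arr_of_notMem _ _ _ _ (by decide)]
  have h7 : s₂.reg 7 = s.reg 7 := by
    rw [hs₂, run_reg_of_notMem _ _ _ _ (by decide), hs₁, run_reg_of_notMem _ _ _ _ (by decide)]
  have hf₂ : s₂.flipped = s.flipped := by
    rw [hs₂, run_flipped_of_noCoin _ _ _ _ (by decide), hs₁,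
      run_flipped_of_noCoin _ _ _ _ (by decide)]
  obtain ⟨hf₃, h1₃, hz⟩ := chooseCoords_spec f w hE₂ (clear_spec f w hE₁)
  rw [hf₂, h7, ← hs₃] at hf₃
  rw [hr₂, hf₂, h7, ← hs₃] at hz
  rw [← hs₃] at h1₃
  have hf₅ : s₅.flipped = s.flipped + n * s.reg 7 := by
    rw [hs₅, run_flipped_of_noCoin _ _ _ _ (by decide), hs₄,
      run_flipped_of_noCoin _ _ _ _ (by decide), hf₃]
  have ho₅ : output n s₅ = output n s := by
    unfold output
    rw [hs₅, run_arr_of_notMem _ _ _ _ (by decide), hs₄, run_arr_of_notMem _ _ _ _ (by decide),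
      hs₃, run_arr_of_notMem _ _ _ _ (by decide), hs₂, run_arr_of_notMem _ _ _ _ (by decide),
      hs₁, run_arr_of_notMem _ _ _ _ (by decide)]
  obtain ⟨p, hp13, h5, h6, hp⟩ := select_spec f w hE₄ (A := 3) (by decide) (by decide)
  rw [← hs₅] at hp13 h5 h6
  have he : ∀ i l, s₄.entry n 3 i l = s₃.entry n 3 i l := by
    intro i l
    simp only [State.entry]
    rw [hs₄, run_arr_of_notMem _ _ _ _ (by decide)]
  -- Array `1` is now the last unit vector, so a row not orthogonal to it is a row with last
  -- coordinate `1`, that is, a consistent parity.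
  have hlast : ∀ v : Fin (n + 1) → ZMod 2, v ⬝ᵥ s₄.vec n 1 = v (Fin.last n) := by
    intro v
    rw [dotProduct, Finset.sum_eq_single (Fin.last n)]
    · simp [State.vec, hs₄, hE₃.dim]
    · intro l _ hl
      have : (l : ℕ) ≠ n := fun h => hl (Fin.ext h)
      simp [State.vec, hs₄, hE₃.dim, this, h1₃ l l.2]
    · simp
  simp only [hlast] at h5 hp
  have hrowp : (fun l : Fin (n + 1) => s₃.entry n 3 p l) ∈ s₃.rowSpace n 3 :=
    Submodule.subset_span ⟨p, rfl⟩
  have hcond : (s₅.arr 5 p % 2 ≠ 0) ↔ s₃.entry n 3 p n ≠ 0 := by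
    rw [Ne, ← natCast_zmod_two_eq_zero, h5 p, he]; simp
  simp only [run_ite, Expr.eval_mod, Expr.eval_get, Expr.eval_reg, Expr.eval_const, hp13, hcond]
  split_ifs with hc
  · refine ⟨by rw [run_flipped_of_noCoin _ _ _ _ (by decide), hf₅], Or.inl
      ⟨_, ((hz _).1 hrowp).1, ?_, ((hz _).1 hrowp).2, funext fun i => ?_⟩⟩
    · have h2 : ∀ a : ZMod 2, a ≠ 0 → a = 1 := by decide
      exact h2 _ (by simpa using hc)
    · simp only [output]
      rw [copyOut_spec f w hE₅ i i.2]
      have := h6 i.castSucc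
      simp only [Fin.val_castSucc] at this
      rw [this, he]
      simp
  · refine ⟨hf₅, Or.inr ⟨ho₅, fun z hz2 hzc => ?_⟩⟩
    have hz3 := (hz z).2 ⟨hz2, hzc⟩
    -- The selected row is a nonzero one for the last coordinate whenever such a row exists. As it
    -- has last coordinate `0`, so do all rows and hence all their combinations.
    have hp' : ∀ i : Fin (n + 1), s₃.entry n 3 i n = 0 := by
      intro i
      rcases hp with hp | hp
      · simpa [he] using hp i
      · rw [he] at hp
        exact absurd (by simpa using hp) hc
    rw [State.rowSpace, Submodule.mem_span_range_iff_exists_fun] at hz3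
    obtain ⟨g, rfl⟩ := hz3
    simp [hp']

end trial
/-! ## The learner -/

/-- Rename a program so that it uses the registers and arrays `b, b + 2, b + 4, …`. -/
def Cmd.shift (b : ℕ) (p : Cmd) : Cmd := p.rename fun x => b + 2 * x

/-- Move the input out of the way, and compute the parameters `k` and `t` by the programs `pk` and
`pt`. -/
def setup (pk pt : Cmd) : Cmd :=
  .seq (.set 50 (.reg 1 + .const 1)) <| .seq (.set 51 (.reg 2)) <|
  .seq (.set 1 (.const 0)) <| .seq (.set 2 (.const 0)) <|
  .seq (.set 100 (.reg 0)) <| .seq (pk.shift 100) <|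
  .seq (.set 101 (.reg 0)) <| .seq (pt.shift 101) <|
  .seq (.set modReg ((.reg 0 + .const 2) * (.reg 0 + .const 2))) <|
  .seq (.set 5 (.reg 100)) (.set 6 (.reg 101))

/-- The configuration after the setup. -/
structure Ready (n k t L E : ℕ) (s : State) : Prop where
  dim : s.reg 0 = n
  mod_eq : s.reg modReg = (n + 2) * (n + 2)
  weight : s.reg 5 = k
  blocks : s.reg 6 = t
  confidence : s.reg 50 = L + 1
  accuracy : s.reg 51 = E
  reg_zero : ∀ x < 50, x ∉ [0, modReg, 5, 6] → s.reg x = 0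
  arr_zero : ∀ a < 50, ∀ i, s.arr a i = 0
  drawn : s.drawn = 0
  flipped : s.flipped = 0

theorem exec_set {n : ℕ} (f : Fin n → ZMod 2) (w : Randomness n) (s : State) (x : ℕ) (e : Expr) :
    Exec f w (.set x e) s (s.setReg x (e.eval s)) (e.cost s + 1) := Exec.set s x e

@[simp] theorem Expr.cost_reg (s : State) (x : ℕ) :
    (Expr.reg x).cost s = 1 + (s.reg x).size := rfl
@[simp] theorem Expr.cost_const (s : State) (c : ℕ) :
    (Expr.const c).cost s = 1 + c.size := rfl
@[simp] theorem Expr.cost_add (s : State) (a b : Expr) :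
    (a + b).cost s = a.cost s + b.cost s + 1 + (a.eval s).size + (b.eval s).size := rfl
@[simp] theorem Expr.cost_mul (s : State) (a b : Expr) :
    (a * b).cost s = a.cost s + b.cost s + 1 + (a.eval s).size + (b.eval s).size := rfl

/-- After renaming, `pk` owns the even registers and arrays from `100` on and `pt` the odd ones from
`101` on. Each bank looks like `init [n]` when its program starts, and nothing below `100` is
touched, so the hypotheses on the two programs transfer with their running times. -/
theorem exec_setup {n k t L E Ck Ct : ℕ} {pk pt : Cmd} (f : Fin n → ZMod 2) (w : Randomness n)
    (hk : ∃ (s : State) (τ : ℕ), Exec f w pk (init [n]) s τ ∧ s.reg 0 = k ∧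
      s.drawn = 0 ∧ s.flipped = 0 ∧ τ ≤ Ck * (n + 1) ^ 2)
    (ht : ∃ (s : State) (τ : ℕ), Exec f w pt (init [n]) s τ ∧ s.reg 0 = t ∧
      s.drawn = 0 ∧ s.flipped = 0 ∧ τ ≤ Ct * (n + 1) ^ 2) :
    ∃ s, Ready n k t L E s ∧ ∃ τ ≤ (Ck + Ct) * (n + 1) ^ 2 + (50 + 12 * n + k + t + 2 * L + E),
      Exec f w (setup pk pt) (init [n, L, E]) s τ := by
  obtain ⟨u, τ, hu, hu0, hud, huf, hτ⟩ := hk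
  obtain ⟨u', τ', hu', hu0', hud', huf', hτ'⟩ := ht
  have hinj : ∀ b, Function.Injective fun x : ℕ => b + 2 * x := fun b x y h => by
    simpa using h
  obtain ⟨s₁, hs₁⟩ : ∃ s, s = ((((((init [n, L, E]).setReg 50 (L + 1)).setReg 51 E).setReg 1 0).setReg
    2 0).setReg 100 n) := ⟨_, rfl⟩
  have hi : ∀ (m : ℕ) x, x ≠ 0 → (init [m]).reg x = 0 := by
    intro m x hx
    obtain ⟨y, rfl⟩ := Nat.exists_eq_succ_of_ne_zero hx
    simp [init]
  have hi3 : ∀ x, 3 ≤ x → (init [n, L, E]).reg x = 0 := by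
    intro x hx
    obtain ⟨y, rfl⟩ := Nat.exists_eq_add_of_le' hx
    simp [init]
  have hemb₁ : State.embed (fun x : ℕ => 100 + 2 * x) s₁ (init [n]) = s₁ := by
    refine State.embed_eq_self (fun x => ?_) (fun a => ?_) ?_ ?_
    · rcases Nat.eq_zero_or_pos x with rfl | hx
      · simp [hs₁, init]
      · rw [hi _ _ hx.ne', hs₁]
        simp only [State.setReg_reg]
        rw [if_neg (by omega), if_neg (by omega), if_neg (by omega), if_neg (by omega),
          if_neg (by omega), hi3 _ (by omega)]
    all_goals rw [hs₁]; rfl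
  have hx₁ := hu.rename (hinj 100) s₁
  rw [hemb₁] at hx₁
  obtain ⟨s₂, hs₂⟩ : ∃ s, s = State.embed (fun x : ℕ => 100 + 2 * x) s₁ u := ⟨_, rfl⟩
  rw [← hs₂] at hx₁
  have h100 : s₂.reg 100 = k := by rw [hs₂, ← hu0]; exact State.embed_reg (hinj 100) s₁ u 0
  have hreg₂ : ∀ y, y < 100 ∨ y % 2 = 1 → s₂.reg y = s₁.reg y := fun y hy => by
    rw [hs₂]; exact State.embed_reg_of_notMem _ _ (fun x => by omega)
  have harr₂ : ∀ y, y < 100 ∨ y % 2 = 1 → s₂.arr y = s₁.arr y := fun y hy => by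
    rw [hs₂]; exact State.embed_arr_of_notMem _ _ (fun x => by omega)
  obtain ⟨s₃, hs₃⟩ : ∃ s, s = s₂.setReg 101 n := ⟨_, rfl⟩
  have hd₂ : s₂.drawn = 0 := by rw [hs₂]; exact hud
  have hf₂ : s₂.flipped = 0 := by rw [hs₂]; exact huf
  have hemb₃ : State.embed (fun x : ℕ => 101 + 2 * x) s₃ (init [n]) = s₃ := by
    refine State.embed_eq_self (fun x => ?_) (fun a => ?_) ?_ ?_
    · rcases Nat.eq_zero_or_pos x with rfl | hx
      · simp [hs₃, init]
      · rw [hi _ _ hx.ne', hs₃, State.setReg_reg, if_neg (by omega), hreg₂ _ (by omega), hs₁]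
        simp only [State.setReg_reg]
        rw [if_neg (by omega), if_neg (by omega), if_neg (by omega), if_neg (by omega),
          if_neg (by omega), hi3 _ (by omega)]
    · rw [hs₃, State.setReg_arr, harr₂ _ (by omega), hs₁]; rfl
    · rw [hs₃]; exact hd₂
    · rw [hs₃]; exact hf₂
  have hx₃ := hu'.rename (hinj 101) s₃
  rw [hemb₃] at hx₃
  obtain ⟨s₄, hs₄⟩ : ∃ s, s = State.embed (fun x : ℕ => 101 + 2 * x) s₃ u' := ⟨_, rfl⟩
  rw [← hs₄] at hx₃
  have h101 : s₄.reg 101 = t := by rw [hs₄, ← hu0']; exact State.embed_reg (hinj 101) s₃ u' 0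
  have hreg₄ : ∀ y ≤ 100, s₄.reg y = s₂.reg y := fun y hy => by
    rw [hs₄, State.embed_reg_of_notMem _ _ (fun x => by omega), hs₃,
      State.setReg_reg, if_neg (by omega)]
  have harr₄ : ∀ y ≤ 100, s₄.arr y = s₂.arr y := fun y hy => by
    rw [hs₄, State.embed_arr_of_notMem _ _ (fun x => by omega), hs₃,
      State.setReg_arr]
  have h₄₁ : ∀ y < 100, s₄.reg y = s₁.reg y := fun y hy => by
    rw [hreg₄ y (by omega), hreg₂ y (by omega)]
  have h0₁ : s₁.reg 0 = n := by simp [hs₁, init]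
  have h0₂ : s₂.reg 0 = n := by rw [hreg₂ _ (by omega), h0₁]
  have h0₄ : s₄.reg 0 = n := by rw [h₄₁ _ (by omega), h0₁]
  have h100₄ : s₄.reg 100 = k := by rw [hreg₄ _ (by omega), h100]
  have e1 : (init [n, L, E]).reg 1 = L := rfl
  have e2 : (init [n, L, E]).reg 2 = E := rfl
  have e0 : (init [n, L, E]).reg 0 = n := rfl
  refine ⟨((s₄.setReg modReg ((n + 2) * (n + 2))).setReg 5 k).setReg 6 t, ?_, ?_⟩
  · constructor
    · simp [modReg, h0₄]
    · simp [modReg]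
    · simp
    · simp
    · simp [modReg, h₄₁, hs₁]
    · simp [modReg, h₄₁, hs₁]
    · intro x hx hx'
      simp only [List.mem_cons, List.not_mem_nil, or_false, not_or] at hx'
      simp only [State.setReg_reg]
      rw [if_neg (by omega), if_neg (by omega), if_neg (by omega), h₄₁ x (by omega), hs₁]
      simp only [State.setReg_reg]
      rw [if_neg (by omega), if_neg (c := x = 51) (by omega), if_neg (c := x = 50) (by omega)]
      split_ifs
      · rfl
      · rfl
      · exact hi3 x (by omega)
    · intro a ha i
      simp only [State.setReg_arr]
      rw [harr₄ _ (by omega), harr₂ _ (by omega), hs₁]; rfl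
    · simp only [State.setReg_drawn]; rw [hs₄]; exact hud'
    · simp only [State.setReg_flipped]; rw [hs₄]; exact huf'
  · have hE := Exec.seq (exec_set f w (init [n, L, E]) 50 (.reg 1 + .const 1)) <|
      Exec.seq (exec_set f w _ 51 (.reg 2)) <| Exec.seq (exec_set f w _ 1 (.const 0)) <|
      Exec.seq (exec_set f w _ 2 (.const 0)) <| Exec.seq (exec_set f w _ 100 (.reg 0)) <|
      Exec.seq (s' := s₂) (by
        have : _ = s₁ := hs₁.symm
        simpa [e1, e2, e0] using this ▸ hx₁) <|
      Exec.seq (exec_set f w _ 101 (.reg 0)) <|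
      Exec.seq (s' := s₄) (by simpa [hs₃, h0₂] using hx₃) <|
      Exec.seq (exec_set f w _ modReg ((.reg 0 + .const 2) * (.reg 0 + .const 2))) <|
      Exec.seq (exec_set f w _ 5 (.reg 100)) (exec_set f w _ 6 (.reg 101))
    simp only [Expr.eval_mul, Expr.eval_add, Expr.eval_reg, Expr.eval_const, State.setReg_reg,
      h0₄, h100₄, h101, modReg] at hE
    refine ⟨_, ?_, hE⟩
    simp only [Expr.cost_reg, Expr.cost_const, Expr.cost_add, Expr.cost_mul, Expr.eval_add,
      Expr.eval_reg, Expr.eval_const, State.setReg_reg, e1, e2, e0, h0₂, h0₄, h100₄, h101]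
    have := size_le_self
    have a1 := this n; have a2 := this L; have a3 := this E; have a4 := this (n + 2)
    have a5 := this k; have a6 := this t; have a7 := this 0; have a8 := this 1; have a9 := this 2
    norm_num only [if_true, if_false]
    rw [add_mul]
    omega

/-- Double register `18` and increment register `7`, as long as `2 ^ j * 2 k ≤ t` remains true. -/
def doubling : Cmd :=
  .rep (.reg 0) (.ite (.op .lt (.reg 6) (.reg 18 * .const 4 * .reg 5)) .skip
    (.seq (.set 18 (.reg 18 * .const 2 % .reg modReg))
      (.set 7 ((.reg 7 + .const 1) % .reg modReg))))

/-- Write the identity matrix to array `2`. -/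
def identity : Cmd :=
  .loop 10 (.reg 3) (.store 2 (.reg 10 * .reg 3 + .reg 10) (.const 1))

/-- Compute the parameters of the learner. -/
def prepare : Cmd :=
  .seq (.set 3 ((.reg 0 + .const 1) % .reg modReg)) <|
  .seq (.set 8 (.reg 3 * .reg 3 % .reg modReg)) <|
  .seq (.set 18 (.const 1)) <| .seq doubling <|
  .seq (.set 9 ((.reg 7 * .reg 5 + .reg 0 / .reg 18 + .const 1) % .reg modReg)) identity

/-- The loop is counted, with `n` rounds, to stay within guarded programs. That is enough rounds: as
long as `2 ^ j * (2 * k) ≤ t ≤ n`, one has `j < 2 ^ j ≤ n`. -/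
theorem doubling_spec {n m k t : ℕ} (f : Fin m → ZMod 2) (w : Randomness m) {s : State}
    (h0 : s.reg 0 = n) (hM : n + 2 ≤ s.reg modReg) (h5 : s.reg 5 = k) (h6 : s.reg 6 = t)
    (h7 : s.reg 7 = 0) (h18 : s.reg 18 = 1) (hk : 1 ≤ k) (hkt : 2 * k ≤ t) (htn : t ≤ n) :
    (run f w doubling s).reg 18 = 2 ^ (run f w doubling s).reg 7 ∧
      2 ^ (run f w doubling s).reg 7 * (2 * k) ≤ t ∧
      t < 2 ^ (run f w doubling s).reg 7 * (4 * k) := by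
  set p : Cmd := .ite (.op .lt (.reg 6) (.reg 18 * .const 4 * .reg 5)) .skip
    (.seq (.set 18 (.reg 18 * .const 2 % .reg modReg))
      (.set 7 ((.reg 7 + .const 1) % .reg modReg))) with hp
  -- The last clause says that either every round so far has doubled or the stopping test already
  -- holds; after `n` rounds the first is impossible.
  have key : ∀ i, ∃ s', (run f w p)^[i] s = s' ∧ s'.reg modReg = s.reg modReg ∧ s'.reg 5 = k ∧
      s'.reg 6 = t ∧ s'.reg 18 = 2 ^ s'.reg 7 ∧ 2 ^ s'.reg 7 * (2 * k) ≤ t ∧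
      (s'.reg 7 = i ∨ t < 2 ^ s'.reg 7 * (4 * k)) := by
    intro i
    induction i with
    | zero => exact ⟨s, rfl, rfl, h5, h6, by simp [h18, h7], by simpa [h7] using hkt, Or.inl h7⟩
    | succ i ih =>
      obtain ⟨s', h1, h2, h3, h4, h5', h6', h7'⟩ := ih
      refine ⟨_, rfl, ?_⟩
      rw [Function.iterate_succ_apply', h1]
      simp only [hp, run_ite, Expr.eval_lt, Expr.eval_mul, Expr.eval_reg, Expr.eval_const, h3, h4,
        h5']
      by_cases hc : t < 2 ^ s'.reg 7 * 4 * k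
      · rw [if_pos hc, if_pos one_ne_zero]
        exact ⟨h2, h3, h4, h5', h6', Or.inr (by rwa [mul_assoc] at hc)⟩
      · rw [if_neg hc, if_neg (not_not.2 rfl)]
        have hle : 2 ^ (s'.reg 7 + 1) * (2 * k) ≤ t := by
          rw [pow_succ]; nlinarith [not_lt.1 hc]
        have hlt : 2 ^ (s'.reg 7 + 1) ≤ n := by nlinarith
        have hlt' : s'.reg 7 + 1 < 2 ^ (s'.reg 7 + 1) := Nat.lt_two_pow_self
        simp only [run_seq, run_set, Expr.eval_mod, Expr.eval_mul, Expr.eval_reg, Expr.eval_const,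
          h5', h2, ← pow_succ, Expr.eval_add, State.setReg_reg]
        norm_num only [modReg, if_true, if_false]
        have hM' : n + 2 ≤ s.reg 4 := hM
        rw [Nat.mod_eq_of_lt (show 2 ^ (s'.reg 7 + 1) < s.reg 4 by omega),
          Nat.mod_eq_of_lt (show s'.reg 7 + 1 < s.reg 4 by omega)]
        refine ⟨trivial, h3, h4, rfl, hle, ?_⟩
        rcases h7' with h | h
        · exact Or.inl (by rw [h])
        · exact Or.inr (h.trans_le (by gcongr <;> omega))
  obtain ⟨s', h1, -, -, -, h18', hle, h⟩ := key n
  have hrun : run f w doubling s = s' := by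
    rw [← h1, ← h0]; rfl
  rw [hrun]
  refine ⟨h18', hle, h.resolve_left fun h => ?_⟩
  rw [h] at hle
  have : n < 2 ^ n := Nat.lt_two_pow_self
  nlinarith

/-- Before the first example there is no constraint, so the row space has to be everything. -/
theorem identity_spec {n m : ℕ} (f : Fin m → ZMod 2) (w : Randomness m) {s : State} (hs : Env n s)
    (h2 : ∀ i, s.arr 2 i = 0) (z : Fin (n + 1) → ZMod 2) :
    z ∈ (run f w identity s).rowSpace n 2 := by
  have hW : n + 1 < s.reg modReg := lt_of_le_of_lt (Nat.le_mul_of_pos_left _ (by omega)) hs.lt_mod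
  have h := run_loop f w (x := 10) (e := .reg 3) (s := s) (N := n + 1)
    (p := .store 2 (.reg 10 * .reg 3 + .reg 10) (.const 1))
    (fun j s' => ∀ q, s'.arr 2 q = if ∃ i < j, q = i * (n + 1) + i then 1 else 0)
    (by decide) (by decide) (by decide) (fun i s' v h => h) ?_ (by simp [hs.width]) hW
    (by simp [h2])
  · have hrow : ∀ i l : Fin (n + 1),
        (run f w identity s).entry n 2 i l = (Pi.single i 1 : Fin (n + 1) → ZMod 2) l := by
      intro i l
      simp only [State.entry, identity, h, Pi.single_apply]
      by_cases hil : l = i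
      · subst hil
        rw [if_pos ⟨l, l.2, rfl⟩, if_pos rfl]; simp
      · rw [if_neg hil, if_neg]
        · simp
        · rintro ⟨i', hi', he⟩
          have h1 := congrArg (· / (n + 1)) he
          have h2 := congrArg (· % (n + 1)) he
          simp only [mul_comm _ (n + 1), Nat.mul_add_div (Nat.succ_pos n), Nat.mul_add_mod,
            Nat.mod_eq_of_lt hi', Nat.mod_eq_of_lt l.2, 
            Nat.div_eq_of_lt l.2, Nat.div_eq_of_lt hi'] at h1 h2
          exact hil (Fin.ext (by omega))
    rw [State.rowSpace, Submodule.mem_span_range_iff_exists_fun]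
    refine ⟨z, funext fun l => ?_⟩
    simp [hrow, Pi.single_apply]
  · intro j hj s' hj' hreg harr ih q
    have h3 : s'.reg 3 = n + 1 := by rw [hreg 3 (by decide) (by decide), hs.width]
    simp only [run_store, State.setArr_arr, Expr.eval_reg, Expr.eval_add, Expr.eval_mul,
      Expr.eval_const, hj', h3, true_and]
    split_ifs with ha hb hb
    · rfl
    · exact absurd ⟨j, by omega, ha⟩ hb
    · obtain ⟨i, hi, he⟩ := hb
      rw [ih, if_pos]
      rcases Nat.lt_succ_iff_lt_or_eq.1 hi with hi | rfl
      · exact ⟨i, hi, he⟩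
      · exact absurd he ha
    · rw [ih, if_neg fun ⟨i, hi, he⟩ => hb ⟨i, by omega, he⟩]

/-- The parameters of the learner, as computed by `prepare`. -/
structure Params (n j r L E M : ℕ) (s : State) : Prop where
  small : Small M s
  env : Env n s
  coins : s.reg 7 = j
  samples : s.reg 9 = r
  confidence : s.reg 50 = L + 1
  accuracy : s.reg 51 = E

/-- All parameters are below `(n + 2) * (n + 2)`, so the reductions demanded by guardedness do not
change them. -/
theorem prepare_spec {n k t L E : ℕ} (f : Fin n → ZMod 2) (w : Randomness n) {s : State}
    (hs : Ready n k t L E s) (hk : 1 ≤ k) (hkt : 2 * k ≤ t) (htn : t ≤ n) :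
    ∃ j, 2 ^ j * (2 * k) ≤ t ∧ t < 2 ^ j * (4 * k) ∧ j * k + n / 2 ^ j + 1 < (n + 2) * (n + 2) ∧
      Params n j (j * k + n / 2 ^ j + 1) L E ((n + 2) * (n + 2)) (run f w prepare s) ∧
      (run f w prepare s).reg 5 = k ∧ Consistent f w (run f w prepare s) ∧
      (run f w prepare s).drawn = 0 ∧ (run f w prepare s).flipped = 0 ∧
      ∃ τ ≤ prepare.timeBound ((n + 2) * (n + 2)), Exec f w prepare s (run f w prepare s) τ := by
  have hsq : (n + 2) * (n + 2) = n * n + 4 * n + 4 := by ring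
  have hsmall : Small ((n + 2) * (n + 2)) s := by
    refine ⟨by nlinarith, hs.mod_eq, fun x hx => ?_, fun a ha i => by simp [hs.arr_zero a ha]⟩
    by_cases h : x ∈ [0, modReg, 5, 6]
    · simp only [List.mem_cons, List.not_mem_nil, or_false] at h
      rcases h with rfl | rfl | rfl | rfl
      · rw [hs.dim]; nlinarith
      · rw [hs.mod_eq]
      · rw [hs.weight]; nlinarith
      · rw [hs.blocks]; nlinarith
    · rw [hs.reg_zero x hx h]; exact Nat.zero_le _
  obtain ⟨hsmall', hexec⟩ := exec_of_guarded f w (show n ≤ (n + 2) * (n + 2) by nlinarith)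
    (p := prepare) (by decide) hsmall
  have hdrawn : (run f w prepare s).drawn = 0 := by
    rw [run_drawn_of_noDraw _ _ _ _ (by decide), hs.drawn]
  obtain ⟨s₁, hs₁⟩ : ∃ s', s' = (((s.setReg 3 (n + 1)).setReg 8 ((n + 1) * (n + 1))).setReg 18 1) :=
    ⟨_, rfl⟩
  have hM : s.reg 4 = (n + 2) * (n + 2) := hs.mod_eq
  obtain ⟨h18, hle, hlt⟩ := doubling_spec (n := n) (k := k) (t := t) f w (s := s₁)
    (by simp [hs₁, hs.dim]) (by simp [hs₁, modReg, hM]) (by simp [hs₁, hs.weight])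
    (by simp [hs₁, hs.blocks]) (by simp [hs₁, hs.reg_zero 7 (by decide) (by decide)])
    (by simp [hs₁]) hk hkt htn
  obtain ⟨s₂, hs₂⟩ : ∃ s', s' = run f w doubling s₁ := ⟨_, rfl⟩
  rw [← hs₂] at h18 hle hlt
  obtain ⟨j, hj⟩ : ∃ j, s₂.reg 7 = j := ⟨_, rfl⟩
  rw [hj] at h18 hle hlt
  have hjn : j ≤ n := by
    have : j < 2 ^ j := Nat.lt_two_pow_self
    nlinarith
  have hr : j * k + n / 2 ^ j + 1 < (n + 2) * (n + 2) := by
    have h1 := Nat.div_le_self n (2 ^ j)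
    have h2 : j * k ≤ n * n := Nat.mul_le_mul hjn (by omega)
    omega
  have hreg₂ : ∀ x, x ∉ doubling.regs → s₂.reg x = s₁.reg x := fun x hx => by
    rw [hs₂, run_reg_of_notMem _ _ _ _ hx]
  have hd0 : s₂.reg 0 = n := by rw [hreg₂ _ (by decide)]; simp [hs₁, hs.dim]
  have hd3 : s₂.reg 3 = n + 1 := by rw [hreg₂ _ (by decide)]; simp [hs₁]
  have hd4 : s₂.reg 4 = (n + 2) * (n + 2) := by rw [hreg₂ _ (by decide)]; simp [hs₁, hM]
  have hd5 : s₂.reg 5 = k := by rw [hreg₂ _ (by decide)]; simp [hs₁, hs.weight]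
  have hd8 : s₂.reg 8 = (n + 1) * (n + 1) := by rw [hreg₂ _ (by decide)]; simp [hs₁]
  have hrun : run f w prepare s =
      run f w identity (s₂.setReg 9 (j * k + n / 2 ^ j + 1)) := by
    simp only [prepare, run_seq, run_set, Expr.eval_mod, Expr.eval_add, Expr.eval_mul,
      Expr.eval_reg, Expr.eval_const, Expr.eval_div, State.setReg_reg]
    norm_num only [modReg, if_true, if_false]
    rw [hs.dim, hM, Nat.mod_eq_of_lt (show n + 1 < (n + 2) * (n + 2) by nlinarith),
      Nat.mod_eq_of_lt (show (n + 1) * (n + 1) < (n + 2) * (n + 2) by nlinarith), ← hs₁, ← hs₂,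
      hj, h18, hd0, hd4, hd5, Nat.mod_eq_of_lt hr]
  have henv : Env n (s₂.setReg 9 (j * k + n / 2 ^ j + 1)) :=
    (show Env n s₂ from ⟨hd0, hd3, hd8, by rw [modReg, hd4]; nlinarith⟩).setReg (by decide)
  have harr₂ : ∀ i, s₂.arr 2 i = 0 := fun i => by
    rw [hs₂, run_arr_of_notMem _ _ _ _ (by decide), hs₁]; exact hs.arr_zero 2 (by decide) i
  have hid := identity_spec f w henv harr₂
  refine ⟨j, hle, hlt, hr, ⟨hsmall', ?_, ?_, ?_, ?_, ?_⟩, ?_, ⟨fun z => ?_⟩, hdrawn, ?_, hexec⟩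
  · rw [hrun]; exact henv.run f w (by decide) (by decide) (by decide) (by decide)
  · rw [hrun, run_reg_of_notMem _ _ _ _ (by decide)]; simp [hj]
  · rw [hrun, run_reg_of_notMem _ _ _ _ (by decide)]; simp
  · rw [run_reg_of_notMem _ _ _ _ (by decide), hs.confidence]
  · rw [run_reg_of_notMem _ _ _ _ (by decide), hs.accuracy]
  · rw [run_reg_of_notMem _ _ _ _ (by decide), hs.weight]
  · rw [hdrawn, hrun]; simpa using hid z
  · rw [run_flipped_of_noCoin _ _ _ _ (by decide), hs.flipped]

/-- Compute `2 ^ (j * k)` into register `52`. -/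
def powerTwo : Cmd :=
  .seq (.set 52 (.const 1)) (.rep (.reg 7 * .reg 5) (.set 52 (.reg 52 + .reg 52)))

/-- Process all the examples. -/
def sampling : Cmd :=
  .rep (.reg 51) (.seq (.rep (.reg 50) (.seq sample sample)) (.rep (.reg 9) sample))

/-- Perform all the trials. -/
def trials : Cmd := .rep (.reg 50) (.rep (.reg 52) trial)

/-- The learner, built from programs computing `k` and `t`. -/
def learner (pk pt : Cmd) : Cmd :=
  .seq (setup pk pt) (.seq prepare (.seq powerTwo (.seq sampling trials)))

/-- The vector `g` vanishes outside the coordinates chosen by the block of coins starting at `b`. -/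
def SupportedIn {n : ℕ} (c : ℕ → Bool) (b j : ℕ) (g : Fin n → ZMod 2) : Prop :=
  ∀ i : Fin n, ¬ chosen c b j i → g i = 0

/-! ### Invariants and running times of sampling and of the trials. -/

section phases

variable {n : ℕ} (f : Fin n → ZMod 2) (w : Randomness n)

theorem Params.run {j r L E M : ℕ} {s : State} (h : Params n j r L E M s) (hn : n ≤ M) {p : Cmd}
    (hp : p.guarded = true) (hw : ∀ x ∈ [0, 3, 8, modReg, 7, 9, 50, 51], x ∉ p.regs) :
    Params n j r L E M (run f w p s) ∧ ∃ τ ≤ p.timeBound M, Exec f w p s (run f w p s) τ := by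
  obtain ⟨h1, h2⟩ := exec_of_guarded f w hn hp h.small
  have hreg : ∀ x ∈ [0, 3, 8, modReg, 7, 9, 50, 51], (RAM.run f w p s).reg x = s.reg x :=
    fun x hx => run_reg_of_notMem f w p s (hw x hx)
  refine ⟨⟨h1, h.env.run f w (hw _ (by simp)) (hw _ (by simp)) (hw _ (by simp)) (hw _ (by simp)),
    ?_, ?_, ?_, ?_⟩, h2⟩
  · rw [hreg 7 (by simp), h.coins]
  · rw [hreg 9 (by simp), h.samples]
  · rw [hreg 50 (by simp), h.confidence]
  · rw [hreg 51 (by simp), h.accuracy]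

/-- The value outgrows the modulus, so the program is not guarded and is timed by hand. A bound
polynomial in `j` and `k` and linear in `2 ^ (j * k)` suffices, because at least that many trials
follow. -/
theorem exec_powerTwo {j k : ℕ} {s : State} (h7 : s.reg 7 = j) (h5 : s.reg 5 = k) :
    ∃ τ ≤ 7 + 2 * j + 2 * k + j * k * (5 + 4 * 2 ^ (j * k)),
      Exec f w powerTwo s (s.setReg 52 (2 ^ (j * k))) τ := by
  obtain ⟨h1, τ, hτ, hE⟩ := exec_rep_of_invariant (f := f) (w := w)
    (p := .set 52 (.reg 52 + .reg 52)) (T := 4 + 4 * 2 ^ (j * k)) (e := .reg 7 * .reg 5)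
    (s := s.setReg 52 1) (N := j * k) (by simp [h7, h5])
    (fun i s' => s' = s.setReg 52 (2 ^ i)) (by
      rintro i hi _ rfl
      refine ⟨?_, _, ?_, exec_set f w _ 52 _⟩
      · refine State.ext_of (fun x => ?_) (fun a => rfl) rfl rfl
        simp only [run_set, State.setReg_reg, Expr.eval_add, Expr.eval_reg, if_true]
        split_ifs
        · rw [pow_succ]; ring
        · rfl
      · simp only [Expr.cost_add, Expr.cost_reg, Expr.eval_reg, State.setReg_reg, if_true]
        have h1 := size_le_self (2 ^ i)
        have h2 : 2 ^ i ≤ 2 ^ (j * k) := Nat.pow_le_pow_right (by decide) hi.le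
        omega) (by simp)
  have hseq := Exec.seq (exec_set f w s 52 (.const 1)) hE
  rw [h1] at hseq
  refine ⟨_, ?_, hseq⟩
  refine (Nat.add_le_add_left hτ _).trans ?_
  simp only [Expr.cost_mul, Expr.cost_const, Expr.cost_reg, Expr.eval_reg, State.setReg_reg]
  norm_num only [if_false]
  have a1 := size_le_self j
  have a2 := size_le_self k
  have a3 := size_le_self 1
  rw [h7, h5]
  have : j * k * (4 + 4 * 2 ^ (j * k) + 1) = j * k * (5 + 4 * 2 ^ (j * k)) := by ring
  omega

/-- The state of affairs while examples are being processed. -/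
structure SamplingInv (j r L E M P d : ℕ) (s : State) : Prop where
  params : Params n j r L E M s
  consistent : Consistent f w s
  power : s.reg 52 = P
  drawn : s.drawn = d
  flipped : s.flipped = 0

variable {j r L E M P : ℕ}

theorem SamplingInv.run_sample (hn : n ≤ M) {d : ℕ} {s : State}
    (h : SamplingInv f w j r L E M P d s) :
    SamplingInv f w j r L E M P (d + 1) (run f w sample s) ∧
      ∃ τ ≤ sample.timeBound M, Exec f w sample s (run f w sample s) τ := by
  obtain ⟨h1, h2⟩ := h.params.run f w hn (p := sample) (by decide) (by decide)
  refine ⟨⟨h1, h.consistent.run_sample f w h.params.env, ?_, ?_, ?_⟩, h2⟩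
  · rw [run_reg_of_notMem _ _ _ _ (by decide), h.power]
  · rw [run_sample_drawn, h.drawn]
  · rw [run_flipped_of_noCoin _ _ _ _ (by decide), h.flipped]

/-- The number of examples may exceed the modulus and is never computed: nested loops over the
stored counters `E`, `L + 1` and `r` produce it. -/
theorem exec_sampling (hn : n ≤ M) {s : State} (h : SamplingInv f w j r L E M P 0 s) :
    SamplingInv f w j r L E M P (E * ((L + 1) * 2 + r)) (run f w sampling s) ∧
      ∃ τ ≤ 2 + E + E * ((2 + (L + 1) + (L + 1) * (2 * sample.timeBound M + 1)) +
        (2 + r + r * (sample.timeBound M + 1)) + 1),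
        Exec f w sampling s (run f w sampling s) τ := by
  have hstep : ∀ i, ∀ s, SamplingInv f w j r L E M P (i * ((L + 1) * 2 + r)) s →
      SamplingInv f w j r L E M P ((i + 1) * ((L + 1) * 2 + r))
        (run f w (.seq (.rep (.reg 50) (.seq sample sample)) (.rep (.reg 9) sample)) s) ∧
      ∃ τ ≤ (2 + (L + 1) + (L + 1) * (2 * sample.timeBound M + 1)) +
        (2 + r + r * (sample.timeBound M + 1)),
        Exec f w (.seq (.rep (.reg 50) (.seq sample sample)) (.rep (.reg 9) sample)) s
          (run f w (.seq (.rep (.reg 50) (.seq sample sample)) (.rep (.reg 9) sample)) s) τ := by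
    intro i s hs
    obtain ⟨h1, τ₁, hτ₁, hE₁⟩ := exec_rep_of_invariant (f := f) (w := w)
      (p := .seq sample sample) (T := 2 * sample.timeBound M) (e := .reg 50) (s := s) (N := L + 1)
      hs.params.confidence
      (fun i' s => SamplingInv f w j r L E M P (i * ((L + 1) * 2 + r) + i' * 2) s)
      (fun i' _ s hs => by
        obtain ⟨h1, τ₁, hτ₁, hE₁⟩ := hs.run_sample f w hn
        obtain ⟨h2, τ₂, hτ₂, hE₂⟩ := h1.run_sample f w hn
        refine ⟨?_, _, ?_, Exec.seq hE₁ hE₂⟩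
        · convert h2 using 1
          · ring
          · rfl
        · omega)
      (by simpa using hs)
    obtain ⟨h2, τ₂, hτ₂, hE₂⟩ := exec_rep_of_invariant (f := f) (w := w)
      (p := sample) (T := sample.timeBound M) (e := .reg 9)
      (s := run f w (.rep (.reg 50) (.seq sample sample)) s) (N := r)
      h1.params.samples
      (fun i' s => SamplingInv f w j r L E M P (i * ((L + 1) * 2 + r) + (L + 1) * 2 + i') s)
      (fun i' _ s hs => hs.run_sample f w hn)
      (by simpa using h1)
    refine ⟨?_, _, ?_, Exec.seq hE₁ hE₂⟩
    · convert h2 using 1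
      · ring
      · rfl
    · rw [Expr.cost_reg, hs.params.confidence] at hτ₁
      rw [Expr.cost_reg, h1.params.samples] at hτ₂
      have a1 := size_le_self (L + 1)
      have a2 := size_le_self r
      omega
  obtain ⟨h1, τ, hτ, hE⟩ := exec_rep_of_invariant (f := f) (w := w)
    (p := .seq (.rep (.reg 50) (.seq sample sample)) (.rep (.reg 9) sample)) (e := .reg 51)
    (s := s) (N := E) h.params.accuracy _ (fun i _ => hstep i) (by simpa using h)
  refine ⟨h1, τ, hτ.trans ?_, hE⟩
  rw [Expr.cost_reg, h.params.accuracy]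
  have a1 := size_le_self E
  omega

/-- The state of affairs after `i` trials: either none of them could have found the target, or the
output is consistent with the examples and supported in the chosen coordinates of some trial. -/
structure TrialInv (j r L E M P d i : ℕ) (s : State) : Prop where
  params : Params n j r L E M s
  consistent : Consistent f w s
  power : s.reg 52 = P
  drawn : s.drawn = d
  flipped : s.flipped = i * (n * j)
  output : (∀ i' < i, ¬ SupportedIn w.2 (i' * (n * j)) j f) ∨
    ∃ i' < i, SupportedIn w.2 (i' * (n * j)) j (output n s) ∧
      ∀ l < d, output n s ⬝ᵥ w.1 l = f ⬝ᵥ w.1 l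

theorem TrialInv.run_trial (hn : n ≤ M) {d i : ℕ} {s : State}
    (h : TrialInv f w j r L E M P d i s) :
    TrialInv f w j r L E M P d (i + 1) (run f w trial s) ∧
      ∃ τ ≤ trial.timeBound M, Exec f w trial s (run f w trial s) τ := by
  obtain ⟨h1, h2⟩ := h.params.run f w hn (p := trial) (by decide) (by decide)
  obtain ⟨hf, ht⟩ := trial_spec f w h.params.env
  have hd : (run f w trial s).drawn = s.drawn := run_drawn_of_noDraw _ _ _ _ (by decide)
  refine ⟨⟨h1, ⟨fun z => ?_⟩, ?_, ?_, ?_, ?_⟩, h2⟩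
  · rw [hd, ← h.consistent.mem_iff]
    simp only [State.rowSpace, State.entry]
    rw [run_arr_of_notMem _ _ _ _ (by decide)]
  · rw [run_reg_of_notMem _ _ _ _ (by decide), h.power]
  · rw [hd, h.drawn]
  · rw [hf, h.flipped, h.params.coins]; ring
  · rw [h.flipped, h.params.coins] at ht
    rcases ht with ⟨z, hz, hz1, hzc, ho⟩ | ⟨ho, hz⟩
    · refine Or.inr ⟨i, by omega, ?_, fun l hl => ?_⟩
      · rw [ho]; exact hzc
      · have := (h.consistent.mem_iff z).1 hz l (by rwa [h.drawn])
        rw [hz1, one_mul] at this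
        rw [ho]
        exact CharTwo.add_eq_zero.1 this
    · rw [ho]
      rcases h.output with ho' | ⟨i', hi', h'⟩
      · refine Or.inl fun i' hi' => ?_
        rcases Nat.lt_succ_iff_lt_or_eq.1 hi' with hi' | rfl
        · exact ho' i' hi'
        · intro hsupp
          -- The vector `(f, 1)` satisfies every example, so a trial whose coordinates cover the
          -- support of `f` cannot end without a hypothesis.
          have hmem : (Fin.snoc f 1 : Fin (n + 1) → ZMod 2) ∈ s.rowSpace n 2 := by
            rw [h.consistent.mem_iff]
            intro l _
            simp only [Fin.snoc_castSucc, Fin.snoc_last, one_mul]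
            exact CharTwo.add_self_eq_zero _
          have := hz _ hmem (fun a ha => by
            rw [Fin.snoc_castSucc (α := fun _ => ZMod 2)]; exact hsupp a ha)
          rw [Fin.snoc_last (α := fun _ => ZMod 2)] at this
          exact one_ne_zero this
      · exact Or.inr ⟨i', by omega, h'⟩

theorem exec_trials (hn : n ≤ M) {d : ℕ} {s : State} (h : TrialInv f w j r L E M P d 0 s) :
    TrialInv f w j r L E M P d ((L + 1) * P) (run f w trials s) ∧
      ∃ τ ≤ 2 + (L + 1) + (L + 1) * (2 + P + P * (trial.timeBound M + 1) + 1),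
        Exec f w trials s (run f w trials s) τ := by
  have hstep : ∀ i, ∀ s, TrialInv f w j r L E M P d (i * P) s →
      TrialInv f w j r L E M P d ((i + 1) * P) (run f w (.rep (.reg 52) trial) s) ∧
      ∃ τ ≤ 2 + P + P * (trial.timeBound M + 1),
        Exec f w (.rep (.reg 52) trial) s (run f w (.rep (.reg 52) trial) s) τ := by
    intro i s hs
    obtain ⟨h1, τ, hτ, hE⟩ := exec_rep_of_invariant (f := f) (w := w)
      (p := trial) (T := trial.timeBound M) (e := .reg 52) (s := s) (N := P)
      hs.power (fun i' s => TrialInv f w j r L E M P d (i * P + i') s)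
      (fun i' _ s hs => hs.run_trial f w hn) (by simpa using hs)
    refine ⟨?_, τ, ?_, hE⟩
    · convert h1 using 1; ring
    · rw [Expr.cost_reg, hs.power] at hτ
      have a1 := size_le_self P
      omega
  obtain ⟨h1, τ, hτ, hE⟩ := exec_rep_of_invariant (f := f) (w := w)
    (p := .rep (.reg 52) trial) (e := .reg 50)
    (s := s) (N := L + 1) h.params.confidence _ (fun i _ => hstep i) (by simpa using h)
  refine ⟨h1, τ, hτ.trans ?_, hE⟩
  rw [Expr.cost_reg, h.params.confidence]
  have a1 := size_le_self (L + 1)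
  omega

end phases

/-- The polynomial overhead of the learner. -/
def overhead (M : ℕ) : ℕ :=
  100 + 40 * M + prepare.timeBound M + 2 * sample.timeBound M + M * sample.timeBound M +
    trial.timeBound M

theorem polyBounded_overhead : PolyBounded overhead :=
  (((((PolyBounded.const 100).add ((PolyBounded.const 40).mul .id)).add
    prepare.polyBounded_timeBound).add
    ((PolyBounded.const 2).mul sample.polyBounded_timeBound)).add
    (PolyBounded.id.mul sample.polyBounded_timeBound)).add trial.polyBounded_timeBound

/-- What the learner does on a given sequence of examples and coins. -/
theorem exec_learner {n k t L E Ck Ct : ℕ} {pk pt : Cmd} (f : Fin n → ZMod 2) (w : Randomness n)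
    (hpk : ∃ (s : State) (τ : ℕ), Exec f w pk (init [n]) s τ ∧ s.reg 0 = k ∧
      s.drawn = 0 ∧ s.flipped = 0 ∧ τ ≤ Ck * (n + 1) ^ 2)
    (hpt : ∃ (s : State) (τ : ℕ), Exec f w pt (init [n]) s τ ∧ s.reg 0 = t ∧
      s.drawn = 0 ∧ s.flipped = 0 ∧ τ ≤ Ct * (n + 1) ^ 2)
    (hk : 1 ≤ k) (hkt : 2 * k ≤ t) (htn : t ≤ n) (hE : 1 ≤ E) :
    ∃ j, 2 ^ j * (2 * k) ≤ t ∧ t < 2 ^ j * (4 * k) ∧ ∃ (s : State) (τ : ℕ),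
      Exec f w (learner pk pt) (init [n, L, E]) s τ ∧
      s.drawn = E * ((L + 1) * 2 + (j * k + n / 2 ^ j + 1)) ∧
      τ ≤ E * (L + 1) * 2 ^ (j * k) * ((Ck + Ct) * (n + 1) ^ 2 + overhead ((n + 2) * (n + 2))) ∧
      ((∃ i < (L + 1) * 2 ^ (j * k), SupportedIn w.2 (i * (n * j)) j f) →
        ∃ i < (L + 1) * 2 ^ (j * k), SupportedIn w.2 (i * (n * j)) j (output n s) ∧
          ∀ l < E * ((L + 1) * 2 + (j * k + n / 2 ^ j + 1)),
            output n s ⬝ᵥ w.1 l = f ⬝ᵥ w.1 l) := by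
  obtain ⟨s₁, hr, τ₁, hτ₁, hE₁⟩ := exec_setup (L := L) (E := E) f w hpk hpt
  obtain ⟨j, hle, hlt, hrM, hP, h5, hC, hd, hf, τ₂, hτ₂, hE₂⟩ := prepare_spec f w hr hk hkt htn
  have hn : n ≤ (n + 2) * (n + 2) := by nlinarith
  obtain ⟨τ₃, hτ₃, hE₃⟩ := exec_powerTwo f w hP.coins h5
  have hS : SamplingInv f w j (j * k + n / 2 ^ j + 1) L E ((n + 2) * (n + 2)) (2 ^ (j * k)) 0
      ((run f w prepare s₁).setReg 52 (2 ^ (j * k))) := by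
    refine ⟨⟨⟨hP.small.two_le, ?_, fun x hx => ?_, hP.small.arr_le⟩, hP.env.setReg (by decide),
      ?_, ?_, ?_, ?_⟩, ⟨hC.mem_iff⟩, by simp, hd, hf⟩
    · simpa [modReg] using hP.small.mod_eq
    · rw [State.setReg_reg, if_neg (by omega)]; exact hP.small.reg_le x hx
    · simp [hP.coins]
    · simp [hP.samples]
    · simp [hP.confidence]
    · simp [hP.accuracy]
  obtain ⟨hS', τ₄, hτ₄, hE₄⟩ := exec_sampling f w hn hS
  obtain ⟨hT', τ₅, hτ₅, hE₅⟩ := exec_trials f w hn (d := E * ((L + 1) * 2 + (j * k + n / 2 ^ j + 1)))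
    ⟨hS'.params, hS'.consistent, hS'.power, hS'.drawn, by rw [hS'.flipped, zero_mul],
      Or.inl (by simp)⟩
  refine ⟨j, hle, hlt, _, _, Exec.seq hE₁ (Exec.seq hE₂ (Exec.seq hE₃ (Exec.seq hE₄ hE₅))),
    hT'.drawn, ?_, fun ⟨i, hi, hsupp⟩ => hT'.output.resolve_left fun h => h i hi hsupp⟩
  have hjkr : j * k ≤ j * k + n / 2 ^ j + 1 := by
    rw [add_assoc]; exact Nat.le_add_right _ _
  generalize hrdef : j * k + n / 2 ^ j + 1 = r at *
  generalize hMdef : (n + 2) * (n + 2) = M at *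
  generalize hPdef : 2 ^ (j * k) = P at *
  have hP1 : 1 ≤ P := by rw [← hPdef]; exact Nat.one_le_two_pow
  have hjn : j ≤ n := by
    have : j < 2 ^ j := Nat.lt_two_pow_self
    nlinarith
  have hjkM : j * k ≤ M := hjkr.trans hrM.le
  -- Each phase costs at most `U` times a polynomial in `n`; the numbers in `overhead` leave room
  -- for the sum of these.
  set U := E * (L + 1) * P with hU
  have u1 : E * (L + 1) ≤ U := Nat.le_mul_of_pos_right _ hP1
  have u2 : L + 1 ≤ U := (Nat.le_mul_of_pos_left _ hE).trans u1
  have u3 : E ≤ U := (Nat.le_mul_of_pos_right _ (by omega)).trans u1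
  have u4 : (L + 1) * P ≤ U := by
    rw [hU, mul_assoc]; exact Nat.le_mul_of_pos_left _ hE
  have u5 : P ≤ U := (Nat.le_mul_of_pos_left _ (by omega)).trans u4
  have u6 : 1 ≤ U := hP1.trans u5
  generalize hA : prepare.timeBound M = A at *
  generalize hB : sample.timeBound M = B at *
  generalize hT : trial.timeBound M = T at *
  have b1 : τ₁ ≤ U * ((Ck + Ct) * (n + 1) ^ 2) + U * (53 + 14 * M) := by
    have v1 : (Ck + Ct) * (n + 1) ^ 2 ≤ U * ((Ck + Ct) * (n + 1) ^ 2) :=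
      Nat.le_mul_of_pos_left _ u6
    have v2 : 50 + 14 * M ≤ U * (50 + 14 * M) := Nat.le_mul_of_pos_left _ u6
    have v3 : U * (53 + 14 * M) = U * (50 + 14 * M) + 3 * U := by ring
    omega
  have b2 : τ₂ ≤ U * A := hτ₂.trans (Nat.le_mul_of_pos_left _ u6)
  have b3 : τ₃ ≤ U * (7 + 13 * M) := by
    have v1 : j * k * (5 + 4 * P) ≤ M * (9 * U) := Nat.mul_le_mul hjkM (by omega)
    have v2 : 7 + 4 * M ≤ U * (7 + 4 * M) := Nat.le_mul_of_pos_left _ u6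
    have v3 : U * (7 + 13 * M) = U * (7 + 4 * M) + M * (9 * U) := by ring
    omega
  have b4 : τ₄ ≤ U * (10 + 2 * B + 2 * M + M * B) := by
    have v1 : E * ((2 + (L + 1) + (L + 1) * (2 * B + 1)) + (2 + r + r * (B + 1)) + 1) ≤
        U * (7 + 2 * B + 2 * M + M * B) := by
      calc _ = E * 5 + E * (L + 1) * (2 + 2 * B) + E * (r * (2 + B)) := by ring
        _ ≤ U * 5 + U * (2 + 2 * B) + U * (M * (2 + B)) := by gcongr
        _ = _ := by ring
    have v2 : U * (10 + 2 * B + 2 * M + M * B) = U * (7 + 2 * B + 2 * M + M * B) + 3 * U := by ring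
    omega
  have b5 : τ₅ ≤ U * (8 + T) := by
    have v1 : (L + 1) * (2 + P + P * (T + 1) + 1) ≤ U * (5 + T) := by
      calc _ = (L + 1) * 3 + (L + 1) * P * (T + 2) := by ring
        _ ≤ U * 3 + U * (T + 2) := by gcongr
        _ = _ := by ring
    have v2 : U * (8 + T) = U * (5 + T) + 3 * U := by ring
    omega
  calc τ₁ + (τ₂ + (τ₃ + (τ₄ + τ₅)))
      ≤ U * ((Ck + Ct) * (n + 1) ^ 2) + U * (53 + 14 * M) + U * A + U * (7 + 13 * M) +
        U * (10 + 2 * B + 2 * M + M * B) + U * (8 + T) := by omega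
    _ = U * ((Ck + Ct) * (n + 1) ^ 2 + (78 + 29 * M + A + 2 * B + M * B + T)) := by ring
    _ ≤ U * ((Ck + Ct) * (n + 1) ^ 2 + overhead M) := by
      simp only [overhead, hA, hB, hT]
      gcongr <;> omega

/-! ## Probabilities -/

/-- The coins which decide whether the support of `g` is chosen by the block of coins starting
at `b`. -/
def coinSet {n : ℕ} (b j : ℕ) (g : Fin n → ZMod 2) : Finset ℕ :=
  (Finset.univ.filter (fun i => g i ≠ 0) ×ˢ Finset.range j).image
    fun x : Fin n × ℕ => b + x.1 * j + x.2

/-- Only coordinates with `g i ≠ 0` impose a condition, namely heads on all their coins. Written as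
a cylinder, the event can be evaluated by the product measure. -/
theorem supportedIn_iff {n b j : ℕ} {g : Fin n → ZMod 2} {c : ℕ → Bool} :
    SupportedIn c b j g ↔ c ∈ Set.pi (coinSet b j g : Set ℕ) fun _ => {true} := by
  simp only [SupportedIn, chosen, coinSet, Set.mem_pi, Finset.coe_image, Set.mem_image,
    Finset.mem_coe, Finset.mem_product, Finset.mem_filter, Finset.mem_univ, true_and,
    Finset.mem_range, Set.mem_singleton_iff]
  constructor
  · rintro h _ ⟨⟨i, l⟩, ⟨hi, hl⟩, rfl⟩
    by_contra hc
    exact hi (h i fun h' => hc (h' l hl))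
  · intro h i hi
    by_contra hg
    exact hi fun l hl => h _ ⟨(i, l), ⟨hg, hl⟩, rfl⟩

/-- Different pairs `(i, l)` use different coins, since `l < j` makes them quotient and remainder of
`i * j + l` by `j`. -/
theorem card_coinSet {n : ℕ} (b j : ℕ) (g : Fin n → ZMod 2) :
    (coinSet b j g).card = hammingNorm g * j := by
  rw [coinSet, Finset.card_image_of_injOn, Finset.card_product, Finset.card_range, hammingNorm]
  rintro ⟨i, l⟩ hil ⟨i', l'⟩ hil' h
  simp only [Finset.coe_product, Set.mem_prod, Finset.mem_coe, Finset.mem_range] at hil hil'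
  have h0 : j * i + l = j * i' + l' := by
    simp only at h
    rw [mul_comm j, mul_comm j]; omega
  have h1 := congrArg (· / j) h0
  have h2 := congrArg (· % j) h0
  have hj : 0 < j := by omega
  simp only [Nat.mul_add_div hj, Nat.mul_add_mod, Nat.mod_eq_of_lt hil.2, Nat.mod_eq_of_lt hil'.2,
    Nat.div_eq_of_lt hil.2, Nat.div_eq_of_lt hil'.2, add_zero] at h1 h2
  exact Prod.ext (Fin.ext h1) h2

theorem mem_coinSet_bounds {n b j : ℕ} {g : Fin n → ZMod 2} {x : ℕ} (hx : x ∈ coinSet b j g) :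
    b ≤ x ∧ x < b + n * j := by
  simp only [coinSet, Finset.mem_image, Finset.mem_product, Finset.mem_range] at hx
  obtain ⟨⟨i, l⟩, ⟨-, hl⟩, rfl⟩ := hx
  have hl' : l < j := hl
  have : (i : ℕ) * j + j ≤ n * j := by
    rw [← Nat.succ_mul]; exact Nat.mul_le_mul_right j i.2
  exact ⟨by simp only; omega, by simp only; omega⟩

/-- Trial `i` reads only coins from `i * (n * j)` up to, but excluding, `(i + 1) * (n * j)`. -/
theorem disjoint_coinSet {n j : ℕ} (g : Fin n → ZMod 2) {i i' : ℕ} (h : i ≠ i') :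
    Disjoint (coinSet (i * (n * j)) j g) (coinSet (i' * (n * j)) j g) := by
  rw [Finset.disjoint_left]
  intro x hx hx'
  have h1 := mem_coinSet_bounds hx
  have h2 := mem_coinSet_bounds hx'
  rw [← Nat.succ_mul] at h1 h2
  rcases lt_or_gt_of_ne h with h | h
  · have := Nat.mul_le_mul_right (n * j) (show i.succ ≤ i' from h)
    omega
  · have := Nat.mul_le_mul_right (n * j) (show i'.succ ≤ i from h)
    omega

/-- The law of a sequence of independent fair coins. -/
noncomputable abbrev coinLaw : Measure (ℕ → Bool) :=
  Measure.infinitePi fun _ : ℕ => (PMF.uniformOfFintype Bool).toMeasure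

theorem coinLaw_pi (S : Finset ℕ) :
    coinLaw (Set.pi (S : Set ℕ) fun _ => {true}) = (1 / 2) ^ S.card := by
  rw [coinLaw, Measure.infinitePi_pi _ (fun _ _ => MeasurableSet.singleton _)]
  have : (PMF.uniformOfFintype Bool).toMeasure {true} = 1 / 2 := by
    rw [PMF.toMeasure_apply_singleton _ _ (MeasurableSet.singleton _)]
    simp
  simp [this]

theorem coinLaw_supportedIn {n : ℕ} (b j : ℕ) (g : Fin n → ZMod 2) :
    coinLaw {c | SupportedIn c b j g} = (1 / 2) ^ (hammingNorm g * j) := by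
  rw [← card_coinSet b, ← coinLaw_pi]
  congr 1
  ext c
  exact supportedIn_iff

theorem measurableSet_supportedIn {n : ℕ} (b j : ℕ) (g : Fin n → ZMod 2) :
    MeasurableSet {c | SupportedIn c b j g} := by
  have : {c | SupportedIn c b j g} = Set.pi (coinSet b j g : Set ℕ) fun _ => {true} := by
    ext c
    exact supportedIn_iff
  rw [this]
  exact MeasurableSet.pi (Finset.countable_toSet _) fun _ _ => MeasurableSet.singleton _

/-- An intersection of these cylinders is the cylinder over the union of their coin sets; the union
is disjoint, so the exponents add. -/
theorem iIndepSet_supportedIn {n : ℕ} (j : ℕ) (g : Fin n → ZMod 2) :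
    ProbabilityTheory.iIndepSet (fun i : ℕ => {c | SupportedIn c (i * (n * j)) j g}) coinLaw := by
  rw [ProbabilityTheory.iIndepSet_iff_meas_biInter fun i => measurableSet_supportedIn _ _ _]
  intro s
  simp only [coinLaw_supportedIn]
  have : (⋂ i ∈ s, {c | SupportedIn c (i * (n * j)) j g}) =
      Set.pi ((s.biUnion fun i => coinSet (i * (n * j)) j g : Finset ℕ) : Set ℕ)
        fun _ => {true} := by
    ext c
    simp only [Set.mem_iInter, Set.mem_ofPred_eq, supportedIn_iff, Set.mem_pi, Finset.mem_coe,
      Finset.mem_biUnion]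
    exact ⟨fun h x ⟨i, hi, hx⟩ => h i hi x hx, fun h i hi x hx => h x ⟨i, hi, hx⟩⟩
  rw [this, coinLaw_pi, Finset.card_biUnion fun i _ i' _ h => disjoint_coinSet g h]
  simp only [card_coinSet, Finset.prod_pow_eq_pow_sum]

/-- The probability that no trial chooses the support of `g`. -/
theorem coinLaw_real_none {n : ℕ} (j N : ℕ) (g : Fin n → ZMod 2) :
    coinLaw.real {c | ∀ i < N, ¬ SupportedIn c (i * (n * j)) j g} =
      (1 - (1 / 2) ^ (hammingNorm g * j)) ^ N := by
  -- Independence passes to the generated σ-algebras, which also contain the complements.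
  have h := (ProbabilityTheory.iIndepSet_iff_iIndep _ _).1 (iIndepSet_supportedIn j g)
  have h' := h.meas_biInter (S := Finset.range N)
    (s := fun i => {c | SupportedIn c (i * (n * j)) j g}ᶜ)
    fun i _ => (MeasurableSpace.measurableSet_generateFrom (Set.mem_singleton _)).compl
  have hset : {c : ℕ → Bool | ∀ i < N, ¬ SupportedIn c (i * (n * j)) j g} =
      ⋂ i ∈ Finset.range N, {c | SupportedIn c (i * (n * j)) j g}ᶜ := by
    ext c; simp
  rw [hset, Measure.real, h', ENNReal.toReal_prod]
  have : ∀ i, (coinLaw {c | SupportedIn c (i * (n * j)) j g}ᶜ).toReal =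
      1 - (1 / 2) ^ (hammingNorm g * j) := by
    intro i
    have := probReal_compl_eq_one_sub (μ := coinLaw)
      (measurableSet_supportedIn (i * (n * j)) j g)
    rw [Measure.real] at this
    rw [this, Measure.real, coinLaw_supportedIn]
    simp
  simp [this]

/-- The expected number of vectors supported in the chosen coordinates. -/
theorem sum_coinLaw_real_supportedIn (n b j : ℕ) :
    ∑ g : Fin n → ZMod 2, coinLaw.real {c | SupportedIn c b j g} = (1 + (1 / 2) ^ j) ^ n := by
  -- The probability is a product over coordinates, with factor `1` where `g` vanishes and `2 ^
  -- (-j)` elsewhere, so the sum over all `g` is a power of the one-coordinate sum.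
  have h : ∀ g : Fin n → ZMod 2, coinLaw.real {c | SupportedIn c b j g} =
      ∏ i, if g i = 0 then (1 : ℝ) else (1 / 2) ^ j := by
    intro g
    rw [Measure.real, coinLaw_supportedIn, Finset.prod_ite]
    simp [hammingNorm, pow_mul']
  have h2 : ∑ b : ZMod 2, (if b = 0 then (1 : ℝ) else (1 / 2) ^ j) = 1 + (1 / 2) ^ j := by
    have hu : (Finset.univ : Finset (ZMod 2)) = {0, 1} := by decide
    rw [hu]
    simp
  simp only [h]
  have h3 := Finset.prod_univ_sum (fun _ : Fin n => (Finset.univ : Finset (ZMod 2)))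
    (fun _ b => if b = 0 then (1 : ℝ) else (1 / 2) ^ j)
  rw [h2, Finset.prod_const, Finset.card_univ, Fintype.card_fin, Fintype.piFinset_univ] at h3
  exact h3.symm

/-- The probability that a vector agrees with the target on `m` examples. -/
theorem infinitePi_real_agree {n : ℕ} (D : PMF (Fin n → ZMod 2)) (f g : Fin n → ZMod 2) (m : ℕ) :
    (Measure.infinitePi fun _ : ℕ => D.toMeasure).real {x | ∀ l < m, g ⬝ᵥ x l = f ⬝ᵥ x l} =
      (1 - disagreement D f g) ^ m := by
  have hset : {x : ℕ → Fin n → ZMod 2 | ∀ l < m, g ⬝ᵥ x l = f ⬝ᵥ x l} =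
      Set.pi (Finset.range m : Set ℕ) fun _ => {a | f ⬝ᵥ a ≠ g ⬝ᵥ a}ᶜ := by
    ext x
    simp [Set.mem_pi, eq_comm]
  have hmeas : MeasurableSet {a : Fin n → ZMod 2 | f ⬝ᵥ a ≠ g ⬝ᵥ a} :=
    (Set.toFinite _).measurableSet
  rw [hset, Measure.real, Measure.infinitePi_pi _ (fun _ _ => hmeas.compl), ENNReal.toReal_prod]
  have := probReal_compl_eq_one_sub (μ := D.toMeasure) hmeas
  rw [Measure.real] at this
  simp only [this, Finset.prod_const, Finset.card_range, disagreement]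

/-- A bound for the failure probability of the learner. -/
theorem randomnessLaw_real_failure_le {n : ℕ} (D : PMF (Fin n → ZMod 2)) (f : Fin n → ZMod 2)
    {ε : ℝ} (hε : ε ≤ 1) (j N m : ℕ) :
    (randomnessLaw D).real {w | ¬ ((∃ i < N, SupportedIn w.2 (i * (n * j)) j f) ∧
      ∀ g, (∃ i < N, SupportedIn w.2 (i * (n * j)) j g) →
        (∀ l < m, g ⬝ᵥ w.1 l = f ⬝ᵥ w.1 l) → disagreement D f g < ε)} ≤
      (1 - (1 / 2) ^ (hammingNorm f * j)) ^ N + N * (1 + (1 / 2) ^ j) ^ n * (1 - ε) ^ m := by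
  classical
  set μ := Measure.infinitePi fun _ : ℕ => D.toMeasure with hμ
  have hlaw : randomnessLaw D = μ.prod coinLaw := rfl
  let bad : Finset (Fin n → ZMod 2) := Finset.univ.filter fun g => ε ≤ disagreement D f g
  -- Failure means that all trials miss the support of `f`, or that some trial admits a bad `g`
  -- agreeing with the sample. Agreement involves the examples only and support the coins only, so
  -- each piece is a rectangle with product probability.
  have hsub : {w : Randomness n | ¬ ((∃ i < N, SupportedIn w.2 (i * (n * j)) j f) ∧
      ∀ g, (∃ i < N, SupportedIn w.2 (i * (n * j)) j g) →
        (∀ l < m, g ⬝ᵥ w.1 l = f ⬝ᵥ w.1 l) → disagreement D f g < ε)} ⊆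
      (Set.univ ×ˢ {c | ∀ i < N, ¬ SupportedIn c (i * (n * j)) j f}) ∪
      ⋃ i ∈ Finset.range N, ⋃ g ∈ bad, {x | ∀ l < m, g ⬝ᵥ x l = f ⬝ᵥ x l} ×ˢ
        {c | SupportedIn c (i * (n * j)) j g} := by
    intro w hw
    simp only [Set.mem_ofPred_eq, not_and_or, not_exists, not_forall, not_lt] at hw
    rcases hw with hw | ⟨g, ⟨i, hi, hg⟩, hc, hd⟩
    · exact Or.inl ⟨trivial, fun i hi => (hw i).resolve_left (not_le.2 hi)⟩
    · refine Or.inr ?_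
      simp only [Set.mem_iUnion]
      exact ⟨i, Finset.mem_range.2 hi, g, Finset.mem_filter.2 ⟨Finset.mem_univ _, hd⟩, hc, hg⟩
  rw [hlaw]
  refine (measureReal_mono hsub).trans ((measureReal_union_le _ _).trans (add_le_add ?_ ?_))
  · rw [measureReal_prod_prod, coinLaw_real_none]
    simp
  · refine (measureReal_biUnion_finset_le _ _).trans ?_
    have hi : ∀ i ∈ Finset.range N, (μ.prod coinLaw).real (⋃ g ∈ bad,
        {x | ∀ l < m, g ⬝ᵥ x l = f ⬝ᵥ x l} ×ˢ {c | SupportedIn c (i * (n * j)) j g}) ≤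
        (1 + (1 / 2) ^ j) ^ n * (1 - ε) ^ m := by
      intro i _
      refine (measureReal_biUnion_finset_le _ _).trans ?_
      calc _ ≤ ∑ g ∈ bad, (1 - ε) ^ m * coinLaw.real {c | SupportedIn c (i * (n * j)) j g} := by
            refine Finset.sum_le_sum fun g hg => ?_
            rw [measureReal_prod_prod, hμ, infinitePi_real_agree]
            refine mul_le_mul_of_nonneg_right ?_ measureReal_nonneg
            have h1 : ε ≤ disagreement D f g := (Finset.mem_filter.1 hg).2
            have h2 : disagreement D f g ≤ 1 := measureReal_le_one
            exact pow_le_pow_left₀ (by linarith) (by linarith) m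
        -- The sum is enlarged to all vectors because the full sum has a closed form.
        _ ≤ ∑ g : Fin n → ZMod 2,
            (1 - ε) ^ m * coinLaw.real {c | SupportedIn c (i * (n * j)) j g} := by
            refine Finset.sum_le_sum_of_subset_of_nonneg (Finset.subset_univ _) fun g _ _ => ?_
            exact mul_nonneg (pow_nonneg (by linarith) _) measureReal_nonneg
        _ = _ := by
            rw [← Finset.mul_sum, sum_coinLaw_real_supportedIn, mul_comm]
    refine (Finset.sum_le_sum hi).trans (le_of_eq ?_)
    simp [mul_assoc]

end RAM

/-! ### Estimates for the binomial coefficient, the sample size and the failure probability. -/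

/-- Induction through `(k + 1) * C(t + 1, k + 1) = (t + 1) * C(t, k)`, where `t + 1 ≥ q * (k + 1)`
contributes one more factor `q`. -/
theorem pow_le_choose_of_mul_le {q : ℕ} (k : ℕ) {t : ℕ} (hq : 1 ≤ q) (h : q * k ≤ t) :
    q ^ k ≤ t.choose k := by
  induction k generalizing t with
  | zero => simp
  | succ k ih =>
    obtain ⟨t, rfl⟩ : ∃ t', t = t' + 1 := ⟨t - 1, by
      have : 1 * 1 ≤ q * (k + 1) := Nat.mul_le_mul hq (by omega)
      omega⟩
    have h1 := ih (t := t) (by rw [mul_add] at h; omega)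
    have h2 := Nat.add_one_mul_choose_eq t k
    refine Nat.le_of_mul_le_mul_right (c := k + 1) ?_ (by omega)
    rw [← h2, pow_succ]
    calc q ^ k * q * (k + 1) = (q * (k + 1)) * q ^ k := by ring
      _ ≤ (t + 1) * t.choose k := Nat.mul_le_mul h h1

section bounds

variable {n k t j : ℕ}

/-- The preceding bound with `q = 2 ^ (j + 1)`. Choosing `2 ^ j` at most `t / (2 * k)` instead of `t
/ k` is what gains the factor `2 ^ k`. -/
theorem two_pow_mul_two_pow_le_choose (hle : 2 ^ j * (2 * k) ≤ t) :
    2 ^ (j * k) * 2 ^ k ≤ t.choose k := by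
  have := pow_le_choose_of_mul_le k (q := 2 ^ j * 2) (t := t)
    (by have : 1 ≤ 2 ^ j := Nat.one_le_two_pow
        omega) (by rwa [mul_assoc])
  rwa [mul_pow, ← pow_mul] at this

/-- The gained `2 ^ k` pays for `exp (k / γ)`, because `1 / γ ≤ 1 / 4 < log 2`. -/
theorem two_pow_le_exp_mul_choose {γ : ℝ} (hγ : 4 < γ) (hle : 2 ^ j * (2 * k) ≤ t) :
    (2 : ℝ) ^ (j * k) ≤ Real.exp (-(k : ℝ) / γ) * t.choose k := by
  have h1 : (2 : ℝ) ^ (j * k) * 2 ^ k ≤ t.choose k := by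
    exact_mod_cast two_pow_mul_two_pow_le_choose hle
  have h2 : Real.exp ((k : ℝ) / γ) ≤ 2 ^ k := by
    rw [← Real.exp_log (show (0 : ℝ) < 2 by norm_num), ← Real.exp_nat_mul, Real.exp_le_exp,
      div_eq_mul_inv]
    have h3 := Real.log_two_gt_d9
    have h4 : γ⁻¹ ≤ 1 / 4 := by
      rw [inv_le_comm₀ (by linarith) (by norm_num)]; norm_num; linarith
    exact mul_le_mul_of_nonneg_left (by linarith) (Nat.cast_nonneg k)
  calc (2 : ℝ) ^ (j * k) = Real.exp (-(k : ℝ) / γ) * (2 ^ (j * k) * Real.exp ((k : ℝ) / γ)) := by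
        rw [mul_left_comm, ← Real.exp_add, neg_div, neg_add_cancel, Real.exp_zero, mul_one]
    _ ≤ Real.exp (-(k : ℝ) / γ) * (2 ^ (j * k) * 2 ^ k) := by gcongr
    _ ≤ _ := by gcongr

theorem exists_two_pow_bracket (hk : 1 ≤ k) (hkt : 2 * k ≤ t) :
    ∃ j, 2 ^ j * (2 * k) ≤ t ∧ t < 2 ^ j * (4 * k) := by
  refine ⟨Nat.log 2 (t / (2 * k)), ?_, ?_⟩
  · have : 2 ^ Nat.log 2 (t / (2 * k)) ≤ t / (2 * k) :=
      Nat.pow_log_le_self 2 (Nat.div_pos hkt (by omega)).ne'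
    exact (Nat.le_div_iff_mul_le (by omega)).1 this
  · have : t / (2 * k) < 2 ^ (Nat.log 2 (t / (2 * k)) + 1) := Nat.lt_pow_succ_log_self (by decide) _
    rw [Nat.div_lt_iff_lt_mul (by omega), pow_succ] at this
    linarith

/-- `exec_learner` provides a `j` for each run; uniqueness makes it the same for all runs, as the
probability estimates require. -/
theorem two_pow_bracket_unique {j' : ℕ} (hle : 2 ^ j * (2 * k) ≤ t) (hlt : t < 2 ^ j * (4 * k))
    (hle' : 2 ^ j' * (2 * k) ≤ t) (hlt' : t < 2 ^ j' * (4 * k)) : j = j' := by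
  have key : ∀ a b : ℕ, 2 ^ a * (2 * k) ≤ t → t < 2 ^ b * (4 * k) → a ≤ b := by
    intro a b h1 h2
    have h3 : 2 ^ a * (2 * k) < 2 ^ (b + 1) * (2 * k) := by
      rw [pow_succ]; linarith
    have := (Nat.pow_lt_pow_iff_right (by decide)).1 (Nat.lt_of_mul_lt_mul_right h3)
    omega
  exact le_antisymm (key _ _ hle hlt') (key _ _ hle' hlt)

/-- The number of examples which the learner draws. -/
theorem samples_le (hk : 1 ≤ k) (htn : t ≤ n) (hle : 2 ^ j * (2 * k) ≤ t)
    (hlt : t < 2 ^ j * (4 * k)) {δ ε : ℝ} (hδ : 0 < δ) (hδ1 : δ < 1) (hε : 0 < ε) (hε1 : ε < 1) :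
    ((⌈1 / ε⌉₊ * ((⌈Real.logb 2 (1 / δ)⌉₊ + 1) * 2 + (j * k + n / 2 ^ j + 1)) : ℕ) : ℝ) ≤
      18 * sampleSize n k t δ / ε := by
  have hE : (⌈1 / ε⌉₊ : ℝ) ≤ 2 / ε := by
    have h1 := (Nat.ceil_lt_add_one (show 0 ≤ 1 / ε by positivity)).le
    have h2 : 1 ≤ 1 / ε := by rw [le_div_iff₀ hε]; linarith
    calc _ ≤ 1 / ε + 1 := h1
      _ ≤ 1 / ε + 1 / ε := by linarith
      _ = 2 / ε := by ring
  have hl : 0 ≤ Real.logb 2 (1 / δ) :=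
    Real.logb_nonneg (by norm_num) (by rw [le_div_iff₀ hδ]; linarith)
  have hL := (Nat.ceil_lt_add_one hl).le
  have htpos : (0 : ℝ) < t := by
    have : 1 ≤ 2 ^ j := Nat.one_le_two_pow
    have : 0 < t := by nlinarith
    exact_mod_cast this
  have hjk : (j * k : ℝ) ≤ Real.logb 2 (t.choose k) := by
    have h1 : (2 : ℝ) ^ (j * k) * 2 ^ k ≤ t.choose k := by
      exact_mod_cast two_pow_mul_two_pow_le_choose hle
    have h2 : (2 : ℝ) ^ (j * k) ≤ t.choose k :=
      (le_mul_of_one_le_right (by positivity) (one_le_pow₀ (by norm_num))).trans h1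
    rw [Real.le_logb_iff_rpow_le (by norm_num) (lt_of_lt_of_le (by positivity) h2)]
    exact_mod_cast h2
  have hq : ((n / 2 ^ j : ℕ) : ℝ) ≤ 4 * ((k : ℝ) * n / t) := by
    refine Nat.cast_div_le.trans ?_
    push_cast
    have h1 : (t : ℝ) ≤ 2 ^ j * (4 * k) := by exact_mod_cast hlt.le
    rw [← mul_div_assoc, div_le_div_iff₀ (by positivity) htpos]
    nlinarith [Nat.cast_nonneg (α := ℝ) n]
  -- This absorbs the additive constants: `4` from `(L + 1) * 2` and `1` from the last summand,
  -- which with the `4` of `hq` give the coefficient `9`. Rounding `1 / ε` up doubles it to `18`.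
  have h1 : 1 ≤ (k : ℝ) * n / t := by
    rw [le_div_iff₀ htpos, one_mul]
    have h2 : (t : ℝ) ≤ n := by exact_mod_cast htn
    have h3 : (1 : ℝ) ≤ k := by exact_mod_cast hk
    nlinarith
  have hjk0 : (0 : ℝ) ≤ j * k := by positivity
  push_cast
  calc (⌈1 / ε⌉₊ : ℝ) * ((⌈Real.logb 2 (1 / δ)⌉₊ + 1) * 2 + (j * k + ((n / 2 ^ j : ℕ) : ℝ) + 1))
      ≤ 2 / ε * (9 * sampleSize n k t δ) := by
        refine mul_le_mul hE ?_ (by positivity) (by positivity)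
        rw [sampleSize]
        linarith
    _ = 18 * sampleSize n k t δ / ε := by ring

/-- The failure probability of the learner. -/
theorem failure_le {δ ε : ℝ} (hδ : 0 < δ) (hε : 0 < ε) (hε1 : ε < 1) {L E : ℕ}
    (hL : Real.logb 2 (1 / δ) ≤ L) (hE : 1 / ε ≤ E) :
    (1 - (1 / 2 : ℝ) ^ (k * j)) ^ ((L + 1) * 2 ^ (j * k)) +
      ((L + 1) * 2 ^ (j * k) : ℕ) * (1 + (1 / 2) ^ j) ^ n *
        (1 - ε) ^ (E * ((L + 1) * 2 + (j * k + n / 2 ^ j + 1))) ≤ δ := by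
  have hexp : Real.exp (-((L : ℝ) + 1)) ≤ δ / 2 := by
    have h1 : 1 / δ ≤ 2 ^ (L : ℝ) :=
      (Real.logb_le_iff_le_rpow (by norm_num) (by positivity)).1 hL
    have h2 : (2 : ℝ) ^ (L + 1) ≤ Real.exp (L + 1) := by
      have : (2 : ℝ) ≤ Real.exp 1 := by have := Real.add_one_le_exp (1 : ℝ); linarith
      calc (2 : ℝ) ^ (L + 1) ≤ Real.exp 1 ^ (L + 1) := by gcongr
        _ = Real.exp (L + 1) := by rw [← Real.exp_nat_mul]; simp
    rw [Real.rpow_natCast] at h1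
    rw [Real.exp_neg, inv_le_comm₀ (Real.exp_pos _) (by positivity)]
    calc (δ / 2)⁻¹ = 1 / δ * 2 := by rw [inv_div]; ring
      _ ≤ 2 ^ L * 2 := by gcongr
      _ = 2 ^ (L + 1) := (pow_succ _ _).symm
      _ ≤ _ := h2
  have hpow : ∀ x : ℝ, ∀ m : ℕ, 0 ≤ 1 + x → (1 + x) ^ m ≤ Real.exp (m * x) := by
    intro x m hx
    rw [Real.exp_nat_mul]
    exact pow_le_pow_left₀ hx (by linarith [Real.add_one_le_exp x]) m
  have hhalf : ∀ m : ℕ, (1 / 2 : ℝ) ^ m ≤ 1 := fun m => pow_le_one₀ (by norm_num) (by norm_num)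
  have h1 : (1 - (1 / 2 : ℝ) ^ (k * j)) ^ ((L + 1) * 2 ^ (j * k)) ≤ δ / 2 := by
    refine le_trans ?_ hexp
    have := hpow (-(1 / 2 : ℝ) ^ (k * j)) ((L + 1) * 2 ^ (j * k)) (by linarith [hhalf (k * j)])
    rw [← sub_eq_add_neg] at this
    refine this.trans (le_of_eq ?_)
    congr 1
    push_cast
    rw [mul_comm k j, one_div, inv_pow]
    field_simp
  have h2 : (((L + 1) * 2 ^ (j * k) : ℕ) : ℝ) * (1 + (1 / 2) ^ j) ^ n *
        (1 - ε) ^ (E * ((L + 1) * 2 + (j * k + n / 2 ^ j + 1))) ≤ δ / 2 := by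
    refine le_trans ?_ hexp
    -- The exponent of `a3` is spent as follows: `j * k` and one `L + 1` on the number of trials, `n
    -- / 2 ^ j` on the number of vectors, and the second `L + 1` remains.
    have a1 : (((L + 1) * 2 ^ (j * k) : ℕ) : ℝ) ≤ Real.exp (L + 1) * Real.exp (j * k) := by
      push_cast
      refine mul_le_mul (by linarith [Real.add_one_le_exp ((L : ℝ) + 1)]) ?_ (by positivity)
        (Real.exp_pos _).le
      have : (2 : ℝ) ≤ Real.exp 1 := by have := Real.add_one_le_exp (1 : ℝ); linarith
      calc (2 : ℝ) ^ (j * k) ≤ Real.exp 1 ^ (j * k) := by gcongr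
        _ = Real.exp (j * k) := by rw [← Real.exp_nat_mul]; simp
    have a2 : (1 + (1 / 2 : ℝ) ^ j) ^ n ≤ Real.exp (n * (1 / 2) ^ j) := hpow _ _ (by positivity)
    have a3 : (1 - ε) ^ (E * ((L + 1) * 2 + (j * k + n / 2 ^ j + 1))) ≤
        Real.exp (-(((L : ℝ) + 1) * 2 + (j * k + n * (1 / 2) ^ j))) := by
      have := hpow (-ε) (E * ((L + 1) * 2 + (j * k + n / 2 ^ j + 1))) (by linarith)
      rw [← sub_eq_add_neg] at this
      refine this.trans (Real.exp_le_exp.2 ?_)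
      have hEε : 1 ≤ E * ε := by rwa [div_le_iff₀ hε] at hE
      -- The extra example in `j * k + n / 2 ^ j + 1` compensates the rounding of the quotient.
      have hq : (n : ℝ) * (1 / 2) ^ j ≤ ((n / 2 ^ j : ℕ) : ℝ) + 1 := by
        have h := Nat.lt_div_mul_add (a := n) (b := 2 ^ j) (by positivity)
        have h' : (n : ℝ) ≤ ((n / 2 ^ j : ℕ) : ℝ) * 2 ^ j + 2 ^ j := by exact_mod_cast h.le
        rw [one_div, inv_pow, ← div_eq_mul_inv, div_le_iff₀ (by positivity)]
        linarith
      rw [mul_neg, neg_le_neg_iff]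
      push_cast
      calc ((L : ℝ) + 1) * 2 + (j * k + n * (1 / 2) ^ j)
          ≤ ((L : ℝ) + 1) * 2 + (j * k + ((n / 2 ^ j : ℕ) : ℝ) + 1) := by linarith
        _ ≤ (E * ε) * (((L : ℝ) + 1) * 2 + (j * k + ((n / 2 ^ j : ℕ) : ℝ) + 1)) :=
            le_mul_of_one_le_left (by positivity) hEε
        _ = _ := by ring
    calc _ ≤ Real.exp (L + 1) * Real.exp (j * k) * Real.exp (n * (1 / 2) ^ j) *
          Real.exp (-(((L : ℝ) + 1) * 2 + (j * k + n * (1 / 2) ^ j))) := by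
          refine mul_le_mul (mul_le_mul a1 a2 (by positivity) (by positivity)) a3
            (pow_nonneg (by linarith) _) (by positivity)
      _ = Real.exp (-((L : ℝ) + 1)) := by
          rw [← Real.exp_add, ← Real.exp_add, ← Real.exp_add]
          congr 1; ring
  linarith

end bounds

/-! ### The learning guarantee and the passage to large `n`. -/

open RAM

/-- The learner learns `PAR(k)` over every distribution. -/
theorem pacLearns_learner {n k t Ck Ct c : ℕ} {pk pt : Cmd} {γ δ ε : ℝ}
    (hpk : ∀ (f : Fin n → ZMod 2) (w : Randomness n), ∃ (s : State) (τ : ℕ),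
      Exec f w pk (init [n]) s τ ∧ s.reg 0 = k ∧
      s.drawn = 0 ∧ s.flipped = 0 ∧ τ ≤ Ck * (n + 1) ^ 2)
    (hpt : ∀ (f : Fin n → ZMod 2) (w : Randomness n), ∃ (s : State) (τ : ℕ),
      Exec f w pt (init [n]) s τ ∧ s.reg 0 = t ∧
      s.drawn = 0 ∧ s.flipped = 0 ∧ τ ≤ Ct * (n + 1) ^ 2)
    (hk : 1 ≤ k) (hkt : 2 * k ≤ t) (htn : t ≤ n)
    (hc : 6 * ((Ck + Ct) * (n + 1) ^ 2 + overhead ((n + 2) * (n + 2))) ≤ n ^ c)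
    (hγ : 4 < γ) (hδ : 0 < δ) (hδ1 : δ < 1) (hε : 0 < ε) (hε1 : ε < 1)
    (D : PMF (Fin n → ZMod 2)) :
    PACLearns (learner pk pt) [n, ⌈Real.logb 2 (1 / δ)⌉₊, ⌈1 / ε⌉₊] (PAR n k) D ε δ
      (18 * sampleSize n k t δ / ε) (runningTime γ c n k t δ / ε) := by
  obtain ⟨j, hle, hlt⟩ := exists_two_pow_bracket hk hkt
  have hE1 : 1 ≤ ⌈1 / ε⌉₊ := Nat.one_le_ceil_iff.2 (by positivity)
  have hl : 0 ≤ Real.logb 2 (1 / δ) :=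
    Real.logb_nonneg (by norm_num) (by rw [le_div_iff₀ hδ]; linarith)
  have hE : (⌈1 / ε⌉₊ : ℝ) ≤ 2 / ε := by
    have h1 := (Nat.ceil_lt_add_one (show 0 ≤ 1 / ε by positivity)).le
    have h2 : 1 ≤ 1 / ε := by rw [le_div_iff₀ hε]; linarith
    calc _ ≤ 1 / ε + 1 := h1
      _ ≤ 1 / ε + 1 / ε := by linarith
      _ = 2 / ε := by ring
  have hL1 : ((⌈Real.logb 2 (1 / δ)⌉₊ + 1 : ℕ) : ℝ) ≤ 3 * max 1 (Real.logb 2 (1 / δ)) := by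
    push_cast
    have h1 := (Nat.ceil_lt_add_one hl).le
    have h2 := le_max_left 1 (Real.logb 2 (1 / δ))
    have h3 := le_max_right 1 (Real.logb 2 (1 / δ))
    linarith
  intro f hf
  have hf' : hammingNorm f = k := hf
  have hrun := fun w => exec_learner (L := ⌈Real.logb 2 (1 / δ)⌉₊) f w (hpk f w) (hpt f w) hk hkt
    htn hE1
  constructor
  · intro w
    obtain ⟨j', hle', hlt', s, τ, hex, hd, hτ, -⟩ := hrun w
    obtain rfl := two_pow_bracket_unique hle hlt hle' hlt'
    refine ⟨s, τ, hex, ?_, ?_⟩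
    · rw [hd]; exact samples_le hk htn hle hlt hδ hδ1 hε hε1
    -- The `6` is `2 * 3`, from `⌈1 / ε⌉ ≤ 2 / ε` and `L + 1 ≤ 3 * max 1 (log₂ (1 / δ))`.
    · have hc' : 6 * (((Ck + Ct) * (n + 1) ^ 2 + overhead ((n + 2) * (n + 2)) : ℕ) : ℝ) ≤
          (n : ℝ) ^ c := by exact_mod_cast hc
      generalize (Ck + Ct) * (n + 1) ^ 2 + overhead ((n + 2) * (n + 2)) = W at hτ hc'
      have h2 := two_pow_le_exp_mul_choose hγ hle
      calc (τ : ℝ) ≤ (⌈1 / ε⌉₊ : ℝ) * ((⌈Real.logb 2 (1 / δ)⌉₊ + 1 : ℕ) : ℝ) * 2 ^ (j * k) * W := by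
            exact_mod_cast hτ
        _ ≤ 2 / ε * (3 * max 1 (Real.logb 2 (1 / δ))) *
            (Real.exp (-(k : ℝ) / γ) * t.choose k) * W := by gcongr
        _ = Real.exp (-(k : ℝ) / γ) * t.choose k * (6 * W) * max 1 (Real.logb 2 (1 / δ)) / ε := by
            ring
        _ ≤ Real.exp (-(k : ℝ) / γ) * t.choose k * (n : ℝ) ^ c *
            max 1 (Real.logb 2 (1 / δ)) / ε := by gcongr
        _ = _ := rfl
  · have hfail := randomnessLaw_real_failure_le D f hε1.le j
      ((⌈Real.logb 2 (1 / δ)⌉₊ + 1) * 2 ^ (j * k))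
      (⌈1 / ε⌉₊ * ((⌈Real.logb 2 (1 / δ)⌉₊ + 1) * 2 + (j * k + n / 2 ^ j + 1)))
    rw [hf'] at hfail
    replace hfail := hfail.trans
      (failure_le hδ hε hε1 (Nat.le_ceil (Real.logb 2 (1 / δ))) (Nat.le_ceil (1 / ε)))
    set G : Set (Randomness n) := {w | (∃ i < (⌈Real.logb 2 (1 / δ)⌉₊ + 1) * 2 ^ (j * k),
        SupportedIn w.2 (i * (n * j)) j f) ∧
      ∀ g, (∃ i < (⌈Real.logb 2 (1 / δ)⌉₊ + 1) * 2 ^ (j * k), SupportedIn w.2 (i * (n * j)) j g) →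
        (∀ l < ⌈1 / ε⌉₊ * ((⌈Real.logb 2 (1 / δ)⌉₊ + 1) * 2 + (j * k + n / 2 ^ j + 1)),
          g ⬝ᵥ w.1 l = f ⬝ᵥ w.1 l) → disagreement D f g < ε} with hG
    have hGc : (randomnessLaw D).real Gᶜ ≤ δ := hfail
    have hprob : IsProbabilityMeasure (randomnessLaw D) := by
      unfold randomnessLaw; infer_instance
    -- Subadditivity bounds the measure of `G` from below without a proof that `G` is measurable.
    have huniv := measureReal_union_le (μ := randomnessLaw D) G Gᶜ
    rw [Set.union_compl_self, probReal_univ] at huniv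
    refine (show 1 - δ ≤ (randomnessLaw D).real G by linarith).trans (measureReal_mono ?_)
    rintro w ⟨hw1, hw2⟩
    obtain ⟨j', hle', hlt', s, τ, hex, -, -, hs⟩ := hrun w
    obtain rfl := two_pow_bracket_unique hle hlt hle' hlt'
    obtain ⟨i, hi, hsupp, hcons⟩ := hs hw1
    exact ⟨s, τ, hex, hw2 _ ⟨i, hi, hsupp⟩ hcons⟩

/-- Setting the accuracy to `1 / 2` at the beginning of a program. -/
theorem PACLearns.set_accuracy {n L : ℕ} {p : Cmd} {𝒞 : Set (Fin n → ZMod 2)}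
    {D : PMF (Fin n → ZMod 2)} {ε δ S T : ℝ} (h : PACLearns p [n, L, 2] 𝒞 D ε δ S T) :
    PACLearns (.seq (.set 2 (.const 2)) p) [n, L] 𝒞 D ε δ S (T + 4) := by
  have hinit : (init [n, L]).setReg 2 2 = init [n, L, 2] := by
    refine State.ext_of (fun x => ?_) (fun a => rfl) rfl rfl
    rcases x with _ | _ | _ | x <;> simp [init]
  have hseq : ∀ {f : Fin n → ZMod 2} {w : Randomness n} {s : State} {τ : ℕ},
      Exec f w p (init [n, L, 2]) s τ →
        Exec f w (.seq (.set 2 (.const 2)) p) (init [n, L]) s (4 + τ) := by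
    intro f w s τ hE
    have h1 := exec_set f w (init [n, L]) 2 (.const 2)
    rw [Expr.eval_const, hinit] at h1
    exact Exec.seq h1 hE
  intro f hf
  obtain ⟨h1, h2⟩ := h f hf
  refine ⟨fun w => ?_, h2.trans ?_⟩
  · obtain ⟨s, τ, hE, hS, hT⟩ := h1 w
    exact ⟨s, _, hseq hE, hS, by push_cast; linarith⟩
  · have hprob : IsProbabilityMeasure (randomnessLaw D) := by
      unfold randomnessLaw; infer_instance
    refine measureReal_mono ?_
    rintro w ⟨s, τ, hE, hd⟩
    exact ⟨s, _, hseq hE, hd⟩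

theorem PACLearns.mono {n : ℕ} {p : Cmd} {input : List ℕ} {𝒞 : Set (Fin n → ZMod 2)}
    {D : PMF (Fin n → ZMod 2)} {ε δ S S' T T' : ℝ} (h : PACLearns p input 𝒞 D ε δ S T)
    (hS : S ≤ S') (hT : T ≤ T') : PACLearns p input 𝒞 D ε δ S' T' := by
  intro f hf
  obtain ⟨h1, h2⟩ := h f hf
  refine ⟨fun w => ?_, h2⟩
  obtain ⟨s, τ, hE, hS1, hT1⟩ := h1 w
  exact ⟨s, τ, hE, hS1.trans hS, hT1.trans hT⟩

theorem sampleSize_nonneg (n k t : ℕ) {δ : ℝ} (hδ : 0 < δ) (hδ1 : δ < 1) :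
    0 ≤ sampleSize n k t δ := by
  have hl : 0 ≤ Real.logb 2 (1 / δ) :=
    Real.logb_nonneg (by norm_num) (by rw [le_div_iff₀ hδ]; linarith)
  have hch : 0 ≤ Real.logb 2 (t.choose k) := by
    rcases Nat.eq_zero_or_pos (t.choose k) with h | h
    · simp [h]
    · exact Real.logb_nonneg (by norm_num) (by exact_mod_cast h)
  rw [sampleSize]
  positivity

/-- One more power of `n` absorbs a constant factor. -/
theorem runningTime_le_succ {γ δ : ℝ} {c n k t : ℕ} {x : ℝ} (hn : x ≤ n) :
    x * runningTime γ c n k t δ ≤ runningTime γ (c + 1) n k t δ := by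
  have hmax : 0 ≤ max 1 (Real.logb 2 (1 / δ)) := le_max_of_le_left zero_le_one
  rw [runningTime, runningTime, pow_succ]
  calc _ ≤ (n : ℝ) * (Real.exp (-(k : ℝ) / γ) * t.choose k * (n : ℝ) ^ c *
        max 1 (Real.logb 2 (1 / δ))) := by gcongr
    _ = _ := by ring

/-- The case `j = 0` of `two_pow_le_exp_mul_choose`; it lets additive constants be absorbed into the
running time. -/
theorem one_le_runningTime {γ δ : ℝ} {c n k t : ℕ} (hγ : 4 < γ) (hkt : 2 * k ≤ t) (hn : 1 ≤ n) :
    1 ≤ runningTime γ c n k t δ := by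
  have h1 := two_pow_le_exp_mul_choose (j := 0) hγ (by simpa using hkt)
  rw [zero_mul, pow_zero] at h1
  have h2 : (1 : ℝ) ≤ (n : ℝ) ^ c := one_le_pow₀ (by exact_mod_cast hn)
  exact one_le_mul_of_one_le_of_one_le (one_le_mul_of_one_le_of_one_le h1 h2) (le_max_left _ _)

/-- The overhead of the learner is absorbed by a power of `n`. -/
theorem eventually_overhead_le : ∃ c, ∀ C : ℕ, ∀ᶠ n in atTop,
    6 * (C * (n + 1) ^ 2 + overhead ((n + 2) * (n + 2))) ≤ n ^ c := by
  obtain ⟨K, d, h⟩ := polyBounded_overhead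
  -- The exponent must not depend on the programs for `k` and `t`, so it is fixed before `C`. The
  -- modulus is quadratic in `n`, which gives `2 * d`; two more powers cover `(n + 1) ^ 2`, and the
  -- last one swallows all constants once `n` is large.
  refine ⟨2 * d + 3, fun C => ?_⟩
  filter_upwards [eventually_ge_atTop (6 * (4 * C + K * 4 ^ d)), eventually_ge_atTop 3] with n h1 h2
  have h3 : (n + 2) * (n + 2) + 1 ≤ (2 * n) ^ 2 := by nlinarith
  calc 6 * (C * (n + 1) ^ 2 + overhead ((n + 2) * (n + 2)))
      ≤ 6 * (C * (2 * n) ^ 2 + K * ((2 * n) ^ 2) ^ d) := by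
        gcongr
        · omega
        · exact (h _).trans (by gcongr)
    _ = 6 * (4 * C * n ^ 2 + K * 4 ^ d * n ^ (2 * d)) := by
        have h4 : ((2 * n) ^ 2) ^ d = 4 ^ d * n ^ (2 * d) := by
          rw [mul_pow, mul_pow, ← pow_mul n]; norm_num
        rw [h4]; ring
    _ ≤ 6 * (4 * C * n ^ (2 * d + 2) + K * 4 ^ d * n ^ (2 * d + 2)) := by
        gcongr <;> omega
    _ = 6 * (4 * C + K * 4 ^ d) * n ^ (2 * d + 2) := by ring
    _ ≤ n * n ^ (2 * d + 2) := by gcongr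
    _ = n ^ (2 * d + 3) := by ring

theorem mainTheorem2 :
    ∃ C c : ℕ, ∀ k t : ℕ → ℕ,
      RAM.ConstructibleInQuadraticTime k → RAM.ConstructibleInQuadraticTime t →
      (fun n : ℕ => Real.log (Real.log n)) =o[atTop] (fun n => (k n : ℝ)) →
      (fun n => (k n : ℝ)) =o[atTop] (fun n => (t n : ℝ)) →
      (fun n => (t n : ℝ)) =o[atTop] (fun n : ℕ => (n : ℝ)) →
      ∀ γ : ℝ, 4 < γ →
        -- uniformly random examples
        (∃ (p : RAM.Cmd) (n₀ : ℕ), ∀ n ≥ n₀, ∀ δ : ℝ, 0 < δ → δ < 1 →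
          PACLearns p [n, ⌈Real.logb 2 (1 / δ)⌉₊] (PAR n (k n))
            (PMF.uniformOfFintype (Fin n → ZMod 2)) (1 / 2) δ
            (C * sampleSize n (k n) (t n) δ) (runningTime γ c n (k n) (t n) δ)) ∧
        -- examples from an arbitrary distribution
        (∃ (p : RAM.Cmd) (n₀ : ℕ), ∀ n ≥ n₀, ∀ δ ε : ℝ, 0 < δ → δ < 1 → 0 < ε → ε < 1 →
          ∀ D : PMF (Fin n → ZMod 2),
          PACLearns p [n, ⌈Real.logb 2 (1 / δ)⌉₊, ⌈1 / ε⌉₊] (PAR n (k n)) D ε δ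
            (C * sampleSize n (k n) (t n) δ / ε) (runningTime γ c n (k n) (t n) δ / ε)) := by
  obtain ⟨c, hc⟩ := eventually_overhead_le
  -- `36` is `18 / ε` at `ε = 1 / 2`; the additional power of `n` is for the overhead in the uniform
  -- case.
  refine ⟨36, c + 1, fun k t hk ht hlog hkt htn γ hγ => ?_⟩
  obtain ⟨pk, Ck, hpk⟩ := hk
  obtain ⟨pt, Ct, hpt⟩ := ht
  have hlarge : ∀ᶠ n in atTop, 6 ≤ n ∧ 1 ≤ k n ∧ 2 * k n ≤ t n ∧ t n ≤ n ∧
      6 * ((Ck + Ct) * (n + 1) ^ 2 + overhead ((n + 2) * (n + 2))) ≤ n ^ c := by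
    have hpos : ∀ᶠ n : ℕ in atTop, 0 < Real.log (Real.log n) :=
      (Real.tendsto_log_atTop.comp (Real.tendsto_log_atTop.comp
        tendsto_natCast_atTop_atTop)).eventually_gt_atTop 0
    filter_upwards [eventually_ge_atTop 6, hpos, hlog.bound one_pos,
      hkt.bound (show (0 : ℝ) < 1 / 2 by norm_num), htn.bound one_pos, hc (Ck + Ct)]
      with n h6 h1 h2 h3 h4 h5
    simp only [Real.norm_natCast, one_mul] at h2 h3 h4
    refine ⟨h6, ?_, ?_, by exact_mod_cast h4, h5⟩
    -- For large `n` the iterated logarithm is positive and bounded by `k n`, so `k n` cannot be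
    -- zero.
    · by_contra h
      have h0 : k n = 0 := by omega
      rw [h0, Real.norm_of_nonneg h1.le, Nat.cast_zero] at h2
      linarith
    · have : (2 * k n : ℝ) ≤ t n := by linarith
      exact_mod_cast this
  obtain ⟨n₀, hn₀⟩ := eventually_atTop.1 hlarge
  have hlearn : ∀ n ≥ n₀, ∀ δ ε : ℝ, 0 < δ → δ < 1 → 0 < ε → ε < 1 →
      ∀ D : PMF (Fin n → ZMod 2),
      PACLearns (learner pk pt) [n, ⌈Real.logb 2 (1 / δ)⌉₊, ⌈1 / ε⌉₊] (PAR n (k n)) D ε δ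
        (18 * sampleSize n (k n) (t n) δ / ε) (runningTime γ c n (k n) (t n) δ / ε) := by
    intro n hn δ ε hδ hδ1 hε hε1 D
    obtain ⟨h6, hk1, h2k, htn', hpoly⟩ := hn₀ n hn
    exact pacLearns_learner (fun f w => hpk n n f w) (fun f w => hpt n n f w) hk1 h2k htn' hpoly
      hγ hδ hδ1 hε hε1 D
  refine ⟨⟨.seq (.set 2 (.const 2)) (learner pk pt), n₀, fun n hn δ hδ hδ1 => ?_⟩,
    learner pk pt, n₀, fun n hn δ ε hδ hδ1 hε hε1 D => ?_⟩
  · obtain ⟨h6, -, h2k, -, -⟩ := hn₀ n hn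
    have h := hlearn n hn δ (1 / 2) hδ hδ1 (by norm_num) (by norm_num)
      (PMF.uniformOfFintype (Fin n → ZMod 2))
    have hceil : ⌈(1 : ℝ) / (1 / 2)⌉₊ = 2 := by norm_num
    rw [hceil] at h
    refine h.set_accuracy.mono (le_of_eq (by push_cast; ring)) ?_
    have h1 := one_le_runningTime (δ := δ) (c := c) hγ h2k (show 1 ≤ n by omega)
    have h2 := runningTime_le_succ (γ := γ) (δ := δ) (c := c) (k := k n) (t := t n)
      (show (6 : ℝ) ≤ n by exact_mod_cast h6)
    -- The `2` is `1 / ε`, the `4` is the cost of setting the accuracy register, and `n ≥ 6` pays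
    -- for both.
    calc _ = 2 * runningTime γ c n (k n) (t n) δ + 4 := by ring
      _ ≤ 6 * runningTime γ c n (k n) (t n) δ := by linarith
      _ ≤ _ := h2
  · obtain ⟨h6, -, h2k, -, -⟩ := hn₀ n hn
    refine (hlearn n hn δ ε hδ hδ1 hε hε1 D).mono ?_ ?_
    · have := sampleSize_nonneg n (k n) (t n) hδ hδ1
      gcongr
      norm_num
    · have h2 := runningTime_le_succ (γ := γ) (δ := δ) (c := c) (k := k n) (t := t n)
        (show (1 : ℝ) ≤ n by exact_mod_cast (show 1 ≤ n by omega))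
      rw [one_mul] at h2
      gcongr
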